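/- Let $(X,x)$ be a pointed topological space. Take copies $(X_n,x_n)$, $n\in\mathbb N=\{1,2,\dots\}$, of $(X,x)$, connect $x_n$ with $x_{n+1}$ by an arc for every $n$, and add one new point whose neighbourhoods contain almost all of the $X_n$ and almost all of the attached arcs; call the resulting space $Y$. The alternating cone $AC(X,x)$ is the quotient space of $Y\times[0,1]$ obtained by shrinking $X_n\times\{0\}$ to the point $(x_n,0)$ for every odd $n$ and $X_n\times\{1\}$ to the point $(x_n,1)$ for every even $n$. Theorem. For every path-connected space $X$ and every $x\in X$, the group $\pi_1(X)$ is trivial if and only if $\pi_2(AC(X,x))$ is trivial (for any choice of base points of the two homotopy groups). Corollary. For every $x\in S^1$, the space $AC(S^1,x)$ is a cell-like Peano continuum (a compact, connected, locally connected metrizable space of trivial shape, i.e. a space which, for every embedding in the Hilbert cube, is contractible in each neighbourhood of its image) of covering dimension $2$, and it is not aspherical (some homotopy group $\pi_n(AC(S^1,x))$ with $n\ge 2$ is nontrivial). -/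

import Mathlib

open scoped Topology

universe u

/-! The alternating cone. -/

/-- The parameter `1 / (n + 1)` of the unit interval. -/
noncomputable def attachParam (n : ℕ) : unitInterval :=
  ⟨1 / ((n : ℝ) + 1), by positivity, by
    rw [div_le_one (by positivity)]
    linarith [(Nat.cast_nonneg n : (0 : ℝ) ≤ n)]⟩

/-- The disjoint union of the interval `[0, 1]` and of countably many copies of `X`, before gluing.
The index `n` stands for the copy `X_{n+1}`, so that the copies are `X_1, X_2, X_3, …`. -/
inductive PreChain (X : Type u) : Type u
  | arc (t : unitInterval) : PreChain X
  | copy (n : ℕ) (p : X) : PreChain X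

/-- A set is open if its traces on the interval and on every copy of `X` are open and, in case it
contains the point `0` of the interval, it contains almost all of the copies of `X`. (Being open in
the interval, it then also contains almost all of the arcs `[1 / (n + 2), 1 / (n + 1)]`.) -/
instance PreChain.topology (X : Type u) [TopologicalSpace X] : TopologicalSpace (PreChain X) where
  IsOpen U :=
    IsOpen {t : unitInterval | PreChain.arc t ∈ U} ∧
    (∀ n : ℕ, IsOpen {p : X | PreChain.copy n p ∈ U}) ∧
    (PreChain.arc 0 ∈ U → ∃ N : ℕ, ∀ n, N ≤ n → ∀ p : X, PreChain.copy n p ∈ U)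
  isOpen_univ := ⟨by simp, by simp, by simp⟩
  isOpen_inter := by
    rintro U V ⟨hU1, hU2, hU3⟩ ⟨hV1, hV2, hV3⟩
    refine ⟨hU1.inter hV1, fun n => (hU2 n).inter (hV2 n), ?_⟩
    rintro ⟨h0U, h0V⟩
    obtain ⟨N, hN⟩ := hU3 h0U
    obtain ⟨M, hM⟩ := hV3 h0V
    exact ⟨max N M, fun n hn p =>
      ⟨hN n (le_trans (le_max_left _ _) hn) p, hM n (le_trans (le_max_right _ _) hn) p⟩⟩
  isOpen_sUnion := by
    intro S hS
    refine ⟨?_, fun n => ?_, ?_⟩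
    · have h : {t : unitInterval | PreChain.arc t ∈ ⋃₀ S}
          = ⋃ U ∈ S, {t : unitInterval | (PreChain.arc t : PreChain X) ∈ U} := by
        ext t; simp
      rw [h]
      exact isOpen_biUnion fun U hU => (hS U hU).1
    · have h : {p : X | PreChain.copy n p ∈ ⋃₀ S}
          = ⋃ U ∈ S, {p : X | PreChain.copy n p ∈ U} := by
        ext p; simp
      rw [h]
      exact isOpen_biUnion fun U hU => (hS U hU).2.1 n
    · rintro ⟨U, hU, h0⟩
      obtain ⟨N, hN⟩ := (hS U hU).2.2 h0
      exact ⟨N, fun n hn p => ⟨U, hU, hN n hn p⟩⟩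

/-- The base point of the copy with index `n` is glued to the point `1 / (n + 1)` of the
interval. -/
inductive ChainRel (X : Type u) (x : X) : PreChain X → PreChain X → Prop
  | glue (n : ℕ) : ChainRel X x (PreChain.copy n x) (PreChain.arc (attachParam n))

/-- The space `Y`: the copies `(X_n, x_n)` of `(X, x)`, with `x_n` and `x_{n+1}` connected by an
arc, together with one further point (the point `0` of the interval), each neighbourhood of which
contains almost all copies and almost all arcs. It carries the quotient topology. -/
abbrev Chain (X : Type u) [TopologicalSpace X] (x : X) : Type u := Quot (ChainRel X x)

/-- The point `p` of the copy with index `n`, as a point of `Y`. -/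
abbrev Chain.pt {X : Type u} [TopologicalSpace X] (x : X) (n : ℕ) (p : X) : Chain X x :=
  Quot.mk _ (PreChain.copy n p)

/-- The identifications in `Y × [0, 1]`: at height `0` the odd-numbered copies of `X` are shrunk to
their base points, and at height `1` the even-numbered ones. -/
inductive ACRel (X : Type u) [TopologicalSpace X] (x : X) :
    Chain X x × unitInterval → Chain X x × unitInterval → Prop
  | bottom (n : ℕ) (hn : Odd (n + 1)) (p : X) :
      ACRel X x (Chain.pt x n p, 0) (Chain.pt x n x, 0)
  | top (n : ℕ) (hn : Even (n + 1)) (p : X) :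
      ACRel X x (Chain.pt x n p, 1) (Chain.pt x n x, 1)

/-- The alternating cone `AC(X, x)`, with the quotient topology. -/
abbrev AC (X : Type u) [TopologicalSpace X] (x : X) : Type u := Quot (ACRel X x)

/-! Peano continua, cell-like spaces, dimension, asphericity. -/

/-- A Peano continuum: a compact, connected, locally connected metrizable space. -/
structure IsPeanoContinuum (K : Type u) [TopologicalSpace K] : Prop where
  compact : CompactSpace K
  metrizable : TopologicalSpace.MetrizableSpace K
  connected : ConnectedSpace K
  locallyConnected : LocallyConnectedSpace K

/-- A cell-like space: a nonempty compact metrizable space of trivial shape, that is, for every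
embedding in the Hilbert cube it is contractible inside each open neighbourhood of its image.
(Every compact metrizable space has such embeddings, and the condition does not depend on the
embedding.) -/
structure IsCellLike (K : Type u) [TopologicalSpace K] : Prop where
  compact : CompactSpace K
  metrizable : TopologicalSpace.MetrizableSpace K
  nonempty : Nonempty K
  contractibleIn : ∀ e : C(K, ℕ → unitInterval), Topology.IsEmbedding e →
    ∀ U : Set (ℕ → unitInterval), IsOpen U → ∀ hU : ∀ k, e k ∈ U,
      (⟨fun k => ⟨e k, hU k⟩, e.continuous.subtype_mk hU⟩ : C(K, U)).Nullhomotopic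

/-- Covering dimension at most `n`: every finite open cover has a finite open refinement such that
every point lies in at most `n + 1` of its members. -/
def CoveringDimLE (K : Type u) [TopologicalSpace K] (n : ℕ) : Prop :=
  ∀ 𝒰 : Set (Set K), 𝒰.Finite → (∀ U ∈ 𝒰, IsOpen U) → ⋃₀ 𝒰 = Set.univ →
    ∃ 𝒱 : Set (Set K), 𝒱.Finite ∧ (∀ V ∈ 𝒱, IsOpen V) ∧ ⋃₀ 𝒱 = Set.univ ∧
      (∀ V ∈ 𝒱, ∃ U ∈ 𝒰, V ⊆ U) ∧
      ∀ k : K, {V ∈ 𝒱 | k ∈ V}.encard ≤ (n : ℕ∞) + 1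

/-- Covering dimension exactly `n` (for a nonempty space). -/
def HasCoveringDim (K : Type u) [TopologicalSpace K] (n : ℕ) : Prop :=
  CoveringDimLE K n ∧ ∀ m < n, ¬ CoveringDimLE K m

/-- Asphericity (of a path-connected space): the homotopy groups in degrees `n ≥ 2` vanish. -/
def IsAspherical (K : Type u) [TopologicalSpace K] : Prop :=
  ∀ n : ℕ, 2 ≤ n → ∀ k : K, Subsingleton (π_ n K k)

/-!
Let `X` be path-connected and `Y` the chain of copies of `X`.

If `X` is simply connected, every sphere in the alternating cone is null-homotopic
(`AC.nullSphere_of_simplyConnected`). A sphere is a map of the plane, constant outside a square. Its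
component in `Y` is defined except where it passes through an end at which a copy of `X` is shrunk.
The projections to the single copies of `X` can be corrected near these points, because a map of the
boundary of a square into `X` extends to the square (`exists_continuous_eq_off`). After a homotopy,
the sphere therefore lifts to `Y × [0, 1]`. There it can be moved to the bottom, where the odd
copies disappear, and then to the top, where the even copies disappear, and the rest is a map into a
square (`AC.freelyNull_of_lift`).

If some loop `f` of `X` is not null-homotopic, a path `γ` runs along `Y` and traverses, before the
`n`-th group of four copies of `X`, the `n`-th power of the product of the commutators of the loops
`f` in the first two and in the last two of them (`Chain.exists_path_commutators`). Shrinking all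
odd copies or all even ones makes the commutators trivial and `γ` homotopic to a path of arcs, so
that there is a sphere in the alternating cone with equator `γ` (`AC.exists_sphere`). The
alternating cone is the union of the parts of positive height and of height below one, and a
connecting homomorphism of Mayer–Vietoris type shows that every homotopy invariant of paths in the
intersection `Y × (0, 1)`, additive and with values in an abelian group, vanishes on the equator of
a null-homotopic sphere (`PathCocycle.equator_eq_zero`). Such an invariant is obtained from a
quasimorphism of the free product of four copies of `π₁(X)` which takes the value `n` at the `n`-th
power of the product of commutators (`exists_quasimorphism`): evaluated on all groups of four
copies, it gives a homomorphism to the sequences of integers modulo the bounded ones. The value of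
`γ` is the unbounded sequence `n`, so the sphere is not null-homotopic
(`AC.subsingleton_fundamentalGroup`).

For the circle, the alternating cone is a continuous image of a square, and countably many
continuous functions separate its points (`AC.injective_planarCoord`); hence it is a Peano
continuum. It is cell-like because the self-maps which shrink all but finitely many copies of `X`
are null-homotopic and converge uniformly to the identity (`AC.nullhomotopic_trunc`,
`AC.exists_forall_mix_trunc_mem`). Its dimension is at most `2` since it is covered by arbitrarily
small open cells in three colours, with disjoint cells of equal colour
(`AC.exists_mem_coloredCell`), and at least `2` since it contains a square as a retract, to which a
theorem of Knaster, Kuratowski and Mazurkiewicz applies (`nonempty_inter_of_cover_square`). It is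
not aspherical by the first part.
-/

open Set Filter unitInterval Topology

/-! ### The chain of copies of a space -/

theorem coe_attachParam (n : ℕ) : (attachParam n : ℝ) = 1 / ((n : ℝ) + 1) := rfl

theorem attachParam_pos (n : ℕ) : 0 < (attachParam n : ℝ) := by
  rw [coe_attachParam]; positivity

theorem attachParam_injective : Function.Injective attachParam := by
  intro m n h
  have h' := congrArg (fun t : I => (t : ℝ)⁻¹) h
  simpa [coe_attachParam] using h'

theorem attachParam_ne_zero (n : ℕ) : attachParam n ≠ 0 := fun h =>
  (attachParam_pos n).ne' (congrArg Subtype.val h)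

theorem tendsto_coe_attachParam : Tendsto (fun n => (attachParam n : ℝ)) atTop (𝓝 0) :=
  tendsto_one_div_add_atTop_nhds_zero_nat

/-- Away from `0` the parameters `1 / (n + 1)` are isolated from any other point. -/
theorem eventually_ne_attachParam {t : I} (ht : t ≠ 0) :
    ∀ᶠ s in 𝓝 t, ∀ n, s = attachParam n → t = attachParam n := by
  have ht' : (0 : ℝ) < t := lt_of_le_of_ne t.2.1 fun h => ht (Subtype.ext h.symm)
  obtain ⟨N, hN⟩ := eventually_atTop.1
    (tendsto_coe_attachParam.eventually (gt_mem_nhds (half_pos ht')))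
  have h1 : ∀ᶠ s : I in 𝓝 t, (t : ℝ) / 2 < s :=
    continuous_subtype_val.continuousAt.eventually (lt_mem_nhds (half_lt_self ht'))
  have h2 : ∀ᶠ s : I in 𝓝 t, ∀ n < N, t ≠ attachParam n → s ≠ attachParam n := by
    refine (Set.finite_Iio N).eventually_all.2 fun n _ => ?_
    by_cases h : t = attachParam n
    · simp [h]
    · filter_upwards [isOpen_ne.mem_nhds h] with s hs _ using hs
  filter_upwards [h1, h2] with s hs1 hs2 n hn
  by_contra h
  rcases lt_or_ge n N with hnN | hnN
  · exact hs2 n hnN h hn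
  · have := hN n hnN
    rw [← hn] at this
    exact lt_asymm this hs1

theorem continuous_preChain {X : Type u} [TopologicalSpace X] {Z : Type*} [TopologicalSpace Z]
    {f : PreChain X → Z} (h1 : Continuous fun t => f (PreChain.arc t))
    (h2 : ∀ n, Continuous fun p => f (PreChain.copy n p))
    (h3 : ∀ U ∈ 𝓝 (f (PreChain.arc 0)), ∃ N : ℕ, ∀ n ≥ N, ∀ p, f (PreChain.copy n p) ∈ U) :
    Continuous f := by
  refine ⟨fun U hU => ⟨hU.preimage h1, fun n => hU.preimage (h2 n), fun h0 => ?_⟩⟩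
  exact h3 U (hU.mem_nhds h0)

namespace Chain

variable {X : Type u} [TopologicalSpace X] {x : X}

/-- The point with parameter `t` of the interval, as a point of `Y`. -/
def arc (x : X) (t : I) : Chain X x := Quot.mk _ (PreChain.arc t)

theorem arc_attachParam (n : ℕ) : arc x (attachParam n) = pt x n x :=
  (Quot.sound (ChainRel.glue n)).symm

/-- The map out of `Y` given by its values on the interval and on the copies of `X`. -/
def desc {Z : Type*} (α : I → Z) (β : ℕ → X → Z) (h : ∀ n, β n x = α (attachParam n)) :
    Chain X x → Z :=
  Quot.lift (fun | PreChain.arc t => α t | PreChain.copy n p => β n p) (by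
    rintro _ _ ⟨n⟩
    exact h n)

theorem continuous_desc {Z : Type*} [TopologicalSpace Z] {α : I → Z} {β : ℕ → X → Z}
    {h : ∀ n, β n x = α (attachParam n)} (h1 : Continuous α) (h2 : ∀ n, Continuous (β n))
    (h3 : ∀ U ∈ 𝓝 (α 0), ∃ N : ℕ, ∀ n ≥ N, ∀ p, β n p ∈ U) : Continuous (desc α β h) :=
  continuous_quot_lift _ (continuous_preChain h1 h2 h3)

/-- The retraction of `Y` onto the interval which shrinks every copy of `X`. -/
noncomputable def coord : Chain X x → I := desc id (fun n _ => attachParam n) fun _ => rfl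

open Classical in
/-- The retraction of `Y` onto the copy with index `n`, which shrinks everything else to the base
point. -/
noncomputable def retr (n : ℕ) : Chain X x → X :=
  desc (fun _ => x) (fun m p => if m = n then p else x) fun m => by simp

@[simp] theorem coord_arc (t : I) : coord (arc x t) = t := rfl
@[simp] theorem coord_pt (n : ℕ) (p : X) : coord (pt x n p) = attachParam n := rfl
@[simp] theorem retr_arc (n : ℕ) (t : I) : retr n (arc x t) = x := rfl
@[simp] theorem retr_pt_self (n : ℕ) (p : X) : retr n (pt x n p) = p := if_pos rfl
theorem retr_pt_of_ne {m n : ℕ} (h : m ≠ n) (p : X) : retr n (pt x m p) = x := if_neg h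

theorem continuous_coord : Continuous (coord : Chain X x → I) := by
  refine continuous_desc continuous_id (fun n => continuous_const) fun U hU => ?_
  have h : Tendsto attachParam atTop (𝓝 (0 : I)) := tendsto_subtype_rng.2 tendsto_coe_attachParam
  obtain ⟨N, hN⟩ := eventually_atTop.1 (h.eventually hU)
  exact ⟨N, fun n hn _ => hN n hn⟩

theorem continuous_retr (n : ℕ) : Continuous (retr n : Chain X x → X) := by
  refine continuous_desc continuous_const (fun m => ?_) fun U hU => ⟨n + 1, fun m hm p => ?_⟩
  · by_cases h : m = n
    · simpa only [h, if_true] using continuous_id'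
    · simpa [h] using continuous_const
  · rw [if_neg (by omega)]
    exact mem_of_mem_nhds hU

theorem cases (y : Chain X x) :
    (∃ n p, y = pt x n p) ∨ ∃ t, (∀ n, t ≠ attachParam n) ∧ y = arc x t := by
  induction y using Quot.ind with
  | mk a =>
    cases a with
    | copy n p => exact Or.inl ⟨n, p, rfl⟩
    | arc t =>
      by_cases h : ∃ n, t = attachParam n
      · obtain ⟨n, rfl⟩ := h
        exact Or.inl ⟨n, x, arc_attachParam n⟩
      · exact Or.inr ⟨t, not_exists.1 h, rfl⟩

theorem retr_of_coord_ne {y : Chain X x} {n : ℕ} (h : coord y ≠ attachParam n) :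
    retr n y = x := by
  rcases cases y with ⟨m, p, rfl⟩ | ⟨t, _, rfl⟩
  · exact retr_pt_of_ne (fun hmn => h (by rw [hmn]; rfl)) p
  · rfl

open Classical in
/-- The point of `Y` with given coordinates: parameter `t`, and `p n` in the copy with index `n` if
`t` is the parameter of that copy. -/
noncomputable def build (x : X) (t : I) (p : ℕ → X) : Chain X x :=
  if h : ∃ n, t = attachParam n then pt x h.choose (p h.choose) else arc x t

theorem build_attachParam (n : ℕ) (p : ℕ → X) : build x (attachParam n) p = pt x n (p n) := by
  have h : ∃ m, attachParam n = attachParam m := ⟨n, rfl⟩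
  have h' : h.choose = n := (attachParam_injective h.choose_spec).symm
  rw [build, dif_pos h, h']

theorem build_of_ne {t : I} (h : ∀ n, t ≠ attachParam n) (p : ℕ → X) :
    build x t p = arc x t := by
  rw [build, dif_neg]
  rintro ⟨n, hn⟩
  exact h n hn

@[simp] theorem coord_build (t : I) (p : ℕ → X) : coord (build x t p) = t := by
  by_cases h : ∃ n, t = attachParam n
  · obtain ⟨n, rfl⟩ := h
    rw [build_attachParam, coord_pt]
  · rw [build_of_ne (not_exists.1 h), coord_arc]

theorem retr_build {t : I} {p : ℕ → X} {n : ℕ} (h : t ≠ attachParam n → p n = x) :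
    retr n (build x t p) = p n := by
  by_cases h' : t = attachParam n
  · rw [h', build_attachParam, retr_pt_self]
  · rw [retr_of_coord_ne (by simpa using h'), h h']

@[simp] theorem build_coord_retr (y : Chain X x) : build x (coord y) (fun n => retr n y) = y := by
  rcases cases y with ⟨n, p, rfl⟩ | ⟨t, ht, rfl⟩
  · rw [coord_pt, build_attachParam, retr_pt_self]
  · rw [coord_arc, build_of_ne ht]

theorem ext {y z : Chain X x} (h : coord y = coord z) (h' : ∀ n, retr n y = retr n z) :
    y = z := by
  rw [← build_coord_retr y, ← build_coord_retr z, h, funext h']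

/-- The topology of `Y` is induced by the retractions onto the interval and onto the copies. -/
theorem isInducing : IsInducing fun y : Chain X x => (coord y, fun n => retr n y) := by
  have hc : Continuous fun y : Chain X x => (coord y, fun n => retr n y) :=
    continuous_coord.prodMk (continuous_pi continuous_retr)
  refine isInducing_iff_nhds.2 fun y => le_antisymm (hc.tendsto y).le_comap ?_
  intro V hV
  obtain ⟨W, hWV, hW, hyW⟩ := mem_nhds_iff.1 hV
  refine mem_of_superset ?_ hWV
  obtain ⟨hW1, hW2, hW3⟩ : IsOpen (Quot.mk (ChainRel X x) ⁻¹' W) := hW.preimage continuous_quot_mk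
  -- it suffices to find a neighbourhood in terms of finitely many coordinates
  suffices h : ∃ A ∈ 𝓝 (coord y), ∃ n : ℕ, ∃ B ∈ 𝓝 (retr n y), ∀ z, coord z ∈ A →
      retr n z ∈ B → z ∈ W by
    obtain ⟨A, hA, n, B, hB, h⟩ := h
    have h1 : ∀ᶠ q : I × (ℕ → X) in 𝓝 (coord y, fun n => retr n y), q.1 ∈ A :=
      continuous_fst.continuousAt.eventually hA
    have h2 : ∀ᶠ q : I × (ℕ → X) in 𝓝 (coord y, fun n => retr n y), q.2 n ∈ B :=
      ((continuous_apply n).comp continuous_snd).continuousAt.eventually hB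
    exact mem_comap.2 ⟨_, h1.and h2, fun z hz => h z hz.1 hz.2⟩
  have harc : ∀ t, arc x t ∈ W → {s | arc x s ∈ W} ∈ 𝓝 t := fun t ht => hW1.mem_nhds ht
  rcases cases y with ⟨n, p, rfl⟩ | ⟨t, ht, rfl⟩
  · -- a point of a copy
    rw [coord_pt]
    have hA : ∀ᶠ s in 𝓝 (attachParam n), (x ∈ {q | pt x n q ∈ W} → arc x s ∈ W) ∧
        ∀ m, s = attachParam m → attachParam n = attachParam m := by
      refine Eventually.and ?_ (eventually_ne_attachParam (attachParam_ne_zero n))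
      by_cases hx : pt x n x ∈ W
      · filter_upwards [harc (attachParam n) (by rwa [arc_attachParam])] with s hs _ using hs
      · exact Eventually.of_forall fun s h => absurd h hx
    refine ⟨_, hA, n, {q | pt x n q ∈ W}, by
      rw [retr_pt_self]; exact (hW2 n).mem_nhds hyW, fun z hz1 hz2 => ?_⟩
    rcases cases z with ⟨m, q, rfl⟩ | ⟨t, ht, rfl⟩
    · obtain rfl : n = m := attachParam_injective (hz1.2 m rfl)
      simpa using hz2
    · exact hz1.1 (by simpa using hz2)
  · rw [coord_arc]
    refine (fun ⟨A, hA, h⟩ => ⟨A, hA, 0, univ, univ_mem, fun z hz _ => h z hz⟩ : (∃ A ∈ 𝓝 t, ∀ z,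
      coord z ∈ A → z ∈ W) → _) ?_
    by_cases h0 : t = 0
    · subst h0
      obtain ⟨N, hN⟩ := hW3 hyW
      have h1 : ∀ᶠ s : I in 𝓝 0, ∀ n, s = attachParam n → N ≤ n := by
        have : ∀ᶠ s : I in 𝓝 0, ∀ n < N, s ≠ attachParam n :=
          (Set.finite_Iio N).eventually_all.2 fun n _ =>
            isOpen_ne.mem_nhds (attachParam_ne_zero n).symm
        filter_upwards [this] with s hs n hn
        by_contra h
        exact hs n (not_le.1 h) hn
      refine ⟨_, Filter.Eventually.and (harc 0 hyW) h1, fun z hz => ?_⟩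
      rcases cases z with ⟨m, q, rfl⟩ | ⟨t, ht, rfl⟩
      · exact hN m (hz.2 m rfl) q
      · exact hz.1
    · refine ⟨_, Eventually.and (harc t hyW) (eventually_ne_attachParam h0), fun z hz => ?_⟩
      rcases cases z with ⟨m, q, rfl⟩ | ⟨s, hs, rfl⟩
      · exact absurd (hz.2 m rfl) (ht m)
      · exact hz.1

theorem continuous_iff {T : Type*} [TopologicalSpace T] {g : T → Chain X x} :
    Continuous g ↔ (Continuous fun t => coord (g t)) ∧ ∀ n, Continuous fun t => retr n (g t) := by
  rw [isInducing.continuous_iff]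
  constructor
  · intro h
    exact ⟨continuous_fst.comp h, fun n => (continuous_apply n).comp (continuous_snd.comp h)⟩
  · rintro ⟨h1, h2⟩
    exact h1.prodMk (continuous_pi h2)

theorem continuousOn_iff {T : Type*} [TopologicalSpace T] {g : T → Chain X x} {s : Set T} :
    ContinuousOn g s ↔ ContinuousOn (fun t => coord (g t)) s ∧
      ∀ n, ContinuousOn (fun t => retr n (g t)) s := by
  simp only [continuousOn_iff_continuous_domRestrict]
  exact continuous_iff

theorem continuous_build {T : Type*} [TopologicalSpace T] {g : T → I} {p : T → ℕ → X}
    (hg : Continuous g) (hp : ∀ n, Continuous fun t => p t n)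
    (hx : ∀ t n, g t ≠ attachParam n → p t n = x) : Continuous fun t => build x (g t) (p t) := by
  refine continuous_iff.2 ⟨by simpa using hg, fun n => ?_⟩
  simpa only [retr_build (hx _ n)] using hp n

theorem continuous_arc : Continuous (arc x) := continuous_quot_mk.comp ⟨fun _ hU => hU.1⟩

theorem continuous_pt (n : ℕ) : Continuous (pt x n) :=
  continuous_quot_mk.comp ⟨fun _ hU => hU.2.1 n⟩

open Classical in
/-- The retraction of `Y` which shrinks the copies whose index is not in `s`. -/
noncomputable def collapse (s : Set ℕ) (y : Chain X x) : Chain X x :=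
  build x (coord y) fun n => if n ∈ s then retr n y else x

@[simp] theorem coord_collapse (s : Set ℕ) (y : Chain X x) : coord (collapse s y) = coord y := by
  simp [collapse]

theorem retr_collapse_of_mem {s : Set ℕ} {n : ℕ} (h : n ∈ s) (y : Chain X x) :
    retr n (collapse s y) = retr n y := by
  rw [collapse, retr_build fun h' => by rw [if_pos h, retr_of_coord_ne h'], if_pos h]

theorem retr_collapse_of_notMem {s : Set ℕ} {n : ℕ} (h : n ∉ s) (y : Chain X x) :
    retr n (collapse s y) = x := by
  classical
  rw [collapse, retr_build (n := n) (by simp [h]), if_neg h]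

theorem continuous_collapse (s : Set ℕ) : Continuous (collapse s : Chain X x → Chain X x) := by
  refine continuous_iff.2 ⟨by simpa using continuous_coord, fun n => ?_⟩
  by_cases h : n ∈ s
  · simpa only [retr_collapse_of_mem h] using continuous_retr n
  · simpa only [retr_collapse_of_notMem h] using continuous_const

end Chain

/-! ### The alternating cone -/

/-- The height of the end at which the copy with index `n` is shrunk. -/
def endHeight (n : ℕ) : I := if Even (n + 1) then 1 else 0

theorem endHeight_even {n : ℕ} (h : Even (n + 1)) : endHeight n = 1 := if_pos h
theorem endHeight_odd {n : ℕ} (h : ¬ Even (n + 1)) : endHeight n = 0 := if_neg h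

namespace AC

variable {X : Type u} [TopologicalSpace X] {x : X}

/-- The point of the alternating cone represented by a point of `Y` and a height. -/
def mk (y : Chain X x) (h : I) : AC X x := Quot.mk _ (y, h)

theorem continuous_mk : Continuous fun q : Chain X x × I => mk q.1 q.2 := continuous_quot_mk

theorem isQuotientMap_mk : IsQuotientMap fun q : Chain X x × I => mk q.1 q.2 :=
  isQuotientMap_quot_mk

theorem ind {P : AC X x → Prop} (h : ∀ y t, P (mk y t)) (q : AC X x) : P q := by
  induction q using Quot.ind with
  | mk a => exact h a.1 a.2

theorem mk_endHeight (n : ℕ) (p : X) :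
    mk (Chain.pt x n p) (endHeight n) = mk (Chain.pt x n x) (endHeight n) := by
  by_cases h : Even (n + 1)
  · rw [endHeight_even h]; exact Quot.sound (ACRel.top n h p)
  · rw [endHeight_odd h]; exact Quot.sound (ACRel.bottom n (Nat.not_even_iff_odd.1 h) p)

/-- The map out of the alternating cone induced by a map which is constant on the end of every
copy of `X` that is shrunk. -/
def desc {Z : Type*} (f : Chain X x → I → Z)
    (h : ∀ n p, f (Chain.pt x n p) (endHeight n) = f (Chain.pt x n x) (endHeight n)) :
    AC X x → Z :=
  Quot.lift (fun q => f q.1 q.2) (by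
    rintro _ _ (⟨n, hn, p⟩ | ⟨n, hn, p⟩)
    · simpa [endHeight_odd (Nat.not_even_iff_odd.2 hn)] using h n p
    · simpa [endHeight_even hn] using h n p)

@[simp] theorem desc_mk {Z : Type*} (f : Chain X x → I → Z) (h) (y : Chain X x) (t : I) :
    desc f h (mk y t) = f y t := rfl

theorem continuous_desc {Z : Type*} [TopologicalSpace Z] {f : Chain X x → I → Z}
    {h : ∀ n p, f (Chain.pt x n p) (endHeight n) = f (Chain.pt x n x) (endHeight n)}
    (hf : Continuous fun q : Chain X x × I => f q.1 q.2) : Continuous (desc f h) :=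
  continuous_quot_lift _ hf

/-- A family of maps out of the alternating cone, depending on a parameter in a locally compact
space, is continuous if the corresponding family of maps out of `Y × [0, 1]` is. -/
theorem continuous_desc_param {T Z : Type*} [TopologicalSpace T] [LocallyCompactSpace T]
    [TopologicalSpace Z] {f : T → Chain X x → I → Z}
    {h : ∀ t n p, f t (Chain.pt x n p) (endHeight n) = f t (Chain.pt x n x) (endHeight n)}
    (hf : Continuous fun q : T × Chain X x × I => f q.1 q.2.1 q.2.2) :
    Continuous fun q : T × AC X x => desc (f q.1) (h q.1) q.2 := by
  have hc : ∀ q : Chain X x × I, Continuous fun t => f t q.1 q.2 := fun q =>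
    hf.comp (continuous_id.prodMk continuous_const)
  let F : Chain X x → I → C(T, Z) := fun y s => ⟨fun t => f t y s, hc (y, s)⟩
  have hF : Continuous fun q : Chain X x × I => F q.1 q.2 :=
    ContinuousMap.continuous_of_continuous_uncurry _ (hf.comp continuous_swap)
  have hFd := continuous_desc (h := fun n p => by
    ext t; exact h t n p) hF
  have he : Continuous fun q : T × AC X x => desc F (fun n p => by ext t; exact h t n p) q.2 q.1 :=
    (hFd.comp continuous_snd).eval continuous_fst
  refine he.congr fun q => ?_
  obtain ⟨t, q⟩ := q
  induction q using ind with
  | h y s => rfl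

/-- A function on the alternating cone is continuous on an open set if it is so after composition
with the quotient map. -/
theorem continuousOn_of_comp_mk {Z : Type*} [TopologicalSpace Z] {f : AC X x → Z} {O : Set (AC X x)}
    (hO : IsOpen O)
    (hf : ContinuousOn (fun q : Chain X x × I => f (mk q.1 q.2)) {q | mk q.1 q.2 ∈ O}) :
    ContinuousOn f O := by
  rw [continuousOn_open_iff hO]
  intro t ht
  rw [← isQuotientMap_mk.isOpen_preimage]
  exact hf.isOpen_inter_preimage (hO.preimage continuous_mk) ht

/-- The coordinate along the interval. -/
noncomputable def coord : AC X x → I := desc (fun y _ => Chain.coord y) fun _ _ => rfl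

/-- The height. -/
def height : AC X x → I := desc (fun _ s => s) fun _ _ => rfl

@[simp] theorem coord_mk (y : Chain X x) (s : I) : coord (mk y s) = Chain.coord y := rfl
@[simp] theorem height_mk (y : Chain X x) (s : I) : height (mk y s) = s := rfl

theorem continuous_coord : Continuous (coord : AC X x → I) :=
  continuous_desc (Chain.continuous_coord.comp continuous_fst)

theorem continuous_height : Continuous (height : AC X x → I) := continuous_desc continuous_snd

open Classical in
/-- The projection of the alternating cone to `X` along the cylinder over the copy with index `n`.
It is set to be the base point at the apex, where it fails to be continuous. -/
noncomputable def retr (n : ℕ) : AC X x → X :=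
  desc (fun y s => if s = endHeight n then x else Chain.retr n y) fun m p => by
    by_cases h : m = n
    · simp [h]
    · simp [Chain.retr_pt_of_ne h]

theorem retr_mk_of_ne {n : ℕ} {s : I} (h : s ≠ endHeight n) (y : Chain X x) :
    retr n (mk y s) = Chain.retr n y := if_neg h

theorem retr_of_coord_ne {n : ℕ} {q : AC X x} (h : coord q ≠ attachParam n) : retr n q = x := by
  induction q using ind with
  | h y s =>
    by_cases hs : s = endHeight n
    · exact if_pos hs
    · rw [retr_mk_of_ne hs, Chain.retr_of_coord_ne h]

theorem retr_of_height_eq {n : ℕ} {q : AC X x} (h : height q = endHeight n) : retr n q = x := by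
  induction q using ind with
  | h y s => exact if_pos h

theorem continuousOn_retr (n : ℕ) : ContinuousOn (retr n : AC X x → X)
    {q | ¬ (coord q = attachParam n ∧ height q = endHeight n)} := by
  have h1 : IsOpen {q : AC X x | height q ≠ endHeight n} := isOpen_ne.preimage continuous_height
  have h2 : IsOpen {q : AC X x | coord q ≠ attachParam n} := isOpen_ne.preimage continuous_coord
  have hc1 : ContinuousOn (retr n : AC X x → X) {q | height q ≠ endHeight n} :=
    continuousOn_of_comp_mk h1 (((Chain.continuous_retr n).comp continuous_fst).continuousOn.congr
      fun q hq => retr_mk_of_ne hq q.1)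
  have hc2 : ContinuousOn (retr n : AC X x → X) {q | coord q ≠ attachParam n} :=
    continuousOn_const.congr fun q hq => retr_of_coord_ne hq
  intro q hq
  by_cases h : height q = endHeight n
  · exact (hc2.continuousAt (h2.mem_nhds fun h' => hq ⟨h', h⟩)).continuousWithinAt
  · exact (hc1.continuousAt (h1.mem_nhds h)).continuousWithinAt

/-- The square spanned by the interval and the height. -/
def sq (x : X) (t s : I) : AC X x := mk (Chain.arc x t) s

@[simp] theorem coord_sq (t s : I) : coord (sq x t s) = t := rfl
@[simp] theorem height_sq (t s : I) : height (sq x t s) = s := rfl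

theorem continuous_sq : Continuous fun q : I × I => sq x q.1 q.2 :=
  continuous_mk.comp ((Chain.continuous_arc.comp continuous_fst).prodMk continuous_snd)

/-- The component in `Y` of a point of the open part `0 < height < 1` of the alternating cone. -/
noncomputable def chainPart (q : AC X x) : Chain X x :=
  Chain.build x (coord q) fun n => retr n q

theorem chainPart_mk {y : Chain X x} {s : I} (h0 : s ≠ 0) (h1 : s ≠ 1) :
    chainPart (mk y s) = y := by
  have : ∀ n, retr n (mk y s) = Chain.retr n y := fun n => retr_mk_of_ne (by
    unfold endHeight; split_ifs <;> assumption) y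
  simp [chainPart, this]

theorem continuousOn_chainPart :
    ContinuousOn (chainPart : AC X x → Chain X x) {q | height q ≠ 0 ∧ height q ≠ 1} := by
  rw [Chain.continuousOn_iff]
  refine ⟨by simpa [chainPart] using continuous_coord.continuousOn, fun n => ?_⟩
  have : ∀ q : AC X x, Chain.retr n (chainPart q) = retr n q := fun q =>
    Chain.retr_build fun h => retr_of_coord_ne h
  simp only [this]
  refine (continuousOn_retr n).mono fun q hq h => ?_
  have := h.2
  unfold endHeight at this
  split_ifs at this
  exacts [hq.2 this, hq.1 this]

end AC

/-! ### Spheres as maps of the plane -/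

section Spheres

variable {Z : Type*} [TopologicalSpace Z]

/-- Every map of the plane into `Z` that is equal to `e` outside the open unit square (that is,
every map of the 2-sphere with base point value `e`) is null-homotopic relative to the complement of
the open unit square. The plane carries the sup norm. -/
def NullSphere (Z : Type*) [TopologicalSpace Z] (e : Z) : Prop :=
  ∀ F : C(Fin 2 → ℝ, Z), (∀ z, 1 ≤ ‖z‖ → F z = e) →
    ∃ K : C(ℝ × (Fin 2 → ℝ), Z), (∀ z, K (0, z) = F z) ∧ (∀ z, K (1, z) = e) ∧
      ∀ s z, 1 ≤ ‖z‖ → K (s, z) = e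

/-- A map of the plane is freely null-homotopic, through maps that are constant outside the open
unit square. -/
def FreelyNull (F : C(Fin 2 → ℝ, Z)) : Prop :=
  ∃ K : C(ℝ × (Fin 2 → ℝ), Z), (∀ z, K (0, z) = F z) ∧ (∃ q, ∀ z, K (1, z) = q) ∧
    ∀ s z z', 1 ≤ ‖z‖ → 1 ≤ ‖z'‖ → K (s, z) = K (s, z')

theorem exists_concat {T : Type*} [TopologicalSpace T] (K L : C(ℝ × T, Z))
    (h : ∀ z, K (1, z) = L (0, z)) : ∃ M : C(ℝ × T, Z), (∀ z, M (0, z) = K (0, z)) ∧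
      (∀ z, M (1, z) = L (1, z)) ∧
      ∀ s, ∃ s', (∀ z, M (s, z) = K (s', z)) ∨ ∀ z, M (s, z) = L (s', z) := by
  refine ⟨⟨fun q => if q.1 ≤ 1 / 2 then K (2 * q.1, q.2) else L (2 * q.1 - 1, q.2),
    Continuous.if_le (by fun_prop) (by fun_prop) (by fun_prop) (by fun_prop) ?_⟩, ?_, ?_, ?_⟩
  · rintro ⟨s, z⟩ (rfl : s = 1 / 2)
    norm_num [h]
  · intro z
    simp
  · intro z
    norm_num
  · intro s
    by_cases hs : s ≤ 1 / 2
    · exact ⟨2 * s, Or.inl fun z => if_pos hs⟩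
    · exact ⟨2 * s - 1, Or.inr fun z => if_neg hs⟩

theorem norm_const_one : ‖(fun _ => 1 : Fin 2 → ℝ)‖ = 1 := by
  rw [pi_norm_const]; simp

/-- A free null-homotopy can be replaced by one relative to the complement of the unit square: the
track of the base point is inserted in a collar, and then retracted. -/
theorem FreelyNull.exists_rel {F : C(Fin 2 → ℝ, Z)} (hF : FreelyNull F) {e : Z}
    (he : ∀ z, 1 ≤ ‖z‖ → F z = e) : ∃ K : C(ℝ × (Fin 2 → ℝ), Z), (∀ z, K (0, z) = F z) ∧
      (∀ z, K (1, z) = e) ∧ ∀ s z, 1 ≤ ‖z‖ → K (s, z) = e := by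
  obtain ⟨K, hK0, ⟨q, hq⟩, hK⟩ := hF
  set u : Fin 2 → ℝ := fun _ => 1 with hu
  have hu1 : 1 ≤ ‖u‖ := norm_const_one.ge
  have hKe : ∀ z, 1 ≤ ‖z‖ → K (0, z) = e := fun z hz => (hK0 z).trans (he z hz)
  -- the factor `c s` shrinks the square to the inside of the collar
  let c : ℝ → ℝ := fun s => 1 + max 0 (min s 1)
  let m : ℝ × (Fin 2 → ℝ) → ℝ := fun q => max 0 (min (max 0 (min q.1 1)) (2 - 2 * ‖q.2‖))
  have hcc : Continuous c := by fun_prop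
  have hmc : Continuous m := by fun_prop
  let L : C(ℝ × (Fin 2 → ℝ), Z) := ⟨fun q => K (m q, c q.1 • q.2), by fun_prop⟩
  let L' : C(ℝ × (Fin 2 → ℝ), Z) := ⟨fun q => K ((1 - q.1) * m (1, q.2), u), by fun_prop⟩
  have hm0 : ∀ s z, 1 ≤ ‖z‖ → m (s, z) = 0 := fun s z hz => by
    have : min (max 0 (min s 1)) (2 - 2 * ‖z‖) ≤ 0 := (min_le_right _ _).trans (by linarith)
    exact max_eq_left this
  have hc1 : ∀ s, 1 ≤ c s := fun s => le_add_of_nonneg_right (le_max_left _ _)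
  have hnorm : ∀ (s : ℝ) (z : Fin 2 → ℝ), 1 ≤ ‖z‖ → 1 ≤ ‖c s • z‖ := fun s z hz => by
    rw [norm_smul, Real.norm_of_nonneg (by linarith [hc1 s])]
    nlinarith [hc1 s]
  obtain ⟨M, hM0, hM1, hM⟩ := exists_concat L L' fun z => by
    change K (m (1, z), c 1 • z) = K ((1 - 0) * m (1, z), u)
    rw [sub_zero, one_mul]
    by_cases hz : ‖z‖ ≤ 1 / 2
    · have : m (1, z) = 1 := by
        simp only [m]
        rw [min_self, max_eq_right zero_le_one, min_eq_left (by linarith), max_eq_right zero_le_one]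
      rw [this, hq, hq]
    · refine hK _ _ _ ?_ hu1
      have : c 1 = 2 := by simp only [c]; norm_num
      rw [this, norm_smul, Real.norm_of_nonneg zero_le_two]
      linarith
  refine ⟨M, fun z => ?_, fun z => ?_, fun s z hz => ?_⟩
  · rw [hM0, ← hK0]
    change K (m (0, z), c 0 • z) = _
    have h1 : m (0, z) = 0 := by
      simp only [m]
      have : min (max 0 (min (0:ℝ) 1)) (2 - 2 * ‖z‖) ≤ 0 := (min_le_left _ _).trans (by simp)
      exact max_eq_left this
    have h2 : c 0 = 1 := by simp [c]
    rw [h1, h2, one_smul]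
  · rw [hM1]
    change K ((1 - 1) * m (1, z), u) = e
    rw [sub_self, zero_mul, hKe u hu1]
  · obtain ⟨s', h | h⟩ := hM s
    · rw [h]
      change K (m (s', z), c s' • z) = e
      rw [hm0 _ _ hz, hKe _ (hnorm _ _ hz)]
    · rw [h]
      change K ((1 - s') * m (1, z), u) = e
      rw [hm0 _ _ hz, mul_zero, hKe u hu1]

/-- Change of base point. -/
theorem NullSphere.of_joined {e q : Z} (h : NullSphere Z q) (hj : Joined e q) :
    NullSphere Z e := by
  intro F hF
  obtain ⟨p⟩ := hj
  refine FreelyNull.exists_rel ?_ hF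
  let c : ℝ → ℝ := fun s => max 0 (min s 1)
  have hcc : Continuous c := by fun_prop
  have hc0 : ∀ s, 0 ≤ c s := fun s => le_max_left _ _
  let N : C(ℝ × (Fin 2 → ℝ), Z) := ⟨fun q => if (1 + c q.1) * ‖q.2‖ ≤ 1 then F ((1 + c q.1) • q.2)
      else p.extend (min (c q.1) ((1 + c q.1) * ‖q.2‖ - 1)), by
    refine Continuous.if_le (by fun_prop) (p.continuous_extend.comp (by fun_prop)) (by fun_prop)
      (by fun_prop) ?_
    rintro ⟨s, z⟩ (hz : (1 + c s) * ‖z‖ = 1)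
    have h1 : min (c s) ((1 + c s) * ‖z‖ - 1) = 0 := by
      rw [hz, sub_self, min_eq_right (hc0 s)]
    change F ((1 + c s) • z) = p.extend (min (c s) ((1 + c s) * ‖z‖ - 1))
    rw [h1, p.extend_zero, hF]
    rw [norm_smul, Real.norm_of_nonneg (by linarith [hc0 s]), hz]⟩
  have hN : ∀ s z, 1 ≤ ‖z‖ → N (s, z) = p.extend (c s) := by
    intro s z hz
    change (if (1 + c s) * ‖z‖ ≤ 1 then F ((1 + c s) • z)
      else p.extend (min (c s) ((1 + c s) * ‖z‖ - 1))) = _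
    have h1 : c s ≤ (1 + c s) * ‖z‖ - 1 := by nlinarith [hc0 s]
    rw [min_eq_left h1]
    split_ifs with h2
    · have h3 : c s = 0 := le_antisymm (by linarith) (hc0 s)
      rw [h3, p.extend_zero, add_zero, one_smul, hF z hz]
    · rfl
  obtain ⟨K, hK0, hK1, hK⟩ := h (N.comp ⟨fun z => (1, z), by fun_prop⟩) fun z hz => by
    change N (1, z) = q
    rw [hN 1 z hz]
    simp [c]
  obtain ⟨M, hM0, hM1, hM⟩ := exists_concat N K fun z => (hK0 z).symm
  refine ⟨M, fun z => ?_, ⟨q, fun z => (hM1 z).trans (hK1 z)⟩, fun s z z' hz hz' => ?_⟩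
  · rw [hM0]
    change (if (1 + c 0) * ‖z‖ ≤ 1 then F ((1 + c 0) • z)
      else p.extend (min (c 0) ((1 + c 0) * ‖z‖ - 1))) = _
    have h0 : c 0 = 0 := by simp [c]
    rw [h0, add_zero, one_mul, one_smul]
    split_ifs with h1
    · rfl
    · rw [min_eq_left (by linarith), p.extend_zero, hF z (by linarith)]
  · obtain ⟨s', h | h⟩ := hM s
    · rw [h, h, hN _ _ hz, hN _ _ hz']
    · rw [h, h, hK _ _ hz, hK _ _ hz']

theorem one_le_norm_iff {z : Fin 2 → ℝ} : 1 ≤ ‖z‖ ↔ ∃ i, 1 ≤ |z i| := by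
  constructor
  · intro h
    by_contra! h'
    exact absurd ((pi_norm_lt_iff zero_lt_one).2 h') (not_lt.2 h)
  · rintro ⟨i, hi⟩
    exact hi.trans (norm_le_pi_norm z i)

/-- The affine identification of the unit cube with the unit ball of the sup norm. -/
def cubeToPlane (y : Fin 2 → I) : Fin 2 → ℝ := fun i => 2 * (y i : ℝ) - 1

/-- The retraction of the plane onto the unit ball of the sup norm, in the coordinates of the unit
cube. -/
noncomputable def planeToCube (z : Fin 2 → ℝ) : Fin 2 → I :=
  fun i => projIcc 0 1 zero_le_one ((z i + 1) / 2)

theorem continuous_cubeToPlane : Continuous cubeToPlane := by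
  unfold cubeToPlane; fun_prop

theorem continuous_planeToCube : Continuous planeToCube :=
  continuous_pi fun i => continuous_projIcc.comp (by fun_prop)

theorem planeToCube_cubeToPlane (y : Fin 2 → I) : planeToCube (cubeToPlane y) = y := by
  funext i
  have : (2 * (y i : ℝ) - 1 + 1) / 2 = y i := by ring
  simp only [planeToCube, cubeToPlane, this, projIcc_val]

theorem planeToCube_mem_boundary {z : Fin 2 → ℝ} (hz : 1 ≤ ‖z‖) :
    planeToCube z ∈ Cube.boundary (Fin 2) := by
  obtain ⟨i, hi⟩ := one_le_norm_iff.1 hz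
  refine ⟨i, ?_⟩
  rcases le_abs.1 hi with h | h
  · exact Or.inr (projIcc_of_right_le _ (by linarith))
  · exact Or.inl (projIcc_of_le_left _ (by linarith))

theorem one_le_norm_cubeToPlane {y : Fin 2 → I} (hy : y ∈ Cube.boundary (Fin 2)) :
    1 ≤ ‖cubeToPlane y‖ := by
  obtain ⟨i, hi⟩ := hy
  refine one_le_norm_iff.2 ⟨i, ?_⟩
  rcases hi with h | h
  · simp [cubeToPlane, h]
  · norm_num [cubeToPlane, h]

theorem cubeToPlane_planeToCube {z : Fin 2 → ℝ} (hz : ‖z‖ ≤ 1) :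
    cubeToPlane (planeToCube z) = z := by
  funext i
  have h := abs_le.1 ((norm_le_pi_norm z i).trans hz)
  simp only [planeToCube, cubeToPlane]
  rw [projIcc_of_mem _ ⟨by linarith [h.1], by linarith [h.2]⟩]
  ring

theorem subsingleton_pi_two_iff_nullSphere (e : Z) : Subsingleton (π_ 2 Z e) ↔ NullSphere Z e := by
  constructor
  · intro hs F hF
    let f : GenLoop (Fin 2) Z e := ⟨F.comp ⟨cubeToPlane, continuous_cubeToPlane⟩,
      fun y hy => hF _ (one_le_norm_cubeToPlane hy)⟩
    have h : GenLoop.Homotopic f GenLoop.const :=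
      Quotient.exact (hs.elim (⟦f⟧ : HomotopyGroup (Fin 2) Z e) ⟦GenLoop.const⟧)
    obtain ⟨H⟩ := h
    have hfp : ∀ z, f (planeToCube z) = F z := by
      intro z
      change F (cubeToPlane (planeToCube z)) = F z
      rcases le_total ‖z‖ 1 with hz | hz
      · rw [cubeToPlane_planeToCube hz]
      · rw [hF z hz, hF _ (one_le_norm_cubeToPlane (planeToCube_mem_boundary hz))]
    refine ⟨⟨fun q => H (projIcc 0 1 zero_le_one q.1, planeToCube q.2),
      H.continuous.comp ((continuous_projIcc.comp continuous_fst).prodMk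
        (continuous_planeToCube.comp continuous_snd))⟩, fun z => ?_, fun z => ?_, fun s z hz => ?_⟩
    · change H (projIcc 0 1 zero_le_one 0, planeToCube z) = F z
      rw [projIcc_left]
      exact (H.apply_zero _).trans (hfp z)
    · change H (projIcc 0 1 zero_le_one 1, planeToCube z) = e
      rw [projIcc_right]
      exact H.apply_one _
    · refine (H.eq_fst _ (planeToCube_mem_boundary hz)).trans ?_
      exact (hfp z).trans (hF z hz)
  · intro h
    have key : ∀ f : GenLoop (Fin 2) Z e, GenLoop.Homotopic f GenLoop.const := by
      intro f
      have hf : ∀ z, 1 ≤ ‖z‖ → f (planeToCube z) = e := fun z hz =>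
        f.2 _ (planeToCube_mem_boundary hz)
      obtain ⟨K, hK0, hK1, hK⟩ := h (f.1.comp ⟨planeToCube, continuous_planeToCube⟩) hf
      refine ⟨⟨⟨⟨fun q => K (q.1, cubeToPlane q.2), K.continuous.comp
        ((continuous_subtype_val.comp continuous_fst).prodMk
          (continuous_cubeToPlane.comp continuous_snd))⟩, fun y => ?_, fun y => ?_⟩, ?_⟩⟩
      · change K (((0 : I) : ℝ), cubeToPlane y) = f y
        rw [Icc.coe_zero, hK0]
        exact congrArg f (planeToCube_cubeToPlane y)
      · change K (((1 : I) : ℝ), cubeToPlane y) = e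
        rw [Icc.coe_one, hK1]
      · intro t y hy
        change K (t, cubeToPlane y) = f y
        rw [hK _ _ (one_le_norm_cubeToPlane hy)]
        exact (f.2 y hy).symm
    refine ⟨fun a b => ?_⟩
    induction a using Quotient.inductionOn with
    | h f =>
      induction b using Quotient.inductionOn with
      | h g => exact Quotient.sound ((key f).trans (key g).symm)

theorem subsingleton_pi_two_iff [PathConnectedSpace Z] (q e : Z) :
    Subsingleton (π_ 2 Z q) ↔ NullSphere Z e := by
  rw [subsingleton_pi_two_iff_nullSphere]
  exact ⟨fun h => h.of_joined (PathConnectedSpace.joined _ _),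
    fun h => h.of_joined (PathConnectedSpace.joined _ _)⟩

end Spheres

/-! ### Path-connectedness of the alternating cone -/

namespace AC

variable {X : Type u} [TopologicalSpace X] {x : X}

theorem _root_.pathConnectedSpace_unitInterval : PathConnectedSpace I :=
  isPathConnected_iff_pathConnectedSpace.1
    ((convex_Icc (0 : ℝ) 1).isPathConnected ⟨0, left_mem_Icc.2 zero_le_one⟩)

instance _root_.Chain.pathConnectedSpace [PathConnectedSpace X] :
    PathConnectedSpace (Chain X x) := by
  have := pathConnectedSpace_unitInterval
  have hY : ∀ y : Chain X x, Joined y (Chain.arc x 0) := by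
    intro y
    have harc : ∀ t, Joined (Chain.arc x t) (Chain.arc x 0) := fun t =>
      ((PathConnectedSpace.joined t 0).map Chain.continuous_arc)
    rcases Chain.cases y with ⟨n, p, rfl⟩ | ⟨t, _, rfl⟩
    · have h := (PathConnectedSpace.joined p x).map (Chain.continuous_pt (x := x) n)
      rw [← Chain.arc_attachParam] at h
      exact h.trans (harc _)
    · exact harc t
  exact ⟨⟨Chain.arc x 0⟩, fun y z => (hY y).trans (hY z).symm⟩

instance pathConnectedSpace [PathConnectedSpace X] : PathConnectedSpace (AC X x) :=
  have := pathConnectedSpace_unitInterval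
  AC.isQuotientMap_mk.surjective.pathConnectedSpace AC.continuous_mk

end AC

/-! ### Extension of maps of the plane into simply connected spaces -/

section Filling

variable {X : Type*} [TopologicalSpace X]

/-- In a simply connected space every map of the boundary of the square extends to the square. The
boundary is given by its bottom, right, left and top sides. -/
theorem exists_square [SimplyConnectedSpace X] {A B C D : X} (b : Path A B) (r : Path B D)
    (l : Path A C) (t : Path C D) : ∃ Q : C(I × I, X), (∀ s, Q (s, 0) = b s) ∧
      (∀ s, Q (1, s) = r s) ∧ (∀ s, Q (0, s) = l s) ∧ ∀ s, Q (s, 1) = t s := by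
  obtain ⟨H⟩ := SimplyConnectedSpace.paths_homotopic (b.trans r) (l.trans t)
  -- the square is swept out by antidiagonals, from the lower right half of its boundary to the
  -- upper left half
  let m : ℝ → ℝ := fun τ => min (2 * τ) 1
  let M : ℝ → ℝ := fun τ => max 0 (2 * τ - 1)
  have hsum : ∀ τ, m τ + M τ = 2 * τ := fun τ => by
    rcases le_total (2 * τ) 1 with h | h
    · simp only [m, M]; rw [min_eq_left h, max_eq_left (by linarith)]; ring
    · simp only [m, M]; rw [min_eq_right h, max_eq_right (by linarith)]; ring
  have hm : ∀ τ : I, m τ ∈ Icc (0 : ℝ) 1 := fun τ =>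
    ⟨le_min (by linarith [τ.2.1]) zero_le_one, min_le_right _ _⟩
  have hM : ∀ τ : I, M τ ∈ Icc (0 : ℝ) 1 := fun τ =>
    ⟨le_max_left _ _, max_le zero_le_one (by linarith [τ.2.2])⟩
  have hMm : ∀ τ : I, M τ ≤ m τ := fun τ =>
    max_le (hm τ).1 (le_min (by linarith [τ.2.2]) (by linarith [τ.2.2]))
  have hmc : Continuous m := by fun_prop
  have hMc : Continuous M := by fun_prop
  have mem : ∀ (u : I) {p q : ℝ}, p ∈ Icc (0 : ℝ) 1 → q ∈ Icc (0 : ℝ) 1 →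
      (1 - u : ℝ) * p + u * q ∈ Icc (0 : ℝ) 1 := fun u p q hp hq =>
    convex_Icc (0 : ℝ) 1 hp hq (by linarith [u.2.2]) u.2.1 (by ring)
  let f : C(I × I, I × I) :=
    ⟨fun q => (⟨(1 - q.1) * m q.2 + q.1 * M q.2, mem _ (hm _) (hM _)⟩,
      ⟨(1 - q.1) * M q.2 + q.1 * m q.2, mem _ (hM _) (hm _)⟩), by fun_prop⟩
  have hf1 : ∀ u τ, ((f (u, τ)).1 : ℝ) = (1 - u) * m τ + u * M τ := fun _ _ => rfl
  have hf2 : ∀ u τ, ((f (u, τ)).2 : ℝ) = (1 - u) * M τ + u * m τ := fun _ _ => rfl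
  have hsurj : Function.Surjective f := by
    rintro ⟨s, t⟩
    let τ : I := ⟨(s + t) / 2, by constructor <;> linarith [s.2.1, s.2.2, t.2.1, t.2.2]⟩
    have hτ : m τ + M τ = s + t := by rw [hsum]; simp only [τ]; ring
    have hMt : M τ ≤ t := max_le t.2.1 (by simp only [τ]; linarith [s.2.2])
    have htm : (t : ℝ) ≤ m τ := le_min (by simp only [τ]; linarith [s.2.1]) t.2.2
    rcases (hMm τ).eq_or_lt with h | h
    · refine ⟨(0, τ), Prod.ext (Subtype.ext ?_) (Subtype.ext ?_)⟩
      · rw [hf1]; simp only [Icc.coe_zero]; linarith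
      · rw [hf2]; simp only [Icc.coe_zero]; linarith
    · have h0 : (0 : ℝ) < m τ - M τ := by linarith
      refine ⟨(⟨(t - M τ) / (m τ - M τ), div_nonneg (by linarith) h0.le,
        (div_le_one h0).2 (by linarith)⟩, τ), Prod.ext (Subtype.ext ?_) (Subtype.ext ?_)⟩
      · rw [hf1]; field_simp; linear_combination (m τ - M τ) * hτ
      · rw [hf2]; field_simp; ring
  have hq : IsQuotientMap f := IsQuotientMap.of_surjective_continuous hsurj f.continuous
  have hH : ∀ p q, f p = f q → H p = H q := by
    rintro ⟨u, τ⟩ ⟨u', τ'⟩ h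
    have h1 := congrArg (fun q => (q.1 : ℝ)) h
    have h2 := congrArg (fun q => (q.2 : ℝ)) h
    simp only [hf1, hf2] at h1 h2
    have hτ : τ = τ' := Subtype.ext (by linarith [hsum τ, hsum τ'])
    subst hτ
    have h3 : (u - u' : ℝ) * (m τ - M τ) = 0 := by linear_combination -h1
    rcases mul_eq_zero.1 h3 with h4 | h4
    · rw [Subtype.ext (sub_eq_zero.1 h4)]
    · rcases le_total (2 * τ : ℝ) 1 with h5 | h5
      · have h0 : τ = 0 := Subtype.ext (by
          simp only [m, M] at h4
          rw [min_eq_left h5, max_eq_left (by linarith)] at h4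
          simp only [Icc.coe_zero]; linarith)
        rw [h0]; simp
      · have h0 : τ = 1 := Subtype.ext (by
          simp only [m, M] at h4
          rw [min_eq_right h5, max_eq_right (by linarith)] at h4
          simp only [Icc.coe_one]; linarith)
        rw [h0]; simp
  let Q : C(I × I, X) := hq.lift ⟨H, H.continuous⟩ hH
  have hQ : ∀ p, Q (f p) = H p := fun p => DFunLike.congr_fun (hq.lift_comp ⟨H, H.continuous⟩ hH) p
  have half : ∀ s : I, (s : ℝ) / 2 ∈ I := fun s => ⟨by linarith [s.2.1], by linarith [s.2.2]⟩
  have half' : ∀ s : I, (1 + s : ℝ) / 2 ∈ I := fun s => ⟨by linarith [s.2.1], by linarith [s.2.2]⟩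
  have m1 : ∀ s : I, m (s / 2) = s := fun s => by
    simp only [m]; rw [min_eq_left (by linarith [s.2.2])]; ring
  have M1 : ∀ s : I, M (s / 2) = 0 := fun s => by
    simp only [M]; exact max_eq_left (by linarith [s.2.2])
  have m2 : ∀ s : I, m ((1 + s) / 2) = 1 := fun s => by
    simp only [m]; exact min_eq_right (by linarith [s.2.1])
  have M2 : ∀ s : I, M ((1 + s) / 2) = s := fun s => by
    simp only [M]; rw [max_eq_right (by linarith [s.2.1])]; ring
  have tr1 : ∀ {A B C : X} (p : Path A B) (q : Path B C) (s : I),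
      p.trans q ⟨s / 2, half s⟩ = p s := fun p q s => by
    rw [Path.trans_apply, dif_pos (by simp only; linarith [s.2.2])]
    congr 1; ext; simp only; ring
  have tr2 : ∀ {A B C : X} (p : Path A B) (q : Path B C) (s : I),
      p.trans q ⟨(1 + s) / 2, half' s⟩ = q s := fun p q s => by
    rcases eq_or_lt_of_le s.2.1 with h0 | h0
    · have : s = 0 := Subtype.ext h0.symm
      subst this
      rw [Path.trans_apply, dif_pos (by simp)]
      simp
    · rw [Path.trans_apply, dif_neg (by simp only; linarith)]
      congr 1; ext; simp only; ring
  refine ⟨Q, fun s => ?_, fun s => ?_, fun s => ?_, fun s => ?_⟩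
  · have : f (0, ⟨s / 2, half s⟩) = (s, 0) := by
      ext <;> simp [hf1, hf2, m1, M1]
    rw [← this, hQ, H.apply_zero]
    exact tr1 b r s
  · have : f (0, ⟨(1 + s) / 2, half' s⟩) = (1, s) := by
      ext <;> simp [hf1, hf2, m2, M2]
    rw [← this, hQ, H.apply_zero]
    exact tr2 b r s
  · have : f (1, ⟨s / 2, half s⟩) = (0, s) := by
      ext <;> simp [hf1, hf2, m1, M1]
    rw [← this, hQ, H.apply_one]
    exact tr1 l t s
  · have : f (1, ⟨(1 + s) / 2, half' s⟩) = (s, 1) := by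
      ext <;> simp [hf1, hf2, m2, M2]
    rw [← this, hQ, H.apply_one]
    exact tr2 l t s

/-- The closed unit square with lower left corner `(i, j)`. -/
def gridCell (i j : ℤ) : Set (ℝ × ℝ) := Icc (i : ℝ) (i + 1) ×ˢ Icc (j : ℝ) (j + 1)

theorem locallyFinite_gridCell : LocallyFinite fun k : ℤ × ℤ => gridCell k.1 k.2 := by
  intro z
  refine ⟨Ioo (⌊z.1⌋ - 1 : ℝ) (⌊z.1⌋ + 2) ×ˢ Ioo (⌊z.2⌋ - 1 : ℝ) (⌊z.2⌋ + 2), ?_, ?_⟩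
  · refine prod_mem_nhds (Ioo_mem_nhds ?_ ?_) (Ioo_mem_nhds ?_ ?_) <;>
    linarith [Int.floor_le z.1, Int.lt_floor_add_one z.1, Int.floor_le z.2,
      Int.lt_floor_add_one z.2]
  · refine ((finite_Icc (⌊z.1⌋ - 2) (⌊z.1⌋ + 2)).prod
      (finite_Icc (⌊z.2⌋ - 2) (⌊z.2⌋ + 2))).subset ?_
    rintro ⟨i, j⟩ ⟨w, ⟨⟨h1, h2⟩, h3, h4⟩, ⟨h5, h6⟩, h7, h8⟩
    simp only at h1 h2 h3 h4 h5 h6 h7 h8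
    have a1 : ((⌊z.1⌋ - 2 : ℤ) : ℝ) < i := by push_cast; linarith
    have a2 : (i : ℝ) < ((⌊z.1⌋ + 2 : ℤ) : ℝ) := by push_cast; linarith
    have a3 : ((⌊z.2⌋ - 2 : ℤ) : ℝ) < j := by push_cast; linarith
    have a4 : (j : ℝ) < ((⌊z.2⌋ + 2 : ℤ) : ℝ) := by push_cast; linarith
    exact ⟨⟨(Int.cast_lt.1 a1).le, (Int.cast_lt.1 a2).le⟩,
      ⟨(Int.cast_lt.1 a3).le, (Int.cast_lt.1 a4).le⟩⟩

/-- Compatible maps on the cells of the unit grid define a continuous map of the plane. -/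
theorem exists_continuous_of_gridCell (Q : ℤ → ℤ → C(I × I, X))
    (h1 : ∀ i j s, Q i j (1, s) = Q (i + 1) j (0, s))
    (h2 : ∀ i j s, Q i j (s, 1) = Q i (j + 1) (s, 0)) :
    ∃ g : ℝ × ℝ → X, Continuous g ∧ ∀ (i j : ℤ) (s t : I), g (i + s, j + t) = Q i j (s, t) := by
  let g : ℝ × ℝ → X := fun z => Q ⌊z.1⌋ ⌊z.2⌋
    (⟨Int.fract z.1, Int.fract_nonneg _, (Int.fract_lt_one _).le⟩,
      ⟨Int.fract z.2, Int.fract_nonneg _, (Int.fract_lt_one _).le⟩)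
  have hg0 : ∀ (i j : ℤ) (s t : I), (s : ℝ) < 1 → (t : ℝ) < 1 →
      g (i + s, j + t) = Q i j (s, t) := by
    intro i j s t hs ht
    have e1 : ⌊(i + s : ℝ)⌋ = i := by
      rw [Int.floor_intCast_add, Int.floor_eq_zero_iff.2 ⟨s.2.1, hs⟩, add_zero]
    have e2 : ⌊(j + t : ℝ)⌋ = j := by
      rw [Int.floor_intCast_add, Int.floor_eq_zero_iff.2 ⟨t.2.1, ht⟩, add_zero]
    have e3 : Int.fract (i + s : ℝ) = s := by rw [Int.fract, e1]; ring
    have e4 : Int.fract (j + t : ℝ) = t := by rw [Int.fract, e2]; ring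
    simp only [g, e1, e2, e3, e4]
  have hg1 : ∀ (i j : ℤ) (s t : I), (t : ℝ) < 1 → g (i + s, j + t) = Q i j (s, t) := by
    intro i j s t ht
    rcases s.2.2.lt_or_eq with hs | hs
    · exact hg0 i j s t hs ht
    · have hs' : s = 1 := Subtype.ext hs
      have := hg0 (i + 1) j 0 t (by simp) ht
      rw [hs', h1, ← this]
      simp
  have hg : ∀ (i j : ℤ) (s t : I), g (i + s, j + t) = Q i j (s, t) := by
    intro i j s t
    rcases t.2.2.lt_or_eq with ht | ht
    · exact hg1 i j s t ht
    · have ht' : t = 1 := Subtype.ext ht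
      have := hg1 i (j + 1) s 0 (by simp)
      rw [ht', h2, ← this]
      simp
  refine ⟨g, ?_, hg⟩
  refine locallyFinite_gridCell.continuous ?_ (fun k => isClosed_Icc.prod isClosed_Icc) ?_
  · refine eq_univ_of_forall fun z => mem_iUnion.2 ⟨(⌊z.1⌋, ⌊z.2⌋), ?_⟩
    exact ⟨⟨Int.floor_le _, (Int.lt_floor_add_one _).le⟩,
      ⟨Int.floor_le _, (Int.lt_floor_add_one _).le⟩⟩
  · rintro ⟨i, j⟩
    have hc : Continuous fun z : ℝ × ℝ => Q i j (projIcc 0 1 zero_le_one (z.1 - i),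
        projIcc 0 1 zero_le_one (z.2 - j)) :=
      (Q i j).continuous.comp ((continuous_projIcc.comp (by fun_prop)).prodMk
        (continuous_projIcc.comp (by fun_prop)))
    refine hc.continuousOn.congr ?_
    rintro ⟨a, b⟩ ⟨⟨h1, h2⟩, h3, h4⟩
    simp only at h1 h2 h3 h4
    have ha : a - i ∈ Icc (0 : ℝ) 1 := ⟨by linarith, by linarith⟩
    have hb : b - j ∈ Icc (0 : ℝ) 1 := ⟨by linarith, by linarith⟩
    have := hg i j ⟨a - i, ha⟩ ⟨b - j, hb⟩
    simp only [add_sub_cancel] at this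
    change g (a, b) = Q i j (projIcc 0 1 zero_le_one (a - i), projIcc 0 1 zero_le_one (b - j))
    rw [this, projIcc_of_mem _ ha, projIcc_of_mem _ hb]

/-- A map into a simply connected space, continuous off `E`, can be made continuous by a change on
the cells of the unit grid which meet `E`. -/
theorem exists_continuous_eq_off_gridCell [SimplyConnectedSpace X] (E : Set (ℝ × ℝ))
    (r : ℝ × ℝ → X) (hr : ContinuousOn r Eᶜ) : ∃ g : ℝ × ℝ → X, Continuous g ∧
      ∀ i j, Disjoint (gridCell i j) E → EqOn g r (gridCell i j) := by
  classical
  let x₀ : X := Classical.arbitrary X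
  let V : ℤ → ℤ → X := fun i j => if ((i : ℝ), (j : ℝ)) ∈ E then x₀ else r (i, j)
  have hh : ∀ i j : ℤ, ∃ p : Path (V i j) (V (i + 1) j),
      (∀ t : I, ((i + t : ℝ), (j : ℝ)) ∉ E) → ∀ t : I, p t = r (i + t, j) := by
    intro i j
    by_cases h : ∀ t : I, ((i + t : ℝ), (j : ℝ)) ∉ E
    · have h0 : V i j = r (i, j) := if_neg (by simpa using h 0)
      have h1 : V (i + 1) j = r (i + 1, j) := by
        simp only [V]; rw [if_neg (by simpa using h 1)]; simp
      exact ⟨⟨⟨fun t => r (i + t, j), hr.comp_continuous (by fun_prop) h⟩, by simp [h0],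
        by simp [h1]⟩, fun _ _ => rfl⟩
    · exact ⟨(PathConnectedSpace.joined _ _).somePath, fun h' => absurd h' h⟩
  have hv : ∀ i j : ℤ, ∃ p : Path (V i j) (V i (j + 1)),
      (∀ t : I, ((i : ℝ), (j + t : ℝ)) ∉ E) → ∀ t : I, p t = r (i, j + t) := by
    intro i j
    by_cases h : ∀ t : I, ((i : ℝ), (j + t : ℝ)) ∉ E
    · have h0 : V i j = r (i, j) := if_neg (by simpa using h 0)
      have h1 : V i (j + 1) = r (i, j + 1) := by
        simp only [V]; rw [if_neg (by simpa using h 1)]; simp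
      exact ⟨⟨⟨fun t => r (i, j + t), hr.comp_continuous (by fun_prop) h⟩, by simp [h0],
        by simp [h1]⟩, fun _ _ => rfl⟩
    · exact ⟨(PathConnectedSpace.joined _ _).somePath, fun h' => absurd h' h⟩
  choose h hh using hh
  choose v hv using hv
  have hQ : ∀ i j : ℤ, ∃ Q : C(I × I, X), (∀ s, Q (s, 0) = h i j s) ∧
      (∀ s, Q (1, s) = v (i + 1) j s) ∧ (∀ s, Q (0, s) = v i j s) ∧
      (∀ s, Q (s, 1) = h i (j + 1) s) ∧
      ((∀ s t : I, ((i + s : ℝ), (j + t : ℝ)) ∉ E) → ∀ s t : I, Q (s, t) = r (i + s, j + t)) := by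
    intro i j
    by_cases hE : ∀ s t : I, ((i + s : ℝ), (j + t : ℝ)) ∉ E
    · refine ⟨⟨fun q => r (i + q.1, j + q.2), hr.comp_continuous (by fun_prop)
        fun q => hE q.1 q.2⟩, fun s => ?_, fun s => ?_, fun s => ?_, fun s => ?_, fun _ _ _ => rfl⟩
      · rw [hh i j fun t => by simpa using hE t 0]; simp
      · rw [hv (i + 1) j fun t => by simpa using hE 1 t]; simp
      · rw [hv i j fun t => by simpa using hE 0 t]; simp
      · rw [hh i (j + 1) fun t => by simpa using hE t 1]; simp
    · obtain ⟨Q, h1, h2, h3, h4⟩ := exists_square (h i j) (v (i + 1) j) (v i j) (h i (j + 1))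
      exact ⟨Q, h1, h2, h3, h4, fun h' => absurd h' hE⟩
  choose Q hQ1 hQ2 hQ3 hQ4 hQ5 using hQ
  obtain ⟨g, hg, hgQ⟩ := exists_continuous_of_gridCell Q
    (fun i j s => by rw [hQ2, hQ3]) (fun i j s => by rw [hQ4, hQ1])
  refine ⟨g, hg, ?_⟩
  rintro i j hd ⟨a, b⟩ ⟨⟨h1, h2⟩, h3, h4⟩
  simp only at h1 h2 h3 h4
  have e1 := hgQ i j ⟨a - i, by linarith, by linarith⟩ ⟨b - j, by linarith, by linarith⟩
  rw [hQ5 i j fun s t hst => disjoint_left.1 hd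
    ⟨⟨by simp only; linarith [s.2.1], by simp only; linarith [s.2.2]⟩,
      by simp only; linarith [t.2.1], by simp only; linarith [t.2.2]⟩ hst] at e1
  simpa using e1

/-- A map of the plane into a simply connected space which is continuous off a compact set can be
made continuous by a change inside any neighbourhood of that set. -/
theorem exists_continuous_eq_off [SimplyConnectedSpace X] {O E : Set (Fin 2 → ℝ)} (hO : IsOpen O)
    (hE : IsCompact E) (hEO : E ⊆ O) (r : (Fin 2 → ℝ) → X) (hr : ContinuousOn r Eᶜ) :
    ∃ g : (Fin 2 → ℝ) → X, Continuous g ∧ ∀ z, z ∉ O → g z = r z := by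
  obtain ⟨δ, hδ, hEδ⟩ := hE.exists_thickening_subset_open hO hEO
  let φ : ℝ × ℝ → Fin 2 → ℝ := fun q => (δ / 2) • ![q.1, q.2]
  let ψ : (Fin 2 → ℝ) → ℝ × ℝ := fun z => (z 0 / (δ / 2), z 1 / (δ / 2))
  have hφψ : ∀ z, φ (ψ z) = z := fun z => by
    have : δ ≠ 0 := hδ.ne'
    ext i; fin_cases i <;> simp [φ, ψ] <;> field_simp
  have hφ : Continuous φ := by
    refine continuous_pi fun i => ?_
    fin_cases i <;> simp [φ] <;> fun_prop
  have hψ : Continuous ψ := by fun_prop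
  obtain ⟨g, hg, hgr⟩ := exists_continuous_eq_off_gridCell (φ ⁻¹' E) (r ∘ φ)
    (hr.comp hφ.continuousOn fun q hq => hq)
  refine ⟨g ∘ ψ, hg.comp hψ, fun z hz => ?_⟩
  have hmem : ψ z ∈ gridCell ⌊(ψ z).1⌋ ⌊(ψ z).2⌋ :=
    ⟨⟨Int.floor_le _, (Int.lt_floor_add_one _).le⟩, Int.floor_le _, (Int.lt_floor_add_one _).le⟩
  have := hgr ⌊(ψ z).1⌋ ⌊(ψ z).2⌋ (disjoint_left.2 fun w hw hwE => hz ?_) hmem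
  · simpa [hφψ] using this
  · refine hEδ (Metric.mem_thickening_iff.2 ⟨φ w, hwE, ?_⟩)
    obtain ⟨⟨h1, h2⟩, h3, h4⟩ := hw
    obtain ⟨⟨k1, k2⟩, k3, k4⟩ := hmem
    have a1 : |(ψ z).1 - w.1| ≤ 1 := abs_le.2 ⟨by linarith, by linarith⟩
    have a2 : |(ψ z).2 - w.2| ≤ 1 := abs_le.2 ⟨by linarith, by linarith⟩
    rw [← hφψ z, dist_eq_norm]
    have : φ (ψ z) - φ w = (δ / 2) • ![(ψ z).1 - w.1, (ψ z).2 - w.2] := by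
      ext i; fin_cases i <;> simp [φ] <;> ring
    rw [this, norm_smul, Real.norm_of_nonneg (by linarith)]
    have hn : ‖![(ψ z).1 - w.1, (ψ z).2 - w.2]‖ ≤ 1 := by
      refine (pi_norm_le_iff_of_nonneg zero_le_one).2 fun i => ?_
      fin_cases i
      · exact a1
      · exact a2
    nlinarith

end Filling

/-! ### Simply connected spaces have alternating cones with trivial second homotopy group -/

/-- The point that divides the segment from `a` to `b` in the unit interval in the ratio
`t : 1 - t`. -/
def mix (t a b : I) : I :=
  ⟨(1 - t) * a + t * b, convex_Icc (0 : ℝ) 1 a.2 b.2 (by linarith [t.2.2]) t.2.1 (by ring)⟩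

@[simp] theorem mix_zero (a b : I) : mix 0 a b = a := Subtype.ext (by simp [mix])
@[simp] theorem mix_one (a b : I) : mix 1 a b = b := Subtype.ext (by simp [mix])
@[simp] theorem mix_self (t a : I) : mix t a a = a := Subtype.ext (by simp only [mix]; ring)

theorem continuous_mix : Continuous fun q : I × I × I => mix q.1 q.2.1 q.2.2 := by
  unfold mix; fun_prop

/-- Time in the unit interval, extended to the real line. -/
noncomputable def clampI (s : ℝ) : I := projIcc 0 1 zero_le_one s

@[simp] theorem clampI_zero : clampI 0 = 0 := projIcc_left _
@[simp] theorem clampI_one : clampI 1 = 1 := projIcc_right _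
theorem continuous_clampI : Continuous clampI := continuous_projIcc (h := zero_le_one)

@[simp] theorem clampI_coe (t : I) : clampI t = t := projIcc_val _ t

theorem FreelyNull.of_homotopy {Z : Type*} [TopologicalSpace Z] {F F' : C(Fin 2 → ℝ, Z)}
    (h : FreelyNull F') (K : I → (Fin 2 → ℝ) → Z) (hK : Continuous fun q : I × _ => K q.1 q.2)
    (h0 : ∀ z, K 0 z = F z) (h1 : ∀ z, K 1 z = F' z)
    (hout : ∀ s z z', 1 ≤ ‖z‖ → 1 ≤ ‖z'‖ → K s z = K s z') : FreelyNull F := by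
  obtain ⟨L, hL0, ⟨q, hq⟩, hL⟩ := h
  obtain ⟨M, hM0, hM1, hM⟩ := exists_concat (⟨fun q => K (clampI q.1) q.2, hK.comp
    ((continuous_clampI.comp continuous_fst).prodMk continuous_snd)⟩ : C(ℝ × (Fin 2 → ℝ), Z)) L
    fun z => by
      change K (clampI 1) z = _
      rw [clampI_one, h1, hL0]
  refine ⟨M, fun z => ?_, ⟨q, fun z => (hM1 z).trans (hq z)⟩, fun s z z' hz hz' => ?_⟩
  · rw [hM0]
    change K (clampI 0) z = _
    rw [clampI_zero, h0]
  · obtain ⟨s', h | h⟩ := hM s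
    · rw [h, h]; exact hout _ _ _ hz hz'
    · rw [h, h, hL _ _ _ hz hz']

namespace AC

variable {X : Type u} [TopologicalSpace X] {x : X}

/-- At either end, the copies that are shrunk there may be collapsed. -/
theorem mk_collapse (y : Chain X x) (e : I) :
    mk (Chain.collapse {n | endHeight n ≠ e} y) e = mk y e := by
  rcases Chain.cases y with ⟨n, p, rfl⟩ | ⟨t, ht, rfl⟩
  · by_cases h : endHeight n = e
    · have : Chain.collapse {n | endHeight n ≠ e} (Chain.pt x n p) = Chain.pt x n x := by
        refine Chain.ext (by simp) fun m => ?_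
        by_cases hm : n = m
        · subst hm
          rw [Chain.retr_collapse_of_notMem (by simpa using h), Chain.retr_pt_self]
        · rw [Chain.retr_pt_of_ne hm, Chain.retr_of_coord_ne]
          simpa using fun h' => hm (attachParam_injective h')
      rw [this, ← h, mk_endHeight n p]
    · congr 1
      refine Chain.ext (by simp) fun m => ?_
      by_cases hm : n = m
      · subst hm
        rw [Chain.retr_collapse_of_mem (by simpa using h)]
      · rw [Chain.retr_pt_of_ne hm, Chain.retr_of_coord_ne]
        simpa using fun h' => hm (attachParam_injective h')
  · congr 1
    refine Chain.ext (by simp) fun m => ?_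
    rw [Chain.retr_of_coord_ne (by simpa using ht m)]
    rfl

theorem mk_collapse_collapse (y : Chain X x) :
    mk (Chain.collapse {n | endHeight n ≠ 0} y) 1 = sq x (Chain.coord y) 1 := by
  rw [← mk_collapse, sq]
  congr 1
  refine Chain.ext (by simp) fun m => ?_
  rw [Chain.retr_arc]
  by_cases h : endHeight m = 1
  · exact Chain.retr_collapse_of_notMem (by simpa using h) _
  · rw [Chain.retr_collapse_of_mem h]
    refine Chain.retr_collapse_of_notMem ?_ _
    unfold endHeight at h ⊢
    split_ifs at h ⊢ with h' <;> simp_all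

/-- A sphere in the alternating cone that lifts to `Y × [0, 1]` can be contracted: it is pushed down
to height `0`, where every second copy of `X` disappears, and then up to height `1`, where the
others disappear. -/
theorem freelyNull_of_lift {y : (Fin 2 → ℝ) → Chain X x} {h : (Fin 2 → ℝ) → I} (hy : Continuous y)
    (hh : Continuous h) (hy' : ∀ z z', 1 ≤ ‖z‖ → 1 ≤ ‖z'‖ → y z = y z')
    (hh' : ∀ z z', 1 ≤ ‖z‖ → 1 ≤ ‖z'‖ → h z = h z') (F : C(Fin 2 → ℝ, AC X x))
    (hF : ∀ z, F z = mk (y z) (h z)) : FreelyNull F := by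
  have hcy : Continuous fun z => Chain.collapse {n | endHeight n ≠ 0} (y z) :=
    (Chain.continuous_collapse _).comp hy
  have hcd : Continuous fun z => Chain.coord (y z) := Chain.continuous_coord.comp hy
  refine FreelyNull.of_homotopy (F' := ⟨fun z => mk (y z) 0,
    continuous_mk.comp (hy.prodMk continuous_const)⟩) ?_ (fun s z => mk (y z) (mix s (h z) 0))
    (continuous_mk.comp ((hy.comp continuous_snd).prodMk (continuous_mix.comp
      (continuous_fst.prodMk ((hh.comp continuous_snd).prodMk continuous_const)))))
    (fun z => by simp [hF]) (fun z => by simp)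
    fun s z z' hz hz' => by rw [hy' z z' hz hz', hh' z z' hz hz']
  refine FreelyNull.of_homotopy (F' := ⟨fun z => sq x (Chain.coord (y z)) 1,
    continuous_sq.comp (hcd.prodMk continuous_const)⟩) ?_
    (fun s z => mk (Chain.collapse {n | endHeight n ≠ 0} (y z)) s)
    (continuous_mk.comp ((hcy.comp continuous_snd).prodMk continuous_fst))
    (fun z => mk_collapse (y z) 0) (fun z => mk_collapse_collapse (y z))
    fun s z z' hz hz' => by rw [hy' z z' hz hz']
  refine ⟨⟨fun q => sq x (mix (clampI q.1) (Chain.coord (y q.2)) 0) 1, continuous_sq.comp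
    ((continuous_mix.comp ((continuous_clampI.comp continuous_fst).prodMk
      ((hcd.comp continuous_snd).prodMk continuous_const))).prodMk continuous_const)⟩,
    fun z => by simp, ⟨sq x 0 1, fun z => by simp⟩, fun s z z' hz hz' => ?_⟩
  change sq x (mix _ (Chain.coord (y z)) 0) 1 = sq x (mix _ (Chain.coord (y z')) 0) 1
  rw [hy' z z' hz hz']

/-- A self-map of the interval which snaps a neighbourhood of each of the parameters `1 / (n + 1)`
to that parameter. -/
theorem exists_snap : ∃ θ : I → I, Continuous θ ∧ θ 0 = 0 ∧
    ∀ (n : ℕ) (a : I), |1 - (n + 1) * (a : ℝ)| < a / 4 → θ a = attachParam n := by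
  -- in the coordinate `u = 1 / a - 1` the parameters are the natural numbers, and the map is a
  -- continuous substitute for rounding
  let p : ℝ → ℝ := fun v => max (-v) (min (v - 1 / 2) (1 - v))
  have hp : Continuous fun u : ℝ => p (Int.fract u) :=
    ContinuousOn.comp_fract'' (f := p) (by fun_prop) (by norm_num [p])
  let g : ℝ → ℝ := fun u => u + p (Int.fract u)
  have hg : Continuous g := continuous_id.add hp
  have hg1 : ∀ u, (⌊u⌋ : ℝ) ≤ g u := fun u => by
    have : -Int.fract u ≤ p (Int.fract u) := le_max_left _ _
    have := Int.self_sub_fract u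
    simp only [g]; linarith
  have hg0 : ∀ u, 0 ≤ u → 0 ≤ g u := fun u hu =>
    le_trans (by exact_mod_cast Int.floor_nonneg.2 hu) (hg1 u)
  have hgn : ∀ (n : ℕ) (u : ℝ), |u - n| < 1 / 4 → g u = n := by
    intro n u hu
    obtain ⟨h1, h2⟩ := abs_lt.1 hu
    rcases le_or_gt (n : ℝ) u with h | h
    · have hfl : ⌊u⌋ = n := by
        rw [Int.floor_eq_iff]; push_cast; exact ⟨h, by linarith⟩
      have hfr : Int.fract u = u - n := by rw [Int.fract, hfl]; simp
      simp only [g, p, hfr]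
      rw [max_eq_left ((min_le_left _ _).trans (by linarith))]; ring
    · have hfl : ⌊u⌋ = n - 1 := by
        rw [Int.floor_eq_iff]; push_cast; exact ⟨by linarith, by linarith⟩
      have hfr : Int.fract u = u - n + 1 := by rw [Int.fract, hfl]; push_cast; ring
      simp only [g, p, hfr]
      rw [min_eq_right (by linarith), max_eq_right (by linarith)]; ring
  have hu0 : ∀ a : I, a ≠ 0 → 0 ≤ 1 / (a : ℝ) - 1 := fun a ha => by
    have : (0 : ℝ) < a := lt_of_le_of_ne a.2.1 fun h => ha (Subtype.ext h.symm)
    have := one_le_one_div this a.2.2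
    linarith
  let f : I → ℝ := fun a => if (a : ℝ) = 0 then 0 else 1 / (1 + g (1 / a - 1))
  have hne : ∀ a : I, (a : ℝ) ≠ 0 → a ≠ 0 := fun a h h' => h (congrArg Subtype.val h')
  have hf : ∀ a, f a ∈ Icc (0 : ℝ) 1 := fun a => by
    simp only [f]
    split_ifs with h
    · exact ⟨le_rfl, zero_le_one⟩
    · have h1 := hg0 _ (hu0 a (hne a h))
      exact ⟨by positivity, (div_le_one (by linarith)).2 (by linarith)⟩
  have hf2 : ∀ a : I, f a ≤ 2 * a := fun a => by
    rcases le_or_gt (1 / 2 : ℝ) a with h | h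
    · linarith [(hf a).2]
    · simp only [f]
      split_ifs with h0
      · rw [h0]; simp
      · have ha : (0 : ℝ) < a := lt_of_le_of_ne a.2.1 (Ne.symm h0)
        have h1 := (Int.sub_one_lt_floor (1 / (a : ℝ) - 1)).trans_le (hg1 (1 / (a : ℝ) - 1))
        have h2 : 1 / (2 * (a : ℝ)) ≤ 1 + g (1 / a - 1) := by
          have h3 : (1 : ℝ) ≤ 1 / (2 * a) := by rw [le_div_iff₀ (by positivity)]; linarith
          have h4 : 1 / (a : ℝ) = 2 * (1 / (2 * a)) := by field_simp
          linarith
        calc 1 / (1 + g (1 / a - 1)) ≤ 1 / (1 / (2 * (a : ℝ))) :=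
              one_div_le_one_div_of_le (by positivity) h2
          _ = 2 * a := one_div_one_div _
  have hfc : Continuous f := by
    rw [continuous_iff_continuousAt]
    intro a
    by_cases ha : (a : ℝ) = 0
    · have hfa : f a = 0 := if_pos ha
      rw [ContinuousAt, hfa]
      refine squeeze_zero (fun b => (hf b).1) hf2 ?_
      have : Tendsto (fun b : I => 2 * (b : ℝ)) (𝓝 a) (𝓝 (2 * a)) :=
        (continuous_const.mul continuous_subtype_val).continuousAt
      rwa [ha, mul_zero] at this
    · have h1 : f =ᶠ[𝓝 a] fun a : I => 1 / (1 + g (1 / a - 1)) := by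
        have : ∀ᶠ b : I in 𝓝 a, (b : ℝ) ≠ 0 :=
          (isOpen_ne.preimage continuous_subtype_val).mem_nhds ha
        filter_upwards [this] with b hb using if_neg hb
      refine ContinuousAt.congr ?_ h1.symm
      have h2 := hg0 _ (hu0 a (hne a ha))
      have h3 : ContinuousAt (fun a : I => (1 : ℝ) / a - 1) a :=
        (continuousAt_const.div continuous_subtype_val.continuousAt ha).sub continuousAt_const
      exact continuousAt_const.div (continuousAt_const.add
        (ContinuousAt.comp (g := g) hg.continuousAt h3)) (by linarith)
  refine ⟨fun a => ⟨f a, hf a⟩, hfc.subtype_mk hf, Subtype.ext (if_pos rfl), fun n a h => ?_⟩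
  have ha : (0 : ℝ) < a := by linarith [abs_nonneg (1 - (n + 1) * (a : ℝ))]
  refine Subtype.ext ?_
  have h1 : |1 / (a : ℝ) - 1 - n| < 1 / 4 := by
    have : 1 / (a : ℝ) - 1 - n = (1 - (n + 1) * a) / a := by field_simp; ring
    rw [this, abs_div, abs_of_pos ha, div_lt_iff₀ ha]
    linarith
  change f a = 1 / (n + 1)
  simp only [f]
  rw [if_neg ha.ne', hgn n _ h1, add_comm]

/-- If `X` is simply connected then the second homotopy group of the alternating cone vanishes: a
homotopy first makes neighbourhoods of all apices go to the apices. Then on the preimages of these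
neighbourhoods the component in `X` can be changed at will, and by simple connectedness it can be
changed so as to become continuous, so that the map lifts to `Y × [0, 1]`. -/
theorem nullSphere_of_simplyConnected [SimplyConnectedSpace X] :
    NullSphere (AC X x) (sq x 0 0) := by
  intro F hF
  refine FreelyNull.exists_rel ?_ hF
  obtain ⟨θ, hθ, hθ0, hθn⟩ := exists_snap
  have hθa : ∀ n, θ (attachParam n) = attachParam n := fun n => hθn n _ (by
    have : 1 - (n + 1) * (attachParam n : ℝ) = 0 := by rw [coe_attachParam]; field_simp; ring
    rw [this, abs_zero]
    linarith [attachParam_pos n])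
  let η : I → I → I := fun a s => clampI (((s : ℝ) - a / 4) / (1 - a / 2))
  have hden : ∀ a : I, (0 : ℝ) < 1 - a / 2 := fun a => by linarith [a.2.2]
  have hη : Continuous fun q : I × I => η q.1 q.2 :=
    continuous_clampI.comp (Continuous.div (by fun_prop) (by fun_prop) fun q => (hden q.1).ne')
  have hηend : ∀ n (a s : I), |(s : ℝ) - endHeight n| < a / 4 → η a s = endHeight n := by
    intro n a s h
    obtain ⟨h1, h2⟩ := abs_lt.1 h
    unfold endHeight at h1 h2 ⊢
    split_ifs at h1 h2 ⊢ with he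
    · refine projIcc_of_right_le _ ((one_le_div (hden a)).2 ?_)
      simp only [Icc.coe_one] at h1
      linarith
    · refine projIcc_of_le_left _ (div_nonpos_of_nonpos_of_nonneg ?_ (hden a).le)
      simp only [Icc.coe_zero] at h2
      linarith
  -- the homotopy of the identity of the alternating cone
  have hΘ : ∀ (t : I) (n : ℕ) (p : X), mk (Chain.build x (mix t (Chain.coord (Chain.pt x n p))
      (θ (Chain.coord (Chain.pt x n p)))) fun m => Chain.retr m (Chain.pt x n p))
      (mix t (endHeight n) (η (Chain.coord (Chain.pt x n p)) (endHeight n))) =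
      mk (Chain.build x (mix t (Chain.coord (Chain.pt x n x)) (θ (Chain.coord (Chain.pt x n x))))
        fun m => Chain.retr m (Chain.pt x n x))
      (mix t (endHeight n) (η (Chain.coord (Chain.pt x n x)) (endHeight n))) := by
    intro t n p
    have : η (attachParam n) (endHeight n) = endHeight n :=
      hηend n _ _ (by simpa using attachParam_pos n)
    simp only [Chain.coord_pt, hθa, mix_self, this, Chain.build_attachParam, Chain.retr_pt_self]
    exact mk_endHeight n p
  let Θ : I → AC X x → AC X x := fun t => desc (fun y s => mk (Chain.build x
    (mix t (Chain.coord y) (θ (Chain.coord y))) fun m => Chain.retr m y)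
    (mix t s (η (Chain.coord y) s))) (hΘ t)
  have hΘc : Continuous fun q : I × AC X x => Θ q.1 q.2 := by
    have hc : Continuous fun q : I × Chain X x × I => Chain.coord q.2.1 :=
      Chain.continuous_coord.comp (continuous_fst.comp continuous_snd)
    refine continuous_desc_param (f := fun t y s => mk (Chain.build x
      (mix t (Chain.coord y) (θ (Chain.coord y))) fun m => Chain.retr m y)
      (mix t s (η (Chain.coord y) s))) (h := hΘ) (continuous_mk.comp (Continuous.prodMk ?_ ?_))
    · refine Chain.continuous_build (continuous_mix.comp (continuous_fst.prodMk
        (hc.prodMk (hθ.comp hc)))) (fun n => (Chain.continuous_retr n).comp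
        (continuous_fst.comp continuous_snd)) fun q n h => ?_
      refine Chain.retr_of_coord_ne fun h' => h ?_
      change Chain.coord q.2.1 = attachParam n at h'
      simp only [Function.comp_apply, h', hθa, mix_self]
    · exact continuous_mix.comp (continuous_fst.prodMk ((continuous_snd.comp continuous_snd).prodMk
        (hη.comp (hc.prodMk (continuous_snd.comp continuous_snd)))))
  let a : (Fin 2 → ℝ) → I := fun z => coord (F z)
  let h : (Fin 2 → ℝ) → I := fun z => height (F z)
  have ha : Continuous a := continuous_coord.comp F.continuous
  have hh : Continuous h := continuous_height.comp F.continuous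
  let O : ℕ → Set (Fin 2 → ℝ) := fun n => {z | |1 - (n + 1) * (a z : ℝ)| < a z / 4 ∧
    |(h z : ℝ) - endHeight n| < a z / 4}
  have hE : ∀ n, ∃ g : (Fin 2 → ℝ) → X, Continuous g ∧ ∀ z, z ∉ O n → g z = retr n (F z) := by
    intro n
    have hEc : IsClosed {z | a z = attachParam n ∧ h z = endHeight n} :=
      (isClosed_eq ha continuous_const).inter (isClosed_eq hh continuous_const)
    refine exists_continuous_eq_off (E := {z | a z = attachParam n ∧ h z = endHeight n}) ?_ ?_ ?_ _
      ((continuousOn_retr n).comp F.continuous.continuousOn fun z hz => hz)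
    · have h1 : IsOpen {z | |1 - (n + 1) * (a z : ℝ)| < a z / 4} :=
        isOpen_lt (by fun_prop) (by fun_prop)
      exact h1.inter (isOpen_lt (f := fun z => |(h z : ℝ) - endHeight n|)
        (g := fun z => (a z : ℝ) / 4) (by fun_prop) (by fun_prop))
    · refine (isCompact_closedBall (0 : Fin 2 → ℝ) 1).of_isClosed_subset hEc fun z hz => ?_
      rw [mem_closedBall_zero_iff]
      by_contra hz1
      have : a z = 0 := by simp only [a, hF z (not_le.1 hz1).le, coord_sq]
      exact attachParam_ne_zero n (hz.1.symm.trans this)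
    · rintro z ⟨h1, h2⟩
      have : 1 - (n + 1) * (attachParam n : ℝ) = 0 := by rw [coe_attachParam]; field_simp; ring
      have hp := attachParam_pos n
      refine ⟨?_, ?_⟩
      · rw [h1, this, abs_zero]; linarith
      · rw [h1, h2, sub_self, abs_zero]; linarith
  choose R hR hRO using hE
  let y : (Fin 2 → ℝ) → Chain X x := fun z => Chain.build x (θ (a z)) fun m => R m z
  have hy : Continuous y := by
    refine Chain.continuous_build (hθ.comp ha) hR fun z m hm => ?_
    have hz : z ∉ O m := fun hz => hm (hθn m _ hz.1)
    rw [hRO m z hz]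
    exact retr_of_coord_ne fun h' => hm (by simp only [a, h', hθa])
  have hkey : ∀ z, Θ 1 (F z) = mk (y z) (η (a z) (h z)) := by
    intro z
    obtain ⟨y₀, s, hys⟩ : ∃ y₀ s, F z = mk y₀ s :=
      ind (P := fun q => ∃ y₀ s, q = mk y₀ s) (fun y s => ⟨y, s, rfl⟩) (F z)
    have haz : a z = Chain.coord y₀ := by simp only [a, hys, coord_mk]
    have hhz : h z = s := by simp only [h, hys, height_mk]
    have hΘz : Θ 1 (F z) = mk (Chain.build x (θ (a z)) fun m => Chain.retr m y₀)
        (η (a z) (h z)) := by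
      rw [hys, haz, hhz]
      simp only [Θ, desc_mk, mix_one]
    rw [hΘz]
    by_cases hz : ∃ m, z ∈ O m
    · obtain ⟨m, hz⟩ := hz
      simp only [y]
      rw [hθn m _ hz.1, hηend m _ _ hz.2, Chain.build_attachParam, Chain.build_attachParam,
        mk_endHeight m, mk_endHeight m (R m z)]
    · have hz' := not_exists.1 hz
      congr 1
      simp only [y]
      by_cases hm : ∃ m, θ (a z) = attachParam m
      · obtain ⟨m, hm⟩ := hm
        rw [hm, Chain.build_attachParam, Chain.build_attachParam, hRO m z (hz' m)]
        by_cases hs : s = endHeight m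
        · rw [retr_of_height_eq (by rw [hys, height_mk, hs]), Chain.retr_of_coord_ne]
          intro hc
          refine hz' m ⟨?_, ?_⟩
          · have : 1 - (m + 1) * (attachParam m : ℝ) = 0 := by
              rw [coe_attachParam]; field_simp; ring
            rw [haz, hc, this, abs_zero]
            linarith [attachParam_pos m]
          · rw [hhz, hs, sub_self, abs_zero, haz, hc]
            linarith [attachParam_pos m]
        · rw [hys, retr_mk_of_ne hs]
      · rw [Chain.build_of_ne (not_exists.1 hm), Chain.build_of_ne (not_exists.1 hm)]
  have hout : ∀ z, 1 ≤ ‖z‖ → a z = 0 ∧ h z = 0 := fun z hz => by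
    simp only [a, h, hF z hz, coord_sq, height_sq, and_self]
  refine FreelyNull.of_homotopy (F' := ⟨fun z => Θ 1 (F z),
    hΘc.comp (continuous_const.prodMk F.continuous)⟩) ?_ (fun t z => Θ t (F z))
    (hΘc.comp (continuous_fst.prodMk (F.continuous.comp continuous_snd))) (fun z => ?_)
    (fun z => rfl) fun s z z' hz hz' => by simp only [hF z hz, hF z' hz']
  · refine freelyNull_of_lift hy (hη.comp (ha.prodMk hh)) (fun z z' hz hz' => ?_)
      (fun z z' hz hz' => ?_) _ hkey
    · simp only [y]
      rw [(hout z hz).1, (hout z' hz').1, hθ0,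
        Chain.build_of_ne fun n => (attachParam_ne_zero n).symm,
        Chain.build_of_ne fun n => (attachParam_ne_zero n).symm]
    · simp only [Function.comp_apply]
      rw [(hout z hz).1, (hout z' hz').1, (hout z hz).2, (hout z' hz').2]
  · generalize F z = q
    induction q using ind with
    | h y s => simp only [Θ, desc_mk, mix_zero, Chain.build_coord_retr]

theorem simplyConnectedSpace_of_subsingleton [PathConnectedSpace X] {p : X}
    (h : Subsingleton (FundamentalGroup X p)) : SimplyConnectedSpace X := by
  refine simply_connected_iff_loops_nullhomotopic.2 ⟨inferInstance, fun {y} γ => ?_⟩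
  have e := FundamentalGroup.fundamentalGroupMulEquivOfPathConnected (X := X) y p
  have : Subsingleton (FundamentalGroup X y) := e.injective.subsingleton
  exact Quotient.exact (this.elim (Path.Homotopic.Quotient.mk γ : FundamentalGroup X y)
    (Path.Homotopic.Quotient.mk (Path.refl y)))

end AC

/-! ### Cocycles on paths -/

section Cocycles

/-- The restriction of a map to the segment from `p` to `q`, as a path. -/
def edge {E Z : Type*} [AddCommGroup E] [Module ℝ E] [TopologicalSpace E] [ContinuousAdd E]
    [ContinuousSMul ℝ E] [TopologicalSpace Z] (G : C(E, Z)) (p q : E) : C(I, Z) :=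
  ⟨fun t => G (p + (t : ℝ) • (q - p)), by fun_prop⟩

/-- A triangle in a convex set is parametrized by the plane. -/
theorem exists_triangle {E : Type*} [AddCommGroup E] [Module ℝ E] [TopologicalSpace E]
    [ContinuousAdd E] [ContinuousSMul ℝ E] {C : Set E} (hC : Convex ℝ C) {p q r : E} (hp : p ∈ C)
    (hq : q ∈ C) (hr : r ∈ C) : ∃ T : C(ℝ × ℝ, E), (∀ z, T z ∈ C) ∧
      (∀ t : I, T ((t : ℝ), 0) = p + (t : ℝ) • (q - p)) ∧
      (∀ t : I, T (1 - (t : ℝ), (t : ℝ)) = q + (t : ℝ) • (r - q)) ∧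
      ∀ t : I, T (0, (t : ℝ)) = p + (t : ℝ) • (r - p) := by
  let a : ℝ × ℝ → ℝ := fun z => max 0 (min z.1 1)
  let b : ℝ × ℝ → ℝ := fun z => max 0 (min z.2 (1 - a z))
  have ha : ∀ z, 0 ≤ a z := fun z => le_max_left _ _
  have ha1 : ∀ z, a z ≤ 1 := fun z => max_le zero_le_one (min_le_right _ _)
  have hb : ∀ z, 0 ≤ b z := fun z => le_max_left _ _
  have hab : ∀ z, b z ≤ 1 - a z := fun z => max_le (by linarith [ha1 z]) (min_le_right _ _)
  have hac : Continuous a := by fun_prop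
  have hbc : Continuous b := by fun_prop
  have haI : ∀ (t : I) (s : ℝ), a ((t : ℝ), s) = t := fun t s => by
    simp only [a]; rw [min_eq_left t.2.2, max_eq_right t.2.1]
  refine ⟨⟨fun z => (1 - a z - b z) • p + a z • q + b z • r, by fun_prop⟩, fun z => ?_,
    fun t => ?_, fun t => ?_, fun t => ?_⟩
  · have := hC.sum_mem (t := Finset.univ) (w := ![1 - a z - b z, a z, b z]) (z := ![p, q, r])
      (fun i _ => by
        fin_cases i
        · simpa using by linarith [hab z]
        · exact ha z
        · exact hb z) (by simp only [Fin.sum_univ_three]; simp; ring)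
          (fun i _ => by fin_cases i <;> assumption)
    simpa [Fin.sum_univ_three] using this
  · have h1 : b ((t : ℝ), 0) = 0 := by
      simp only [b]
      rw [haI, min_eq_left (by linarith [t.2.2]), max_self]
    change (1 - a _ - b _) • p + a _ • q + b _ • r = _
    rw [h1, haI]
    module
  · have h0 : a (1 - (t : ℝ), (t : ℝ)) = 1 - t := haI (unitInterval.symm t) t
    have h1 : b (1 - (t : ℝ), (t : ℝ)) = t := by
      simp only [b]
      rw [h0, sub_sub_cancel, min_self, max_eq_right t.2.1]
    change (1 - a _ - b _) • p + a _ • q + b _ • r = _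
    rw [h1, h0]
    module
  · have h0 : a (0, (t : ℝ)) = 0 := haI 0 t
    have h1 : b (0, (t : ℝ)) = t := by
      simp only [b]
      rw [h0, sub_zero, min_eq_left t.2.2, max_eq_right t.2.1]
    change (1 - a _ - b _) • p + a _ • q + b _ • r = _
    rw [h1, h0]
    module

/-- A function on paths satisfies the triangle law on a map of the plane. -/
def TriangleLaw {Z H : Type*} [TopologicalSpace Z] [Mul H] (ω : C(I, Z) → H)
    (G : C(ℝ × ℝ, Z)) : Prop :=
  ω (edge G (0, 0) (0, 1)) = ω (edge G (1, 0) (0, 1)) * ω (edge G (0, 0) (1, 0))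

/-- A homotopy invariant multiplicative function on paths, with values in a group: this amounts to
a functor on the fundamental groupoid. Both properties follow from multiplicativity along the
boundaries of (parametrized) triangles. The order of the factors is that of composition of maps. -/
structure PathCocycle (Z H : Type*) [TopologicalSpace Z] [Group H] where
  /-- The value on a path. -/
  toFun : C(I, Z) → H
  triangle : ∀ G, TriangleLaw toFun G

theorem TriangleLaw.of_convex {Z H : Type*} [TopologicalSpace Z] [Mul H] {ω : C(I, Z) → H}
    {E : Type*} [AddCommGroup E] [Module ℝ E] [TopologicalSpace E] [ContinuousAdd E]
    [ContinuousSMul ℝ E] {C : Set E} (hC : Convex ℝ C) {f : E → Z} (hf : ContinuousOn f C)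
    (hω : ∀ G : C(ℝ × ℝ, Z), (∀ z, G z ∈ f '' C) → TriangleLaw ω G) {p q r : E}
    (hp : p ∈ C) (hq : q ∈ C) (hr : r ∈ C) {a b c : C(I, Z)}
    (ha : ∀ t : I, a t = f (p + (t : ℝ) • (q - p))) (hb : ∀ t : I, b t = f (q + (t : ℝ) • (r - q)))
    (hc : ∀ t : I, c t = f (p + (t : ℝ) • (r - p))) : ω c = ω b * ω a := by
  obtain ⟨T, hT, h1, h2, h3⟩ := exists_triangle hC hp hq hr
  have := hω ⟨fun z => f (T z), hf.comp_continuous T.continuous hT⟩ fun z => ⟨T z, hT z, rfl⟩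
  have e1 : edge ⟨fun z => f (T z), hf.comp_continuous T.continuous hT⟩ (0, 0) (1, 0) = a := by
    ext t; rw [ha, ← h1]; simp [edge]
  have e2 : edge ⟨fun z => f (T z), hf.comp_continuous T.continuous hT⟩ (1, 0) (0, 1) = b := by
    ext t; rw [hb, ← h2]; simp [edge, sub_eq_add_neg]
  have e3 : edge ⟨fun z => f (T z), hf.comp_continuous T.continuous hT⟩ (0, 0) (0, 1) = c := by
    ext t; rw [hc, ← h3]; simp [edge]
  rwa [TriangleLaw, e1, e2, e3] at this

namespace PathCocycle

variable {Z H : Type*} [TopologicalSpace Z] [Group H] (Φ : PathCocycle Z H)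

instance : CoeFun (PathCocycle Z H) fun _ => C(I, Z) → H := ⟨toFun⟩

theorem map_of_convex {E : Type*} [AddCommGroup E] [Module ℝ E] [TopologicalSpace E]
    [ContinuousAdd E] [ContinuousSMul ℝ E] {C : Set E} (hC : Convex ℝ C) {f : E → Z}
    (hf : ContinuousOn f C) {p q r : E} (hp : p ∈ C) (hq : q ∈ C) (hr : r ∈ C) {a b c : C(I, Z)}
    (ha : ∀ t : I, a t = f (p + (t : ℝ) • (q - p))) (hb : ∀ t : I, b t = f (q + (t : ℝ) • (r - q)))
    (hc : ∀ t : I, c t = f (p + (t : ℝ) • (r - p))) : Φ c = Φ b * Φ a :=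
  TriangleLaw.of_convex hC hf (fun G _ => Φ.triangle G) hp hq hr ha hb hc

theorem map_const (z : Z) : Φ (ContinuousMap.const I z) = 1 := by
  have := Φ.map_of_convex (E := ℝ) (f := fun _ => z) convex_univ continuousOn_const (mem_univ 0)
    (mem_univ 0) (mem_univ 0) (a := ContinuousMap.const I z) (b := ContinuousMap.const I z)
    (c := ContinuousMap.const I z) (fun _ => rfl) (fun _ => rfl) (fun _ => rfl)
  simpa using this

theorem map_trans {a b c : Z} (γ : Path a b) (γ' : Path b c) :
    Φ (γ.trans γ').toContinuousMap = Φ γ'.toContinuousMap * Φ γ.toContinuousMap := by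
  refine Φ.map_of_convex (E := ℝ) (f := fun s => (γ.trans γ') (clampI s)) (p := 0) (q := 1 / 2)
    (r := 1) convex_univ ((γ.trans γ').continuous.comp continuous_clampI).continuousOn trivial
    trivial trivial (fun t => ?_) (fun t => ?_) fun t => ?_
  · have h : (0 : ℝ) + (t : ℝ) • (1 / 2 - 0) = t / 2 := by simp; ring
    have h' : (t : ℝ) / 2 ∈ I := ⟨by linarith [t.2.1], by linarith [t.2.2]⟩
    simp only [h]
    rw [clampI, projIcc_of_mem _ h', Path.trans_apply, dif_pos (by simp only; linarith [t.2.2])]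
    change γ t = _
    congr 1; ext; simp only; ring
  · have h : (1 / 2 : ℝ) + (t : ℝ) • (1 - 1 / 2) = (1 + t) / 2 := by simp; ring
    have h' : (1 + t : ℝ) / 2 ∈ I := ⟨by linarith [t.2.1], by linarith [t.2.2]⟩
    simp only [h]
    rw [clampI, projIcc_of_mem _ h', Path.trans_apply]
    change γ' t = _
    split_ifs with h0
    · have : t = 0 := Subtype.ext (le_antisymm (by simp only at h0; simp; linarith) t.2.1)
      subst this
      simp
    · congr 1; ext; simp only; ring
  · have h : (0 : ℝ) + (t : ℝ) • (1 - 0) = t := by simp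
    simp only [h, clampI_coe]
    rfl

theorem map_eq_of_homotopic {a b : Z} {γ γ' : Path a b} (h : γ.Homotopic γ') :
    Φ γ.toContinuousMap = Φ γ'.toContinuousMap := by
  obtain ⟨K⟩ := h
  let f : ℝ × ℝ → Z := fun z => K (clampI z.1, clampI z.2)
  have hf : ContinuousOn f univ := (K.continuous.comp ((continuous_clampI.comp
    continuous_fst).prodMk (continuous_clampI.comp continuous_snd))).continuousOn
  let d : C(I, Z) := ⟨fun t => K (t, t), by fun_prop⟩
  have h1 := Φ.map_of_convex convex_univ hf (p := (0, 0)) (q := (0, 1)) (r := (1, 1)) trivial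
    trivial trivial (a := γ.toContinuousMap) (b := ContinuousMap.const I b) (c := d)
    (fun t => by simp [f]) (fun t => by simp [f]) (fun t => by simp [f, d])
  have h2 := Φ.map_of_convex convex_univ hf (p := (0, 0)) (q := (1, 0)) (r := (1, 1)) trivial
    trivial trivial (a := ContinuousMap.const I a) (b := γ'.toContinuousMap) (c := d)
    (fun t => by simp [f]) (fun t => by simp [f]) (fun t => by simp [f, d])
  rw [map_const, one_mul] at h1
  rw [map_const, mul_one] at h2
  rw [← h1, h2]

/-- The homomorphism on the fundamental group induced by a cocycle. -/
def fundamentalGroupHom (b : Z) : FundamentalGroup Z b →* H where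
  toFun := Quotient.lift (fun γ : Path b b => Φ γ.toContinuousMap) fun _ _ h =>
    Φ.map_eq_of_homotopic h
  map_one' := Φ.map_const b
  map_mul' := by
    rintro ⟨γ⟩ ⟨γ'⟩
    exact Φ.map_trans γ' γ

theorem map_symm {a b : Z} (γ : Path a b) :
    Φ γ.symm.toContinuousMap = (Φ γ.toContinuousMap)⁻¹ := by
  have h : (γ.trans γ.symm).Homotopic (Path.refl a) := ⟨(Path.Homotopy.reflTransSymm γ).symm⟩
  have := Φ.map_eq_of_homotopic h
  rw [map_trans] at this
  exact eq_inv_of_mul_eq_one_left (this.trans (Φ.map_const a))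

end PathCocycle

/-- The tautological cocycle with values in the fundamental group, which closes up a path by means
of a choice of paths from the base point. -/
theorem exists_pathCocycle_fundamentalGroup {X : Type*} [TopologicalSpace X] [PathConnectedSpace X]
    (x : X) : ∃ Λ : PathCocycle X (FundamentalGroup X x), ∀ γ : Path x x,
      Λ γ.toContinuousMap = (Path.Homotopic.Quotient.mk γ : FundamentalGroup X x) := by
  classical
  let c : ∀ y, FundamentalGroupoid.mk x ⟶ FundamentalGroupoid.mk y := fun y =>
    if h : x = y then CategoryTheory.eqToHom (congrArg FundamentalGroupoid.mk h)
    else Path.Homotopic.Quotient.mk (PathConnectedSpace.somePath x y)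
  have hcx : c x = CategoryTheory.CategoryStruct.id _ := by simp [c]
  let hom : ∀ {y z : X}, Path y z → (FundamentalGroupoid.mk y ⟶ FundamentalGroupoid.mk z) :=
    fun γ => Path.Homotopic.Quotient.mk γ
  open CategoryTheory in
  let L : ∀ {y z : X}, Path y z → FundamentalGroup X x := fun {y z} γ =>
    c y ≫ hom γ ≫ Groupoid.inv (c z)
  have hL : ∀ {y z : X} (γ : Path y z),
      L ⟨γ.toContinuousMap, rfl, rfl⟩ = L γ := by
    rintro y z ⟨f, rfl, rfl⟩
    rfl
  have htr : ∀ {a b d : X} (γ : Path a b) (γ' : Path b d), L (γ.trans γ') = L γ' * L γ := by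
    intro a b d γ γ'
    have : hom (γ.trans γ') = CategoryTheory.CategoryStruct.comp (hom γ) (hom γ') := rfl
    rw [CategoryTheory.End.mul_def]
    simp [L, this]
  refine ⟨⟨fun τ => L ⟨τ, rfl, rfl⟩, fun G => ?_⟩, fun γ => ?_⟩
  · let s : ∀ p q : ℝ × ℝ, Path p q := fun p q =>
      ⟨⟨fun t => p + (t : ℝ) • (q - p), by fun_prop⟩, by simp, by simp⟩
    have hs : ∀ p q, L ⟨edge G p q, rfl, rfl⟩ = L ((s p q).map G.continuous) := fun p q =>
      hL ((s p q).map G.continuous)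
    have hh : hom ((s (0, 0) (0, 1)).map G.continuous) =
        hom (((s (0, 0) (1, 0)).trans (s (1, 0) (0, 1))).map G.continuous) :=
      Quotient.sound ((SimplyConnectedSpace.paths_homotopic (s (0, 0) (0, 1))
        ((s (0, 0) (1, 0)).trans (s (1, 0) (0, 1)))).map G)
    rw [TriangleLaw, hs, hs, hs, ← htr, ← Path.map_trans]
    simp only [L, hh]
  · refine (hL γ).trans ?_
    simp only [L, hcx]
    simp
    rfl

/-- A multiplicative function on short segments of a bounded convex set is the coboundary of a
function on points. -/
theorem exists_development {E H : Type*} [NormedAddCommGroup E] [NormedSpace ℝ E] [Group H]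
    {K : Set E} (hK : Convex ℝ K) (hKb : Bornology.IsBounded K) {δ : ℝ} (hδ : 0 < δ)
    (ω : E → E → H) (hω : ∀ p ∈ K, ∀ q ∈ K, ∀ r ∈ K, dist p q < δ → dist q r < δ → dist p r < δ →
      ω p r = ω q r * ω p q) :
    ∃ g : E → H, ∀ p ∈ K, ∀ q ∈ K, dist p q < δ / 2 → ω p q = g q * (g p)⁻¹ := by
  rcases K.eq_empty_or_nonempty with rfl | ⟨o, ho⟩
  · exact ⟨fun _ => 1, fun p hp => absurd hp (notMem_empty p)⟩
  obtain ⟨R, hR⟩ := hKb.subset_closedBall o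
  have hR' : ∀ p ∈ K, ‖p - o‖ ≤ R := fun p hp => by
    rw [← dist_eq_norm]; exact hR hp
  obtain ⟨N, hN⟩ := exists_nat_gt (R / (δ / 2))
  have hR0 : 0 ≤ R := (norm_nonneg _).trans (hR' o ho)
  have hN0 : (0 : ℝ) < N := lt_of_le_of_lt (by positivity) hN
  have hRN : R / N < δ / 2 := by
    rw [div_lt_iff₀ hN0]; rw [div_lt_iff₀ (by positivity)] at hN; linarith
  -- the points of a subdivision of the segment from `o` to `p`
  let pt : ℕ → E → E := fun k p => o + ((k : ℝ) / N) • (p - o)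
  have hpt : ∀ k ≤ N, ∀ p ∈ K, pt k p ∈ K := fun k hk p hp => by
    have h1 : (k : ℝ) / N ≤ 1 := (div_le_one hN0).2 (by exact_mod_cast hk)
    have h2 : (0 : ℝ) ≤ k / N := by positivity
    have := hK ho hp (sub_nonneg.2 h1) h2 (by ring)
    convert this using 1
    simp only [pt]; module
  have hd1 : ∀ k ≤ N, ∀ p q, dist (pt k p) (pt k q) ≤ dist p q := fun k hk p q => by
    have h1 : (k : ℝ) / N ≤ 1 := (div_le_one hN0).2 (by exact_mod_cast hk)
    have h2 : (0 : ℝ) ≤ k / N := by positivity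
    rw [dist_eq_norm, dist_eq_norm]
    have : pt k p - pt k q = ((k : ℝ) / N) • (p - q) := by simp only [pt]; module
    rw [this, norm_smul, Real.norm_of_nonneg h2]
    exact mul_le_of_le_one_left (norm_nonneg _) h1
  have hd2 : ∀ k, ∀ p ∈ K, dist (pt k p) (pt (k + 1) p) < δ / 2 := fun k p hp => by
    rw [dist_eq_norm]
    have : pt k p - pt (k + 1) p = (-(1 / N : ℝ)) • (p - o) := by
      simp only [pt]; push_cast; rw [add_div]; module
    rw [this, norm_smul, norm_neg, Real.norm_of_nonneg (by positivity)]
    calc 1 / (N : ℝ) * ‖p - o‖ ≤ 1 / N * R := by gcongr; exact hR' p hp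
      _ = R / N := by ring
      _ < δ / 2 := hRN
  let g : ℕ → E → H := fun k p => Nat.rec 1 (fun k h => ω (pt k p) (pt (k + 1) p) * h) k
  have hg : ∀ k p, g (k + 1) p = ω (pt k p) (pt (k + 1) p) * g k p := fun _ _ => rfl
  have key : ∀ k ≤ N, ∀ p ∈ K, ∀ q ∈ K, dist p q < δ / 2 →
      ω (pt k p) (pt k q) * g k p = g k q := by
    intro k
    induction k with
    | zero =>
      intro _ p hp q hq _
      have h0 : ∀ p, pt 0 p = o := fun p => by simp [pt]
      have h1 := hω o ho o ho o ho (by simpa) (by simpa) (by simpa)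
      simp only [h0, g]
      simpa using h1
    | succ k ih =>
      intro hk p hp q hq hpq
      have hk' : k ≤ N := by omega
      have a1 := hpt k hk' p hp
      have a2 := hpt k hk' q hq
      have a3 := hpt (k + 1) hk p hp
      have a4 := hpt (k + 1) hk q hq
      have b1 := (hd1 k hk' p q).trans_lt hpq
      have b2 := (hd1 (k + 1) hk p q).trans_lt hpq
      have b3 := hd2 k p hp
      have b4 := hd2 k q hq
      have b5 : dist (pt k p) (pt (k + 1) q) < δ :=
        (dist_triangle _ (pt k q) _).trans_lt (by linarith)
      rw [hg, hg, ← ih hk' p hp q hq hpq, ← mul_assoc, ← mul_assoc,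
        ← hω _ a1 _ a3 _ a4 (by linarith) (by linarith) b5,
        ← hω _ a1 _ a2 _ a4 (by linarith) (by linarith) b5]
  refine ⟨g N, fun p hp q hq hpq => ?_⟩
  have hNN : ∀ p, pt N p = p := fun p => by
    simp only [pt]; rw [div_self hN0.ne']; module
  rw [eq_mul_inv_iff_mul_eq]
  simpa only [hNN] using key N le_rfl p hp q hq hpq

theorem eq_of_eq_of_near {α : Type*} (f : ℝ → α) {ε : ℝ} (hε : 0 < ε)
    (h : ∀ s ∈ I, ∀ t ∈ I, |s - t| < ε → f s = f t) : f 0 = f 1 := by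
  obtain ⟨N, hN⟩ := exists_nat_gt (1 / ε)
  have hN0 : (0 : ℝ) < N := lt_trans (by positivity) hN
  have hNε : 1 / (N : ℝ) < ε := by
    rw [div_lt_iff₀ hN0]; rw [div_lt_iff₀ hε] at hN; linarith
  have hI : ∀ k ≤ N, (k : ℝ) / N ∈ I := fun k hk =>
    ⟨by positivity, (div_le_one hN0).2 (by exact_mod_cast hk)⟩
  have key : ∀ k ≤ N, f 0 = f (k / N) := by
    intro k
    induction k with
    | zero => simp
    | succ k ih =>
      intro hk
      rw [ih (by omega)]
      refine h _ (hI k (by omega)) _ (hI (k + 1) hk) ?_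
      have : (k : ℝ) / N - ((k + 1 : ℕ) : ℝ) / N = -(1 / N) := by push_cast; ring
      rwa [this, abs_neg, abs_of_pos (by positivity)]
  simpa [div_self hN0.ne'] using key N le_rfl

/-- A van Kampen theorem: compatible cocycles on the members of an open cover are the restrictions
of a cocycle. -/
theorem exists_pathCocycle_of_cover {Z H ι : Type*} [TopologicalSpace Z] [Group H]
    {N : ι → Set Z} (hN : ∀ i, IsOpen (N i)) (hcov : ∀ z, ∃ i, z ∈ N i) (ω : C(I, Z) → H)
    (hω : ∀ i (G : C(ℝ × ℝ, Z)), (∀ z, G z ∈ N i) → TriangleLaw ω G) :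
    ∃ Φ : PathCocycle Z H, ∀ i τ, (∀ t, τ t ∈ N i) → Φ τ = ω τ := by
  have hlaw : ∀ {E : Type} [NormedAddCommGroup E] [NormedSpace ℝ E] (G : C(E, Z)) (C : Set E)
      (i : ι),
      Convex ℝ C → (∀ z ∈ C, G z ∈ N i) → ∀ p ∈ C, ∀ q ∈ C, ∀ r ∈ C,
      ω (edge G p r) = ω (edge G q r) * ω (edge G p q) := by
    intro E _ _ G C i hC hCN p hp q hq r hr
    refine TriangleLaw.of_convex hC G.continuous.continuousOn (fun G' hG' => hω i G' fun z => ?_)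
      hp hq hr (fun _ => rfl) (fun _ => rfl) fun _ => rfl
    obtain ⟨w, hw, h⟩ := hG' z
    exact h ▸ hCN w hw
  have hdev : ∀ {E : Type} [NormedAddCommGroup E] [NormedSpace ℝ E] [ProperSpace E] (G : C(E, Z)),
      ∃ ε > 0, ∃ g : E → H, ∀ p ∈ Metric.closedBall (0 : E) 1, ∀ q ∈ Metric.closedBall (0 : E) 1,
      dist p q < ε → ω (edge G p q) = g q * (g p)⁻¹ := by
    intro E _ _ _ G
    obtain ⟨δ, hδ, hball⟩ := lebesgue_number_lemma_of_metric (c := fun i => G ⁻¹' N i)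
      (isCompact_closedBall (0 : E) 1) (fun i => (hN i).preimage G.continuous)
      fun z _ => mem_iUnion.2 (hcov (G z))
    obtain ⟨g, hg⟩ := exists_development (convex_closedBall (0 : E) 1)
      Metric.isBounded_closedBall hδ
      (fun p q => ω (edge G p q)) fun p hp q hq r hr h1 h2 h3 => by
        obtain ⟨i, hi⟩ := hball p hp
        exact hlaw G (Metric.ball p δ) i (convex_ball p δ) (fun z hz => hi hz) p
          (Metric.mem_ball_self hδ) q (by rwa [Metric.mem_ball, dist_comm]) r
          (by rwa [Metric.mem_ball, dist_comm])
    exact ⟨δ / 2, half_pos hδ, g, hg⟩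
  let ext : C(I, Z) → C(ℝ, Z) := fun τ =>
    ⟨fun t => τ (clampI t), τ.continuous.comp continuous_clampI⟩
  choose ε hε g hg using fun τ => hdev (ext τ)
  have hIball : ∀ t ∈ I, t ∈ Metric.closedBall (0 : ℝ) 1 := fun t ht => by
    rw [mem_closedBall_zero_iff, Real.norm_of_nonneg ht.1]; exact ht.2
  have huniq : ∀ (τ : C(I, Z)) (f : ℝ → H) (η : ℝ), 0 < η → (∀ s ∈ I, ∀ t ∈ I, |s - t| < η →
      ω (edge (ext τ) s t) = f t * (f s)⁻¹) → g τ 1 * (g τ 0)⁻¹ = f 1 * (f 0)⁻¹ := by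
    intro τ f η hη hf
    have := eq_of_eq_of_near (fun t => (f t)⁻¹ * g τ t) (lt_min hη (hε τ)) fun s hs t ht hst => by
      have h1 := hf s hs t ht (hst.trans_le (min_le_left _ _))
      rw [hg τ s (hIball s hs) t (hIball t ht) (hst.trans_le (min_le_right _ _))] at h1
      have h2 : g τ t = f t * (f s)⁻¹ * g τ s := by rw [← h1]; group
      simp only [h2]; group
    have h2 : g τ 1 = f 1 * ((f 0)⁻¹ * g τ 0) := by rw [this]; group
    rw [h2]; group
  refine ⟨⟨fun τ => g τ 1 * (g τ 0)⁻¹, fun G => ?_⟩, fun i τ hτ => ?_⟩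
  · obtain ⟨η, hη, f, hf⟩ := hdev G
    have hedge : ∀ p ∈ Metric.closedBall (0 : ℝ × ℝ) 1, ∀ q ∈ Metric.closedBall (0 : ℝ × ℝ) 1,
        g (edge G p q) 1 * (g (edge G p q) 0)⁻¹ = f q * (f p)⁻¹ := by
      intro p hp q hq
      have hmem : ∀ t ∈ I, p + t • (q - p) ∈ Metric.closedBall (0 : ℝ × ℝ) 1 := fun t ht => by
        have := convex_closedBall (0 : ℝ × ℝ) 1 hp hq (sub_nonneg.2 ht.2) ht.1 (by ring)
        convert this using 1; module
      have := huniq (edge G p q) (fun t => f (p + t • (q - p))) (η / (‖q - p‖ + 1))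
        (by positivity) fun s hs t ht hst => by
          rw [← hf _ (hmem s hs) _ (hmem t ht)]
          · congr 1
            ext u
            have hu : s + (u : ℝ) • (t - s) ∈ I := by
              have := convex_Icc (0 : ℝ) 1 hs ht (sub_nonneg.2 u.2.2) u.2.1 (by ring)
              convert this using 1; simp only [smul_eq_mul]; ring
            change G (p + ((clampI (s + (u : ℝ) • (t - s)) : I) : ℝ) • (q - p)) =
              G (p + s • (q - p) + (u : ℝ) • (p + t • (q - p) - (p + s • (q - p))))
            rw [clampI, projIcc_of_mem _ hu]
            congr 1
            simp only [smul_eq_mul]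
            module
          · rw [dist_eq_norm]
            have : p + s • (q - p) - (p + t • (q - p)) = (s - t) • (q - p) := by module
            rw [this, norm_smul, Real.norm_eq_abs]
            rw [lt_div_iff₀ (by positivity)] at hst
            nlinarith [abs_nonneg (s - t)]
      simpa using this
    have h00 : ((0, 0) : ℝ × ℝ) ∈ Metric.closedBall (0 : ℝ × ℝ) 1 := by simp
    have h10 : ((1, 0) : ℝ × ℝ) ∈ Metric.closedBall (0 : ℝ × ℝ) 1 := by simp [Prod.norm_def]
    have h01 : ((0, 1) : ℝ × ℝ) ∈ Metric.closedBall (0 : ℝ × ℝ) 1 := by simp [Prod.norm_def]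
    rw [TriangleLaw, hedge _ h00 _ h01, hedge _ h10 _ h01, hedge _ h00 _ h10]
    group
  · have hτ' := hlaw (ext τ) univ i convex_univ fun z _ => hτ _
    have := huniq τ (fun t => ω (edge (ext τ) 0 t)) 1 zero_lt_one fun s _ t _ _ => by
      rw [hτ' 0 trivial s trivial t trivial]; group
    change g τ 1 * (g τ 0)⁻¹ = ω τ
    rw [this]
    have h1 : edge (ext τ) 0 1 = τ := by ext t; simp [edge, ext]
    have h2 := hτ' 0 trivial 0 trivial 0 trivial
    have h3 : ω (edge (ext τ) 0 0) = 1 := by simpa using h2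
    rw [h1, h3, inv_one, mul_one]

end Cocycles

/-! ### A counting quasimorphism on a free product -/

section FreeProduct

open Monoid

variable {ι G : Type*} [Group G]

/-- The lists of letters that form reduced words of the free product of copies of `G`. -/
def IsReducedList (L : List (Σ _ : ι, G)) : Prop :=
  (∀ l ∈ L, l.2 ≠ 1) ∧ L.IsChain fun l l' => l.1 ≠ l'.1

/-- The product of the letters of a list. -/
def letterProd (L : List (Σ _ : ι, G)) : CoprodI fun _ : ι => G :=
  (L.map fun l => CoprodI.of (M := fun _ : ι => G) (i := l.1) l.2).prod

/-- The list of letters of the formal inverse. -/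
def letterInv (L : List (Σ _ : ι, G)) : List (Σ _ : ι, G) :=
  (L.map fun l => ⟨l.1, l.2⁻¹⟩).reverse

theorem letterProd_append (L L' : List (Σ _ : ι, G)) :
    letterProd (L ++ L') = letterProd L * letterProd L' := by
  simp [letterProd]

theorem letterProd_flatten_replicate (L : List (Σ _ : ι, G)) (n : ℕ) :
    letterProd (List.replicate n L).flatten = letterProd L ^ n := by
  induction n with
  | zero => simp [letterProd]
  | succ n ih => rw [List.replicate_succ, List.flatten_cons, letterProd_append, ih, pow_succ']

theorem IsReducedList.left {L L' : List (Σ _ : ι, G)} (h : IsReducedList (L ++ L')) :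
    IsReducedList L :=
  ⟨fun l hl => h.1 l (List.mem_append_left _ hl), (List.isChain_append.1 h.2).1⟩

theorem IsReducedList.right {L L' : List (Σ _ : ι, G)} (h : IsReducedList (L ++ L')) :
    IsReducedList L' :=
  ⟨fun l hl => h.1 l (List.mem_append_right _ hl), (List.isChain_append.1 h.2).2.1⟩

theorem IsReducedList.append {L L' : List (Σ _ : ι, G)} (h : IsReducedList L)
    (h' : IsReducedList L')
    (hj : ∀ l ∈ L.getLast?, ∀ l' ∈ L'.head?, l.1 ≠ l'.1) : IsReducedList (L ++ L') :=
  ⟨fun l hl => (List.mem_append.1 hl).elim (h.1 l) (h'.1 l),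
    List.isChain_append.2 ⟨h.2, h'.2, hj⟩⟩

/-- In the product of two reduced words, a final piece of the first word cancels against an initial
piece of the second word; then the remaining words are joined, or two letters are amalgamated. -/
theorem exists_cancellation [DecidableEq ι] (u v : List (Σ _ : ι, G)) (hu : IsReducedList u)
    (hv : IsReducedList v) : ∃ a s b, u = a ++ s ∧ v = letterInv s ++ b ∧
      ((IsReducedList (a ++ b) ∧ letterProd (a ++ b) = letterProd u * letterProd v) ∨
        ∃ a' b' i g h, a = a' ++ [⟨i, g⟩] ∧ b = ⟨i, h⟩ :: b' ∧
          IsReducedList (a' ++ ⟨i, g * h⟩ :: b') ∧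
          letterProd (a' ++ ⟨i, g * h⟩ :: b') = letterProd u * letterProd v) := by
  classical
  induction u using List.reverseRecOn generalizing v with
  | nil => exact ⟨[], [], v, rfl, rfl, Or.inl ⟨hv, letterProd_append [] v⟩⟩
  | append_singleton u l ih =>
    obtain ⟨i, g⟩ := l
    rcases v with _ | ⟨⟨j, h⟩, v⟩
    · exact ⟨u ++ [⟨i, g⟩], [], [], by simp, rfl, Or.inl ⟨by simpa using hu, letterProd_append _ _⟩⟩
    by_cases hij : i = j
    · subst hij
      have hgh : letterProd (u ++ [⟨i, g⟩]) * letterProd (⟨i, h⟩ :: v) =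
          letterProd (u ++ ⟨i, g * h⟩ :: v) := by
        simp [letterProd, mul_assoc]
      have hu' := hu.left
      have hv' : IsReducedList v := IsReducedList.right (L := [⟨i, h⟩]) hv
      by_cases h1 : g * h = 1
      · obtain ⟨a, s, b, rfl, rfl, hc⟩ := ih v hu' hv'
        refine ⟨a, s ++ [⟨i, g⟩], b, by simp, ?_, ?_⟩
        · simp [letterInv, inv_eq_of_mul_eq_one_right h1]
        · have : letterProd (a ++ s ++ [⟨i, g⟩]) * letterProd (⟨i, h⟩ :: (letterInv s ++ b)) =
              letterProd (a ++ s) * letterProd (letterInv s ++ b) := by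
            rw [hgh]; simp [letterProd, h1, mul_assoc]
          rw [this]
          exact hc
      · refine ⟨u ++ [⟨i, g⟩], [], ⟨i, h⟩ :: v, by simp, rfl, Or.inr ⟨u, v, i, g, h, rfl, rfl, ?_,
          hgh.symm⟩⟩
        refine ⟨fun l hl => ?_, ?_⟩
        · rcases List.mem_append.1 hl with hl | hl
          · exact hu'.1 l hl
          · rcases List.mem_cons.1 hl with rfl | hl
            · exact h1
            · exact hv'.1 l hl
        · have c1 := List.isChain_append.1 hu.2
          refine List.isChain_append.2 ⟨hu'.2, ?_, fun l hl l' hl' => ?_⟩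
          · have c2 := hv.2
            rw [List.isChain_cons] at c2 ⊢
            exact ⟨fun l hl => c2.1 l hl, c2.2⟩
          · have := c1.2.2 l hl ⟨i, g⟩ (by simp)
            simp only [List.head?_cons, Option.mem_def, Option.some.injEq] at hl'
            subst hl'
            exact this
    · refine ⟨u ++ [⟨i, g⟩], [], ⟨j, h⟩ :: v, by simp, rfl, Or.inl ⟨?_, letterProd_append _ _⟩⟩
      refine hu.append hv fun l hl l' hl' => ?_
      simp only [List.getLast?_append, List.getLast?_singleton, Option.some_or, Option.mem_def,
        Option.some.injEq, List.head?_cons] at hl hl'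
      subst hl hl'
      exact hij

/-- The sum of a function over the pairs of adjacent letters. -/
def pairSum {α : Type*} (κ : α → α → ℤ) : List α → ℤ
  | [] => 0
  | [_] => 0
  | a :: b :: L => κ a b + pairSum κ (b :: L)

theorem pairSum_append_cons {α : Type*} (κ : α → α → ℤ) (L : List α) (a b : α) (L' : List α) :
    pairSum κ (L ++ [a] ++ b :: L') = pairSum κ (L ++ [a]) + κ a b + pairSum κ (b :: L') := by
  induction L with
  | nil => simp [pairSum]
  | cons c L ih =>
    rcases L with _ | ⟨d, L⟩
    · simp [pairSum]; ring
    · simp only [List.cons_append, pairSum] at ih ⊢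
      rw [ih]; ring

theorem abs_pairSum_append_sub_le {α : Type*} {κ : α → α → ℤ} (hκ : ∀ a b, |κ a b| ≤ 1)
    (L L' : List α) : |pairSum κ (L ++ L') - pairSum κ L - pairSum κ L'| ≤ 1 := by
  rcases L' with _ | ⟨b, L'⟩
  · simp [pairSum]
  induction L using List.reverseRecOn with
  | nil => simp [pairSum]
  | append_singleton L a _ =>
    rw [pairSum_append_cons]
    have : pairSum κ (L ++ [a]) + κ a b + pairSum κ (b :: L') - pairSum κ (L ++ [a]) -
      pairSum κ (b :: L') = κ a b := by ring
    rw [this]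
    exact hκ a b

theorem pairSum_letterInv {κ : (Σ _ : ι, G) → (Σ _ : ι, G) → ℤ}
    (hκ : ∀ a b, κ ⟨b.1, b.2⁻¹⟩ ⟨a.1, a.2⁻¹⟩ = -κ a b) (L : List (Σ _ : ι, G)) :
    pairSum κ (letterInv L) = -pairSum κ L := by
  induction L with
  | nil => simp [letterInv, pairSum]
  | cons a L ih =>
    rcases L with _ | ⟨b, L⟩
    · simp [letterInv, pairSum]
    · have h : letterInv (a :: b :: L) = letterInv L ++ [⟨b.1, b.2⁻¹⟩] ++ [⟨a.1, a.2⁻¹⟩] := by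
        simp [letterInv]
      have h' : letterInv (b :: L) = letterInv L ++ [⟨b.1, b.2⁻¹⟩] := by simp [letterInv]
      rw [h, pairSum_append_cons, ← h', ih, hκ]
      simp only [pairSum]
      ring

theorem exists_quasimorphism_of_pairs [DecidableEq ι] {κ : (Σ _ : ι, G) → (Σ _ : ι, G) → ℤ}
    (hκ1 : ∀ a b, |κ a b| ≤ 1) (hκ : ∀ a b, κ ⟨b.1, b.2⁻¹⟩ ⟨a.1, a.2⁻¹⟩ = -κ a b) :
    ∃ ψ : CoprodI (fun _ : ι => G) → ℤ, (∀ u v, |ψ (u * v) - ψ u - ψ v| ≤ 10) ∧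
      ∀ L, IsReducedList L → ψ (letterProd L) = pairSum κ L := by
  classical
  have hpr : ∀ w : CoprodI.Word (fun _ : ι => G), letterProd w.toList = w.prod := fun w => rfl
  have hψ : ∀ L, IsReducedList L →
      pairSum κ (CoprodI.Word.equiv (M := fun _ : ι => G) (letterProd L)).toList = pairSum κ L := by
    intro L hL
    have : letterProd L = CoprodI.Word.equiv.symm
        (⟨L, hL.1, hL.2⟩ : CoprodI.Word (fun _ : ι => G)) :=
      rfl
    rw [this, Equiv.apply_symm_apply]
  refine ⟨fun w => pairSum κ (CoprodI.Word.equiv (M := fun _ : ι => G) w).toList, fun u v => ?_, hψ⟩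
  obtain ⟨wu, rfl⟩ := CoprodI.Word.equiv.symm.surjective u
  obtain ⟨wv, rfl⟩ := CoprodI.Word.equiv.symm.surjective v
  simp only [Equiv.apply_symm_apply]
  have e : ∀ w : CoprodI.Word (fun _ : ι => G), CoprodI.Word.equiv.symm w = letterProd w.toList :=
    fun w => rfl
  rw [e, e]
  obtain ⟨a, s, b, hu, hv, h⟩ := exists_cancellation wu.toList wv.toList ⟨wu.ne_one, wu.chain_ne⟩
    ⟨wv.ne_one, wv.chain_ne⟩
  have i1 := abs_le.1 (abs_pairSum_append_sub_le hκ1 a s)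
  have i2 := abs_le.1 (abs_pairSum_append_sub_le hκ1 (letterInv s) b)
  rw [pairSum_letterInv hκ] at i2
  rw [abs_le]
  rcases h with ⟨h1, h2⟩ | ⟨a', b', i, g, h, rfl, rfl, h1, h2⟩
  · rw [← h2, hψ _ h1, hu, hv]
    have i3 := abs_le.1 (abs_pairSum_append_sub_le hκ1 a b)
    constructor <;> linarith
  · rw [← h2, hψ _ h1, hu, hv]
    have i3 := abs_le.1 (abs_pairSum_append_sub_le hκ1 a' (⟨i, g * h⟩ :: b'))
    have i4 := abs_le.1 (abs_pairSum_append_sub_le hκ1 [⟨i, g * h⟩] b')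
    have i5 := abs_le.1 (abs_pairSum_append_sub_le hκ1 [⟨i, h⟩] b')
    have i6 := abs_le.1 (abs_pairSum_append_sub_le hκ1 a' [⟨i, g⟩])
    simp only [pairSum, List.cons_append, List.nil_append] at *
    constructor <;> linarith

/-- The commutators of two letters from different copies, and then from two further copies. -/
def commutatorWord (f : G) : List (Σ _ : Fin 4, G) :=
  [⟨0, f⟩, ⟨1, f⟩, ⟨0, f⁻¹⟩, ⟨1, f⁻¹⟩, ⟨2, f⟩, ⟨3, f⟩, ⟨2, f⁻¹⟩, ⟨3, f⁻¹⟩]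

theorem isReducedList_commutatorWord_pow {f : G} (hf : f ≠ 1) (n : ℕ) :
    IsReducedList (List.replicate n (commutatorWord f)).flatten := by
  induction n with
  | zero => exact ⟨by simp, by simp⟩
  | succ n ih =>
    rw [List.replicate_succ, List.flatten_cons]
    refine IsReducedList.append ⟨?_, ?_⟩ ih ?_
    · simp [commutatorWord, hf]
    · simp [commutatorWord]
    · cases n with
      | zero => simp
      | succ n => simp [List.replicate_succ, commutatorWord]

/-- The powers of a product of two commutators in a free product of four copies of a nontrivial
group are told apart by a quasimorphism. Counting the pattern `(0, f) (1, f)`, and its inverse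
negatively, works even if `f` is an involution, because the last four letters separate the periods.
-/
theorem exists_quasimorphism {f : G} (hf : f ≠ 1) :
    ∃ ψ : CoprodI (fun _ : Fin 4 => G) → ℤ, (∀ u v, |ψ (u * v) - ψ u - ψ v| ≤ 10) ∧
      ∀ n : ℕ, ψ (letterProd (commutatorWord f) ^ n) = n := by
  classical
  let κ : (Σ _ : Fin 4, G) → (Σ _ : Fin 4, G) → ℤ := fun a b =>
    (if a = ⟨0, f⟩ ∧ b = ⟨1, f⟩ then 1 else 0) - if a = ⟨1, f⁻¹⟩ ∧ b = ⟨0, f⁻¹⟩ then 1 else 0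
  have hinv : ∀ (a : Σ _ : Fin 4, G) (i : Fin 4) (g : G),
      ((⟨a.1, a.2⁻¹⟩ : Σ _ : Fin 4, G) = ⟨i, g⟩) = (a = ⟨i, g⁻¹⟩) := by
    rintro ⟨j, h⟩ i g
    simp [inv_eq_iff_eq_inv]
  obtain ⟨ψ, h1, h2⟩ := exists_quasimorphism_of_pairs (κ := κ) (fun a b => by
      simp only [κ]; split_ifs <;> simp) fun a b => by
      simp only [κ, hinv, inv_inv, neg_sub]
      simp only [and_comm]
  refine ⟨ψ, h1, fun n => ?_⟩
  rw [← letterProd_flatten_replicate, h2 _ (isReducedList_commutatorWord_pow hf n)]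
  have hc : pairSum κ (commutatorWord f) = 1 := by
    by_cases hff : f = f⁻¹
    · simp [commutatorWord, pairSum, κ, ← hff]
    · simp [commutatorWord, pairSum, κ, hff, Ne.symm hff]
  have hlast : commutatorWord f =
      [⟨0, f⟩, ⟨1, f⟩, ⟨0, f⁻¹⟩, ⟨1, f⁻¹⟩, ⟨2, f⟩, ⟨3, f⟩, ⟨2, f⁻¹⟩] ++ [⟨3, f⁻¹⟩] := rfl
  have hj : ∀ b, κ ⟨3, f⁻¹⟩ b = 0 := fun b => by simp [κ]
  induction n with
  | zero => simp [pairSum]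
  | succ n ih =>
    rw [List.replicate_succ, List.flatten_cons]
    rcases h : (List.replicate n (commutatorWord f)).flatten with _ | ⟨b, L⟩
    · rw [h] at ih
      rw [List.append_nil, hc]
      simp only [pairSum] at ih
      push_cast
      linarith
    · rw [hlast, pairSum_append_cons, ← hlast, hc, hj, ← h, ih]
      push_cast
      ring

end FreeProduct

namespace PathCocycle

variable {Z H : Type*} [TopologicalSpace Z] [Group H] (Φ : PathCocycle Z H)

theorem map_edge_mul (f : C(ℝ, Z)) (a b c : ℝ) :
    Φ (edge f b c) * Φ (edge f a b) = Φ (edge f a c) :=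
  (Φ.map_of_convex convex_univ f.continuous.continuousOn (p := a) (q := b) (r := c) trivial trivial
    trivial (fun _ => rfl) (fun _ => rfl) fun _ => rfl).symm

theorem map_comp_eq {E : Type*} [TopologicalSpace E] [SimplyConnectedSpace E] (f : C(E, Z))
    {a b : E} (p p' : Path a b) :
    Φ (f.comp p.toContinuousMap) = Φ (f.comp p'.toContinuousMap) :=
  Φ.map_eq_of_homotopic (γ := p.map f.continuous) (γ' := p'.map f.continuous)
    ((SimplyConnectedSpace.paths_homotopic p p').map f)

/-- The pull-back of a cocycle. -/
def comp {Z' : Type*} [TopologicalSpace Z'] (j : C(Z', Z)) : PathCocycle Z' H :=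
  ⟨fun τ => Φ (j.comp τ), fun G => Φ.triangle (j.comp G)⟩

theorem comp_apply {Z' : Type*} [TopologicalSpace Z'] (j : C(Z', Z)) (τ : C(I, Z')) :
    Φ.comp j τ = Φ (j.comp τ) := rfl

theorem eq_one_of_cover {ι : Type*} {N : ι → Set Z} (hN : ∀ i, IsOpen (N i))
    (hcov : ∀ z, ∃ i, z ∈ N i) (τ : C(I, Z))
    (h : ∀ i (θ : C(I, I)), (∀ t, τ (θ t) ∈ N i) → Φ (τ.comp θ) = 1) : Φ τ = 1 := by
  let f : C(ℝ, Z) := ⟨fun t => τ (clampI t), τ.continuous.comp continuous_clampI⟩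
  obtain ⟨δ, hδ, hball⟩ := lebesgue_number_lemma_of_metric (c := fun i => f ⁻¹' N i)
    (isCompact_Icc (a := (0 : ℝ)) (b := 1)) (fun i => (hN i).preimage f.continuous)
    fun z _ => mem_iUnion.2 (hcov (f z))
  have key := eq_of_eq_of_near (fun t => Φ (edge f 0 t)) hδ fun s hs t ht hst => by
    obtain ⟨i, hi⟩ := hball s hs
    have h1 : Φ (edge f s t) = 1 := by
      refine h i ⟨fun v => clampI (s + (v : ℝ) • (t - s)), continuous_clampI.comp (by fun_prop)⟩
        fun v => ?_
      have hv : s + (v : ℝ) • (t - s) ∈ Metric.ball s δ := by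
        have := (convex_ball s δ).add_smul_sub_mem (Metric.mem_ball_self hδ)
          (y := t) (by rwa [Metric.mem_ball, Real.dist_eq, abs_sub_comm]) v.2
        exact this
      exact hi hv
    rw [← Φ.map_edge_mul f 0 s t, h1, one_mul]
  have h0 : edge f 0 0 = ContinuousMap.const I (τ 0) := by ext t; simp [edge, f]
  have h1 : edge f 0 1 = τ := by ext t; simp [edge, f]
  rw [h0, h1, map_const] at key
  exact key.symm

end PathCocycle

section Equator

variable {Z A : Type*} [TopologicalSpace Z] [AddCommGroup A]

/-- The values of a locally constant function agree at the ends of a segment. -/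
theorem eq_of_eq_of_near_of_convex {E α : Type*} [NormedAddCommGroup E] [NormedSpace ℝ E]
    {D : Set E}
    (hD : Convex ℝ D) (g : E → α) {δ : ℝ} (hδ : 0 < δ)
    (h : ∀ z ∈ D, ∀ w ∈ D, dist z w < δ → g z = g w) {z w : E} (hz : z ∈ D) (hw : w ∈ D) :
    g z = g w := by
  have := eq_of_eq_of_near (fun t => g (z + t • (w - z))) (ε := δ / (‖w - z‖ + 1)) (by positivity)
    fun s hs t ht hst => h _ (hD.add_smul_sub_mem hz hw hs) _ (hD.add_smul_sub_mem hz hw ht) (by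
      have e : z + s • (w - z) - (z + t • (w - z)) = (s - t) • (w - z) := by module
      rw [dist_eq_norm, e, norm_smul, Real.norm_eq_abs]
      rw [lt_div_iff₀ (by positivity)] at hst
      nlinarith [abs_nonneg (s - t)])
  simpa using this

/-- A connecting homomorphism of Mayer–Vietoris type vanishes on null-homotopic spheres: if the two
halves of a null-homotopic sphere lie in `U` and `V`, then an additive homotopy invariant of paths
in `U ∩ V`, with values in an abelian group, vanishes on the equator. The invariant of short
segments is a cochain whose coboundary, cut off over `V`, is a `2`-cocycle `c` on the domain of the
null-homotopy. The prism operator makes `c` the coboundary of a `1`-cochain `b` at time `0`, and `b`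
vanishes near the boundary of the square; then the invariant is, up to `b`, a coboundary on one half
of the square, and so is `b` on the other half. -/
theorem equator_eq_zero {U V : Set Z} (hU : IsOpen U) (hV : IsOpen V) (hUV : ∀ z, z ∈ U ∨ z ∈ V)
    (ω : C(I, Z) → A) (hω : ∀ G : C(ℝ × ℝ, Z), (∀ z, G z ∈ U ∩ V) →
      TriangleLaw (fun τ => Multiplicative.ofAdd (ω τ)) G) {e : Z} (he : e ∈ U ∩ V)
    (hnull : NullSphere Z e) (F : C(Fin 2 → ℝ, Z)) (hFe : ∀ z, 1 ≤ ‖z‖ → F z = e)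
    (hFU : ∀ z, z 1 ≤ 0 → F z ∈ U) (hFV : ∀ z, 0 ≤ z 1 → F z ∈ V) :
    ω (edge F ![-1, 0] ![1, 0]) = 0 := by
  classical
  obtain ⟨K, hK0, hK1, hKe⟩ := hnull F hFe
  -- additivity on convex sets
  have hadd : ∀ {E : Type} [NormedAddCommGroup E] [NormedSpace ℝ E] (G : C(E, Z)) (C : Set E),
      Convex ℝ C → (∀ z ∈ C, G z ∈ U ∩ V) → ∀ p ∈ C, ∀ q ∈ C, ∀ r ∈ C,
      ω (edge G p r) = ω (edge G q r) + ω (edge G p q) := by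
    intro E _ _ G C hC hCN p hp q hq r hr
    have := TriangleLaw.of_convex (ω := fun τ => Multiplicative.ofAdd (ω τ)) hC
      G.continuous.continuousOn (fun G' hG' => hω G' fun z => ?_) hp hq hr
      (a := edge G p q) (b := edge G q r) (c := edge G p r)
      (fun _ => rfl) (fun _ => rfl) fun _ => rfl
    · exact Multiplicative.ofAdd.injective this
    · obtain ⟨w, hw, h⟩ := hG' z
      exact h ▸ hCN w hw
  have hconst : ω (ContinuousMap.const I e) = 0 := by
    have := hadd (ContinuousMap.const ℝ e) univ convex_univ (fun _ _ => he) 0 trivial 0 trivial 0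
      trivial
    have h0 : edge (ContinuousMap.const ℝ e) 0 0 = ContinuousMap.const I e := rfl
    rw [h0] at this
    simpa using this
  let w : ℝ × (Fin 2 → ℝ) → ℝ × (Fin 2 → ℝ) → A := fun p q => ω (edge K p q)
  let c : ℝ × (Fin 2 → ℝ) → ℝ × (Fin 2 → ℝ) → ℝ × (Fin 2 → ℝ) → A := fun p q r =>
    if ∃ C : Set (ℝ × (Fin 2 → ℝ)), Convex ℝ C ∧ p ∈ C ∧ q ∈ C ∧ r ∈ C ∧ ∀ z ∈ C, K z ∈ V then 0
    else w p q + w q r - w p r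
  have hcV : ∀ C : Set (ℝ × (Fin 2 → ℝ)), Convex ℝ C → (∀ z ∈ C, K z ∈ V) → ∀ p ∈ C, ∀ q ∈ C,
      ∀ r ∈ C, c p q r = 0 := fun C hC hCV p hp q hq r hr => if_pos ⟨C, hC, hp, hq, hr, hCV⟩
  have hcU : ∀ C : Set (ℝ × (Fin 2 → ℝ)), Convex ℝ C → (∀ z ∈ C, K z ∈ U) → ∀ p ∈ C, ∀ q ∈ C,
      ∀ r ∈ C, c p q r = w p q + w q r - w p r := by
    intro C hC hCU p hp q hq r hr
    by_cases h : ∃ C : Set (ℝ × (Fin 2 → ℝ)), Convex ℝ C ∧ p ∈ C ∧ q ∈ C ∧ r ∈ C ∧ ∀ z ∈ C, K z ∈ V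
    · obtain ⟨D, hD, hp', hq', hr', hDV⟩ := h
      rw [hcV D hD hDV p hp' q hq' r hr']
      have := hadd K (C ∩ D) (hC.inter hD) (fun z hz => ⟨hCU z hz.1, hDV z hz.2⟩) p ⟨hp, hp'⟩ q
        ⟨hq, hq'⟩ r ⟨hr, hr'⟩
      simp only [w]
      rw [this]; abel
    · exact if_neg h
  -- the cocycle law on small sets
  obtain ⟨δ, hδ, hball⟩ := lebesgue_number_lemma_of_metric
    (c := fun i : Bool => K ⁻¹' (if i then U else V))
    (isCompact_closedBall (0 : ℝ × (Fin 2 → ℝ)) 1)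
    (fun i => by cases i <;> [exact hV.preimage K.continuous; exact hU.preimage K.continuous])
    fun z _ => mem_iUnion.2 ((hUV (K z)).elim (fun h => ⟨true, h⟩) fun h => ⟨false, h⟩)
  have hδc : ∀ p ∈ Metric.closedBall (0 : ℝ × (Fin 2 → ℝ)) 1, ∀ q r t, dist q p < δ → dist r p < δ →
      dist t p < δ → c q r t - c p r t + c p q t - c p q r = 0 := by
    intro p hp q r t hq hr ht
    have hp' := Metric.mem_ball_self (x := p) hδ
    obtain ⟨i, hi⟩ := hball p hp
    cases i
    · have := hcV (Metric.ball p δ) (convex_ball p δ) (fun z hz => hi hz)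
      rw [this q hq r hr t ht, this p hp' r hr t ht, this p hp' q hq t ht, this p hp' q hq r hr]
      simp
    · have := hcU (Metric.ball p δ) (convex_ball p δ) (fun z hz => hi hz)
      rw [this q hq r hr t ht, this p hp' r hr t ht, this p hp' q hq t ht, this p hp' q hq r hr]
      abel
  -- the prism operator
  obtain ⟨N, hN⟩ := exists_nat_gt (1 / δ)
  have hN0 : (0 : ℝ) < N := lt_trans (by positivity) hN
  have hNδ : 1 / (N : ℝ) < δ := by
    rw [div_lt_iff₀ hN0]; rw [div_lt_iff₀ hδ] at hN; linarith
  let s : ℕ → ℝ := fun k => (k : ℝ) / N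
  have hs : ∀ k, s (k + 1) - s k = 1 / N := fun k => by simp only [s]; push_cast; ring
  have hs0 : ∀ k, 0 ≤ s k := fun k => by positivity
  let β : ℕ → (Fin 2 → ℝ) → (Fin 2 → ℝ) → A := fun k z v =>
    c (s k, z) (s k, v) (s (k + 1), v) - c (s k, z) (s (k + 1), z) (s (k + 1), v)
  let b : (Fin 2 → ℝ) → (Fin 2 → ℝ) → A := fun z v => ∑ k ∈ Finset.range N, β k z v
  have hb : ∀ z ∈ Metric.closedBall (0 : Fin 2 → ℝ) 1, ∀ u ∈ Metric.closedBall (0 : Fin 2 → ℝ) 1,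
      ∀ v, dist u z < δ → dist v z < δ → dist v u < δ →
      c (0, z) (0, u) (0, v) = b u v - b z v + b z u := by
    intro z hz u hu v huz hvz hvu
    have hstep : ∀ k ∈ Finset.range N, β k u v - β k z v + β k z u =
        c (s k, z) (s k, u) (s k, v) - c (s (k + 1), z) (s (k + 1), u) (s (k + 1), v) := by
      intro k hk
      have hk1 : s k ≤ 1 :=
        (div_le_one hN0).2 (by exact_mod_cast (Finset.mem_range.1 hk).le)
      have hd : dist (s (k + 1)) (s k) < δ := by
        rw [Real.dist_eq, hs, abs_of_pos (by positivity)]; exact hNδ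
      have hd0 : dist (s k) (s k) < δ := by simpa
      have hzz : dist z z < δ := by simpa
      have huu : dist u u < δ := by simpa
      have mk : ∀ {a a' : ℝ} {y y' : Fin 2 → ℝ}, dist a a' < δ → dist y y' < δ →
          dist (a, y) (a', y') < δ := fun h h' => max_lt h h'
      have hz' : (s k, z) ∈ Metric.closedBall (0 : ℝ × (Fin 2 → ℝ)) 1 := by
        rw [mem_closedBall_zero_iff] at hz ⊢
        exact max_le (by rw [Real.norm_of_nonneg (hs0 k)]; exact hk1) hz
      have e1 := hδc (s k, z) hz' (s k, u) (s k, v) (s (k + 1), v) (mk hd0 huz) (mk hd0 hvz)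
        (mk hd hvz)
      have e2 := hδc (s k, z) hz' (s k, u) (s (k + 1), u) (s (k + 1), v) (mk hd0 huz) (mk hd huz)
        (mk hd hvz)
      have e3 := hδc (s k, z) hz' (s (k + 1), z) (s (k + 1), u) (s (k + 1), v) (mk hd hzz)
        (mk hd huz) (mk hd hvz)
      simp only [β]
      rw [← sub_eq_zero]
      calc _ = (c (s k, u) (s k, v) (s (k + 1), v) - c (s k, z) (s k, v) (s (k + 1), v) +
              c (s k, z) (s k, u) (s (k + 1), v) - c (s k, z) (s k, u) (s k, v)) -
            (c (s k, u) (s (k + 1), u) (s (k + 1), v) - c (s k, z) (s (k + 1), u) (s (k + 1), v) +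
              c (s k, z) (s k, u) (s (k + 1), v) - c (s k, z) (s k, u) (s (k + 1), u)) +
            (c (s (k + 1), z) (s (k + 1), u) (s (k + 1), v) -
              c (s k, z) (s (k + 1), u) (s (k + 1), v) +
              c (s k, z) (s (k + 1), z) (s (k + 1), v) -
              c (s k, z) (s (k + 1), z) (s (k + 1), u)) := by abel
        _ = 0 := by rw [e1, e2, e3]; simp
    have hsum := Finset.sum_congr rfl hstep
    rw [Finset.sum_range_sub' (fun k => c (s k, z) (s k, u) (s k, v)), Finset.sum_add_distrib,
      Finset.sum_sub_distrib] at hsum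
    have hsN : s N = 1 := div_self hN0.ne'
    have hs0' : s 0 = 0 := by simp [s]
    have hlast : c (1, z) (1, u) (1, v) = 0 :=
      hcV {q | q.1 = 1} (fun x hx y hy a a' _ _ h => by
        simp only [mem_ofPred_eq] at hx hy ⊢
        simp [hx, hy, h]) (by rintro ⟨_, q⟩ rfl; rw [hK1]; exact he.2) _ rfl _ rfl _ rfl
    rw [hsN, hs0', hlast, sub_zero] at hsum
    exact hsum.symm
  have hb0 : ∀ D : Set (Fin 2 → ℝ), Convex ℝ D → (∀ z ∈ D, 1 ≤ ‖z‖) → ∀ z ∈ D, ∀ v ∈ D,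
      b z v = 0 := by
    intro D hD hD1 z hz v hv
    refine Finset.sum_eq_zero fun k _ => ?_
    have := hcV (univ ×ˢ D) (convex_univ.prod hD) fun q hq => by
      rw [show q = (q.1, q.2) from rfl, hKe _ _ (hD1 _ hq.2)]; exact he.2
    simp only [β]
    rw [this _ ⟨trivial, hz⟩ _ ⟨trivial, hv⟩ _ ⟨trivial, hv⟩,
      this _ ⟨trivial, hz⟩ _ ⟨trivial, hz⟩ _ ⟨trivial, hv⟩, sub_zero]
  have hw0 : ∀ z v, w (0, z) (0, v) = ω (edge F z v) := fun z v => by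
    simp only [w]
    congr 1
    ext t
    simp [edge, ← hK0]
  have hc0 : ∀ C : Set (Fin 2 → ℝ), Convex ℝ C → Convex ℝ (({0} : Set ℝ) ×ˢ C) := fun C hC =>
    (convex_singleton 0).prod hC
  -- primitives over the two halves of the square
  have hLo : Convex ℝ (Metric.closedBall (0 : Fin 2 → ℝ) 1 ∩ {z | z 1 ≤ 0}) :=
    (convex_closedBall _ _).inter (convex_halfSpace_le (LinearMap.proj (R := ℝ) 1).isLinear 0)
  have hUp : Convex ℝ (Metric.closedBall (0 : Fin 2 → ℝ) 1 ∩ {z | 0 ≤ z 1}) :=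
    (convex_closedBall _ _).inter (convex_halfSpace_ge (LinearMap.proj (R := ℝ) 1).isLinear 0)
  obtain ⟨g₁, hg₁⟩ := exists_development (H := Multiplicative A) hLo
    (Metric.isBounded_closedBall.subset inter_subset_left) hδ
    (fun z v => Multiplicative.ofAdd (ω (edge F z v) - b z v)) fun p hp q hq r hr h1 h2 h3 => by
      have e1 := hb p hp.1 q hq.1 r (by rwa [dist_comm]) (by rwa [dist_comm]) (by rwa [dist_comm])
      rw [hcU _ (hc0 {z | z 1 ≤ 0} (convex_halfSpace_le (LinearMap.proj (R := ℝ) 1).isLinear 0))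
        (by rintro ⟨_, z⟩ ⟨rfl, hz⟩; rw [hK0]; exact hFU z hz) (0, p) ⟨mem_singleton _, hp.2⟩
        (0, q) ⟨mem_singleton _, hq.2⟩ (0, r) ⟨mem_singleton _, hr.2⟩, hw0, hw0, hw0] at e1
      rw [← ofAdd_add]
      congr 1
      rw [← sub_eq_zero] at e1 ⊢
      rw [← neg_eq_zero, ← e1]
      abel
  obtain ⟨g₂, hg₂⟩ := exists_development (H := Multiplicative A) hUp
    (Metric.isBounded_closedBall.subset inter_subset_left) hδ
    (fun z v => Multiplicative.ofAdd (b z v)) fun p hp q hq r hr h1 h2 h3 => by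
      have e1 := hb p hp.1 q hq.1 r (by rwa [dist_comm]) (by rwa [dist_comm]) (by rwa [dist_comm])
      rw [hcV _ (hc0 {z | 0 ≤ z 1} (convex_halfSpace_ge (LinearMap.proj (R := ℝ) 1).isLinear 0))
        (by rintro ⟨_, z⟩ ⟨rfl, hz⟩; rw [hK0]; exact hFV z hz) (0, p) ⟨mem_singleton _, hp.2⟩
        (0, q) ⟨mem_singleton _, hq.2⟩ (0, r) ⟨mem_singleton _, hr.2⟩] at e1
      rw [← ofAdd_add]
      congr 1
      rw [← sub_eq_zero, ← neg_eq_zero, e1]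
      abel
  -- the primitives are constant on the outer sides
  have hside : ∀ D : Set (Fin 2 → ℝ), Convex ℝ D → (∀ z ∈ D, 1 ≤ ‖z‖) → ∀ z ∈ D, ∀ v ∈ D,
      edge F z v = ContinuousMap.const I e := fun D hD hD1 z hz v hv => by
    ext t
    exact hFe _ (hD1 _ (hD.add_smul_sub_mem hz hv t.2))
  have hs₁ : ∀ D : Set (Fin 2 → ℝ), Convex ℝ D → (∀ z ∈ D, 1 ≤ ‖z‖) →
      ∀ z ∈ D ∩ (Metric.closedBall (0 : Fin 2 → ℝ) 1 ∩ {z | z 1 ≤ 0}),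
      ∀ v ∈ D ∩ (Metric.closedBall (0 : Fin 2 → ℝ) 1 ∩ {z | z 1 ≤ 0}), g₁ z = g₁ v := by
    intro D hD hD1 z hz v hv
    refine eq_of_eq_of_near_of_convex (hD.inter hLo) g₁ (half_pos hδ) (fun z hz v hv hzv => ?_)
      hz hv
    have := hg₁ z hz.2 v hv.2 hzv
    rw [hside D hD hD1 z hz.1 v hv.1, hconst, hb0 D hD hD1 z hz.1 v hv.1, sub_zero, ofAdd_zero,
      eq_comm, mul_inv_eq_one] at this
    exact this.symm
  have hs₂ : ∀ D : Set (Fin 2 → ℝ), Convex ℝ D → (∀ z ∈ D, 1 ≤ ‖z‖) →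
      ∀ z ∈ D ∩ (Metric.closedBall (0 : Fin 2 → ℝ) 1 ∩ {z | 0 ≤ z 1}),
      ∀ v ∈ D ∩ (Metric.closedBall (0 : Fin 2 → ℝ) 1 ∩ {z | 0 ≤ z 1}), g₂ z = g₂ v := by
    intro D hD hD1 z hz v hv
    refine eq_of_eq_of_near_of_convex (hD.inter hUp) g₂ (half_pos hδ) (fun z hz v hv hzv => ?_)
      hz hv
    have := hg₂ z hz.2 v hv.2 hzv
    rw [hb0 D hD hD1 z hz.1 v hv.1, ofAdd_zero, eq_comm, mul_inv_eq_one] at this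
    exact this.symm
  have hD : ∀ (i : Fin 2) (a : ℝ), Convex ℝ {z : Fin 2 → ℝ | z i = a} := fun i a =>
    convex_hyperplane (LinearMap.proj (R := ℝ) (φ := fun _ : Fin 2 => ℝ) i).isLinear a
  have hD1 : ∀ (i : Fin 2) (a : ℝ), |a| = 1 → ∀ z ∈ {z : Fin 2 → ℝ | z i = a}, 1 ≤ ‖z‖ :=
    fun i a ha z hz => by
      have := norm_le_pi_norm z i
      rw [mem_ofPred_eq] at hz
      rwa [hz, Real.norm_eq_abs, ha] at this
  have hcb : ∀ a b : ℝ, |a| ≤ 1 → |b| ≤ 1 → ![a, b] ∈ Metric.closedBall (0 : Fin 2 → ℝ) 1 :=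
    fun a b ha hb => by
      rw [mem_closedBall_zero_iff, pi_norm_le_iff_of_nonneg zero_le_one]
      intro i
      fin_cases i <;> simpa
  have hg₁' : g₁ ![-1, 0] = g₁ ![1, 0] := by
    refine (hs₁ _ (hD 0 (-1)) (hD1 0 (-1) (by simp)) ![-1, 0] ⟨?_, hcb _ _ ?_ ?_, ?_⟩ ![-1, -1]
      ⟨?_, hcb _ _ ?_ ?_, ?_⟩).trans <| (hs₁ _ (hD 1 (-1)) (hD1 1 (-1) (by simp)) _
      ⟨?_, hcb _ _ ?_ ?_, ?_⟩ ![1, -1] ⟨?_, hcb _ _ ?_ ?_, ?_⟩).trans <| hs₁ _ (hD 0 1)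
      (hD1 0 1 (by simp)) _ ⟨?_, hcb _ _ ?_ ?_, ?_⟩ _ ⟨?_, hcb _ _ ?_ ?_, ?_⟩ <;> simp
  have hg₂' : g₂ ![-1, 0] = g₂ ![1, 0] := by
    refine (hs₂ _ (hD 0 (-1)) (hD1 0 (-1) (by simp)) ![-1, 0] ⟨?_, hcb _ _ ?_ ?_, ?_⟩ ![-1, 1]
      ⟨?_, hcb _ _ ?_ ?_, ?_⟩).trans <| (hs₂ _ (hD 1 1) (hD1 1 1 (by simp)) _
      ⟨?_, hcb _ _ ?_ ?_, ?_⟩ ![1, 1] ⟨?_, hcb _ _ ?_ ?_, ?_⟩).trans <| hs₂ _ (hD 0 1)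
      (hD1 0 1 (by simp)) _ ⟨?_, hcb _ _ ?_ ?_, ?_⟩ _ ⟨?_, hcb _ _ ?_ ?_, ?_⟩ <;> simp
  -- comparison along the equator
  have heq : ∀ z ∈ {z : Fin 2 → ℝ | z 1 = 0}, F z ∈ U ∩ V := fun z hz =>
    ⟨hFU z (le_of_eq hz), hFV z (ge_of_eq hz)⟩
  have h1 : ![-1, 0] ∈ {z : Fin 2 → ℝ | z 1 = 0} := by simp
  have h2 : ![1, 0] ∈ {z : Fin 2 → ℝ | z 1 = 0} := by simp
  have hfin := eq_of_eq_of_near_of_convex ((convex_closedBall (0 : Fin 2 → ℝ) 1).inter (hD 1 0))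
    (fun z => Multiplicative.ofAdd (ω (edge F ![-1, 0] z)) * (g₁ z * g₂ z)⁻¹) (half_pos hδ)
    (fun z hz v hv hzv => by
      have e1 := hg₁ z ⟨hz.1, le_of_eq hz.2⟩ v ⟨hv.1, le_of_eq hv.2⟩ hzv
      have e2 := hg₂ z ⟨hz.1, ge_of_eq hz.2⟩ v ⟨hv.1, ge_of_eq hv.2⟩ hzv
      have e3 := hadd F _ (hD 1 0) heq _ h1 z hz.2 v hv.2
      have e4 : Multiplicative.ofAdd (ω (edge F z v)) = g₁ v * (g₁ z)⁻¹ * (g₂ v * (g₂ z)⁻¹) := by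
        rw [← e1, ← e2, ← ofAdd_add, sub_add_cancel]
      rw [e3, ofAdd_add, e4]
      simp only [mul_inv]
      have : ∀ a b c d x : Multiplicative A, x * (a⁻¹ * b⁻¹) =
          c * a⁻¹ * (d * b⁻¹) * x * (c⁻¹ * d⁻¹) := fun a b c d x => by
        have h : c * a⁻¹ * (d * b⁻¹) * x * (c⁻¹ * d⁻¹) =
          (x * (a⁻¹ * b⁻¹)) * (c * c⁻¹) * (d * d⁻¹) := by ac_rfl
        rw [h, mul_inv_cancel, mul_inv_cancel, mul_one, mul_one]
      exact this _ _ _ _ _)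
    (z := ![-1, 0]) (w := ![1, 0]) ⟨hcb _ _ (by simp) (by simp), h1⟩
    ⟨hcb _ _ (by simp) (by simp), h2⟩
  rw [hg₁', hg₂', mul_left_inj] at hfin
  rw [← Multiplicative.ofAdd.injective hfin]
  have h3 := hadd F _ (hD 1 0) heq _ h1 _ h1 _ h1
  simpa using h3

end Equator

/-! ### Infinite concatenation -/

section Concat

/-- The parametrization of the `n`-th piece `[n / (n + 1), (n + 1) / (n + 2)]` of the interval. -/
noncomputable def stage (n : ℕ) (t : I) : I :=
  ⟨(n + t) / (n + t + 1), div_nonneg (by linarith [t.2.1, (Nat.cast_nonneg n : (0 : ℝ) ≤ n)])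
    (by linarith [t.2.1, (Nat.cast_nonneg n : (0 : ℝ) ≤ n)]),
    (div_le_one (by linarith [t.2.1, (Nat.cast_nonneg n : (0 : ℝ) ≤ n)])).2 (by linarith)⟩

theorem stage_div_one_sub (n : ℕ) (t : I) : (stage n t : ℝ) / (1 - stage n t) = n + t := by
  have h : (0 : ℝ) < n + t + 1 := by linarith [t.2.1, (Nat.cast_nonneg n : (0 : ℝ) ≤ n)]
  simp only [stage]
  field_simp
  ring

theorem stage_ne_one (n : ℕ) (t : I) : stage n t ≠ 1 := by
  intro h
  have h' : (0 : ℝ) < n + t + 1 := by linarith [t.2.1, (Nat.cast_nonneg n : (0 : ℝ) ≤ n)]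
  have := congrArg Subtype.val h
  simp only [stage, Icc.coe_one] at this
  rw [div_eq_one_iff_eq h'.ne'] at this
  linarith

theorem stage_zero_zero : stage 0 0 = 0 := Subtype.ext (by simp [stage])

theorem continuous_stage (n : ℕ) : Continuous (stage n) :=
  Continuous.subtype_mk (Continuous.div (by fun_prop) (by fun_prop) fun t => by
    linarith [t.2.1, (Nat.cast_nonneg n : (0 : ℝ) ≤ n)]) _

theorem exists_eq_stage {s : I} (h : s ≠ 1) : ∃ n t, s = stage n t := by
  have h1 : (0 : ℝ) < 1 - s := sub_pos.2 (lt_of_le_of_ne s.2.2 fun h' => h (Subtype.ext h'))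
  have h0 : 0 ≤ (s : ℝ) / (1 - s) := div_nonneg s.2.1 h1.le
  refine ⟨⌊(s : ℝ) / (1 - s)⌋₊, ⟨s / (1 - s) - ⌊(s : ℝ) / (1 - s)⌋₊, ?_, ?_⟩, Subtype.ext ?_⟩
  · exact sub_nonneg.2 (Nat.floor_le h0)
  · linarith [Nat.lt_floor_add_one ((s : ℝ) / (1 - s))]
  · simp only [stage, add_sub_cancel]
    field_simp
    ring

/-- The concatenation of a sequence of homotopies (with parameter in `T`) that shrink to a point. -/
theorem exists_infinite_concat {T Z : Type*} [TopologicalSpace T] [TopologicalSpace Z]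
    (p : ℕ → C(T × I, Z)) (c : Z) (hp : ∀ n τ, p n (τ, 1) = p (n + 1) (τ, 0))
    (hc : ∀ U ∈ 𝓝 c, ∀ᶠ n in atTop, ∀ q, p n q ∈ U) :
    ∃ P : C(T × I, Z), (∀ τ, P (τ, 1) = c) ∧ ∀ n τ t, P (τ, stage n t) = p n (τ, t) := by
  have hR : ∀ n : ℕ, ∃ R : C(T × ℝ, Z), ∀ k : ℕ, k ≤ n → ∀ (τ : T) (u : ℝ), k ≤ u → u ≤ k + 1 →
      R (τ, u) = p k (τ, clampI (u - k)) := by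
    intro n
    induction n with
    | zero =>
      refine ⟨⟨fun q => p 0 (q.1, clampI (q.2 - (0 : ℕ))), (p 0).continuous.comp
        (continuous_fst.prodMk (continuous_clampI.comp (by fun_prop)))⟩, fun k hk τ u _ _ => ?_⟩
      obtain rfl : k = 0 := by omega
      rfl
    | succ n ih =>
      obtain ⟨R, hR⟩ := ih
      have hglue : ∀ τ : T, R (τ, (n : ℝ) + 1) = p (n + 1) (τ, 0) := fun τ => by
        rw [hR n le_rfl τ _ (by linarith) le_rfl, add_sub_cancel_left, clampI_one, hp]
      refine ⟨⟨fun q => if q.2 ≤ (n : ℝ) + 1 then R q else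
        p (n + 1) (q.1, clampI (q.2 - ((n : ℝ) + 1))), ?_⟩, fun k hk τ u h1 h2 => ?_⟩
      · refine Continuous.if_le R.continuous ((p (n + 1)).continuous.comp
          (continuous_fst.prodMk (continuous_clampI.comp (by fun_prop)))) continuous_snd
          continuous_const ?_
        rintro ⟨τ, u⟩ h
        simp only at h
        rw [h, sub_self, clampI_zero, hglue]
      · change (if u ≤ (n : ℝ) + 1 then R (τ, u) else _) = _
        rcases Nat.lt_or_ge n k with hk' | hk'
        · obtain rfl : k = n + 1 := by omega
          push_cast at h1 h2 ⊢
          split_ifs with h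
          · obtain rfl : u = (n : ℝ) + 1 := le_antisymm h h1
            rw [hglue, sub_self, clampI_zero]
          · rfl
        · rw [if_pos, hR k hk' τ u h1 h2]
          have : (k : ℝ) ≤ n := by exact_mod_cast hk'
          linarith
  choose R hR using hR
  let P : T × I → Z := fun q => if q.2 = 1 then c else
    p ⌊(q.2 : ℝ) / (1 - q.2)⌋₊ (q.1, clampI (q.2 / (1 - q.2) - ⌊(q.2 : ℝ) / (1 - q.2)⌋₊))
  have hpos : ∀ s : I, s ≠ 1 → (0 : ℝ) < 1 - s := fun s h =>
    sub_pos.2 (lt_of_le_of_ne s.2.2 fun h' => h (Subtype.ext h'))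
  have hPR : ∀ (n : ℕ) (q : T × I), q.2 ≠ 1 → (q.2 : ℝ) / (1 - q.2) < n + 1 →
      P q = R n (q.1, q.2 / (1 - q.2)) := fun n q h h' => by
    have h0 : 0 ≤ (q.2 : ℝ) / (1 - q.2) := div_nonneg q.2.2.1 (hpos _ h).le
    simp only [P]
    rw [if_neg h, hR n ⌊(q.2 : ℝ) / (1 - q.2)⌋₊ (Nat.lt_succ_iff.1 ((Nat.floor_lt h0).2
      (by exact_mod_cast h'))) _ _ (Nat.floor_le h0) (Nat.lt_floor_add_one _).le]
  have hP : Continuous P := by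
    rw [continuous_iff_continuousAt]
    rintro ⟨τ, s⟩
    by_cases h : s = 1
    · subst h
      rw [ContinuousAt, show P (τ, 1) = c from if_pos rfl]
      intro U hU
      obtain ⟨N, hN⟩ := eventually_atTop.1 (hc U hU)
      have h1 : ∀ᶠ q : T × I in 𝓝 (τ, 1), (N : ℝ) * (1 - q.2) < q.2 :=
        (show Continuous fun q : T × I => (N : ℝ) * (1 - (q.2 : ℝ)) by
          fun_prop).continuousAt.eventually_lt
          (show Continuous fun q : T × I => (q.2 : ℝ) by fun_prop).continuousAt (by simp)
      change ∀ᶠ q in 𝓝 (τ, 1), P q ∈ U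
      filter_upwards [h1] with q hq
      simp only [P]
      split_ifs with h
      · exact mem_of_mem_nhds hU
      · exact hN _ (Nat.le_floor ((le_div_iff₀ (hpos _ h)).2 hq.le)) _
    · have h0 : (0 : ℝ) < 1 - s := hpos s h
      obtain ⟨n, hn⟩ := exists_nat_gt ((s : ℝ) / (1 - s))
      have hcd : ContinuousAt (fun q : T × I => (q.2 : ℝ) / (1 - q.2)) (τ, s) :=
        ContinuousAt.div (by fun_prop) (by fun_prop) h0.ne'
      have h1 : ∀ᶠ q : T × I in 𝓝 (τ, s), (q.2 : ℝ) / (1 - q.2) < n + 1 :=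
        hcd.eventually_lt continuousAt_const (by simp only; linarith)
      have h2 : ∀ᶠ q : T × I in 𝓝 (τ, s), q.2 ≠ 1 :=
        continuous_snd.continuousAt.eventually_ne h
      refine ContinuousAt.congr (f := fun q => R n (q.1, q.2 / (1 - q.2))) ?_ ?_
      · exact (R n).continuous.continuousAt.comp (continuousAt_fst.prodMk hcd)
      · filter_upwards [h1, h2] with q hq hq'
        exact (hPR n q hq' hq).symm
  refine ⟨⟨P, hP⟩, fun τ => if_pos rfl, fun n τ t => ?_⟩
  change P _ = _
  by_cases ht : t = 1
  · subst ht
    have e : (stage n 1 : ℝ) / (1 - stage n 1) = n + 1 := by rw [stage_div_one_sub]; rfl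
    rw [hPR (n + 1) _ (stage_ne_one n 1) (by simp only [e]; push_cast; linarith)]
    simp only [e]
    rw [hR (n + 1) (n + 1) le_rfl _ _ (by push_cast; rfl) (by push_cast; linarith)]
    push_cast
    rw [sub_self, clampI_zero, hp]
  · have : (t : ℝ) < 1 := lt_of_le_of_ne t.2.2 fun h' => ht (Subtype.ext h')
    rw [hPR n _ (stage_ne_one n t) (by simp only [stage_div_one_sub]; linarith)]
    simp only [stage_div_one_sub]
    rw [hR n n le_rfl _ _ (by linarith [t.2.1]) (by linarith), add_sub_cancel_left, clampI_coe]

end Concat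

/-! ### Loops in the chain -/

namespace Chain

variable {X : Type u} [TopologicalSpace X] {x : X}

theorem comap_coord_nhds_zero_le : comap coord (𝓝 0) ≤ 𝓝 (arc x 0) := by
  rw [isInducing.nhds_eq_comap, ← tendsto_iff_comap, nhds_prod_eq]
  refine tendsto_comap.prodMk ?_
  rw [tendsto_pi_nhds]
  intro n
  refine tendsto_const_nhds.congr' ?_
  have h : ∀ᶠ t : I in 𝓝 0, t < attachParam n :=
    gt_mem_nhds (lt_of_le_of_ne (attachParam n).2.1 (attachParam_ne_zero n).symm)
  filter_upwards [preimage_mem_comap h] with y hy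
  exact (retr_of_coord_ne (ne_of_lt hy)).symm

theorem exists_forall_coord_lt {U : Set (Chain X x)} (hU : U ∈ 𝓝 (arc x 0)) :
    ∃ ε > (0 : ℝ), ∀ y, (coord y : ℝ) < ε → y ∈ U := by
  obtain ⟨V, hV, hVU⟩ := mem_comap.1 (comap_coord_nhds_zero_le hU)
  obtain ⟨ε, hε, h⟩ := Metric.mem_nhds_iff.1 hV
  refine ⟨ε, hε, fun y hy => hVU (h ?_)⟩
  rw [Metric.mem_ball, Subtype.dist_eq, Real.dist_eq]
  simpa [abs_of_nonneg (coord y).2.1] using hy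

/-- The parameter `a`, truncated at `1 / 5`, is moved so that `1 / a` increases by `4 * i`. -/
noncomputable def shiftParam (i : ℕ) (a : I) : I :=
  ⟨max (a : ℝ) (1 / 5) / (4 * i * max (a : ℝ) (1 / 5) + 1), by positivity, by
    rw [div_le_one (by positivity)]
    have h1 : max (a : ℝ) (1 / 5) ≤ 1 := max_le a.2.2 (by norm_num)
    have h2 : (0 : ℝ) ≤ 4 * i * max (a : ℝ) (1 / 5) := by positivity
    linarith⟩

theorem continuous_shiftParam (i : ℕ) : Continuous (shiftParam i) :=
  Continuous.subtype_mk (Continuous.div (by fun_prop) (by fun_prop) fun a => by positivity) _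

theorem shiftParam_attachParam (i : ℕ) {k : ℕ} (hk : k ≤ 4) :
    shiftParam i (attachParam k) = attachParam (4 * i + k) := by
  have h : max (attachParam k : ℝ) (1 / 5) = 1 / ((k : ℝ) + 1) := by
    rw [coe_attachParam, max_eq_left]
    have : (k : ℝ) ≤ 4 := by exact_mod_cast hk
    exact one_div_le_one_div_of_le (by positivity) (by linarith)
  refine Subtype.ext ?_
  simp only [shiftParam]
  rw [h, coe_attachParam]
  push_cast
  field_simp
  ring

theorem attachParam_zero : attachParam 0 = 1 := Subtype.ext (by simp [coe_attachParam])

theorem shiftParam_one (i : ℕ) : shiftParam i 1 = attachParam (4 * i) := by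
  rw [← attachParam_zero, shiftParam_attachParam i (Nat.zero_le 4), add_zero]

theorem shiftParam_zero (i : ℕ) : shiftParam i 0 = attachParam (4 * i + 4) := by
  refine Subtype.ext ?_
  simp only [shiftParam, coe_attachParam, Icc.coe_zero]
  rw [max_eq_right (by norm_num)]
  push_cast
  field_simp
  ring

theorem shiftParam_le (i : ℕ) (a : I) : (shiftParam i a : ℝ) ≤ 1 / (i + 1) := by
  simp only [shiftParam]
  have h1 : max (a : ℝ) (1 / 5) ≤ 1 := max_le a.2.2 (by norm_num)
  have h2 : 0 < max (a : ℝ) (1 / 5) := by positivity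
  rw [div_le_div_iff₀ (by positivity) (by positivity)]
  have : (0 : ℝ) ≤ i * max (a : ℝ) (1 / 5) := by positivity
  nlinarith

open Classical in
/-- The self-map of `Y` which maps the first four copies of `X` to those with the indices
`4 * i, …, 4 * i + 3`, and shrinks the other copies. -/
noncomputable def shift (i : ℕ) (y : Chain X x) : Chain X x :=
  build x (shiftParam i (coord y)) fun n =>
    if 4 * i ≤ n ∧ n < 4 * i + 4 then retr (n - 4 * i) y else x

@[simp] theorem coord_shift (i : ℕ) (y : Chain X x) :
    coord (shift i y) = shiftParam i (coord y) := by
  simp [shift]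

theorem retr_shift (i n : ℕ) (y : Chain X x) :
    retr n (shift i y) = if 4 * i ≤ n ∧ n < 4 * i + 4 then retr (n - 4 * i) y else x := by
  rw [shift, retr_build]
  intro h
  split_ifs with hn
  · refine retr_of_coord_ne fun h' => h ?_
    rw [h', shiftParam_attachParam i (by omega)]
    congr 1
    omega
  · rfl

theorem continuous_shift (i : ℕ) : Continuous (shift i : Chain X x → Chain X x) := by
  refine continuous_iff.2 ⟨by
    simpa [Function.comp_def] using (continuous_shiftParam i).comp (continuous_coord (x := x)),
    fun n => ?_⟩
  simp only [retr_shift]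
  split_ifs
  · exact continuous_retr _
  · exact continuous_const

theorem shift_arc (i : ℕ) (t : I) : shift i (arc x t) = arc x (shiftParam i t) :=
  ext (by simp) fun n => by simp [retr_shift]

theorem shift_pt (i : ℕ) {k : ℕ} (hk : k < 4) (p : X) :
    shift i (pt x k p) = pt x (4 * i + k) p := by
  refine ext (by simp [shiftParam_attachParam i hk.le]) fun n => ?_
  rw [retr_shift]
  split_ifs with h
  · obtain ⟨m, rfl⟩ := Nat.exists_eq_add_of_le h.1
    rw [Nat.add_sub_cancel_left]
    by_cases hm : k = m
    · subst hm; simp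
    · rw [retr_pt_of_ne hm, retr_pt_of_ne (by omega)]
  · rw [retr_pt_of_ne (by omega)]

theorem shift_collapse (i : ℕ) {s : Set ℕ} (hs : ∀ k, 4 * i + k ∈ s ↔ k ∈ s) (y : Chain X x) :
    shift i (collapse s y) = collapse s (shift i y) := by
  refine ext (by simp) fun n => ?_
  by_cases hn : n ∈ s
  · rw [retr_collapse_of_mem hn, retr_shift, retr_shift]
    split_ifs with h
    · refine retr_collapse_of_mem ((hs _).1 ?_) y
      rwa [Nat.add_sub_cancel' h.1]
    · rfl
  · rw [retr_collapse_of_notMem hn, retr_shift]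
    split_ifs with h
    · refine retr_collapse_of_notMem (fun h' => hn ?_) y
      rwa [← hs, Nat.add_sub_cancel' h.1] at h'
    · rfl

theorem eventually_shift_mem {U : Set (Chain X x)} (hU : U ∈ 𝓝 (arc x 0)) :
    ∀ᶠ i in atTop, ∀ y, shift i y ∈ U := by
  obtain ⟨ε, hε, h⟩ := exists_forall_coord_lt hU
  filter_upwards [tendsto_one_div_add_atTop_nhds_zero_nat.eventually (gt_mem_nhds hε)] with i hi y
  exact h _ (by rw [coord_shift]; exact (shiftParam_le i _).trans_lt hi)

theorem collapse_arc (s : Set ℕ) (t : I) : collapse s (arc x t) = arc x t := by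
  refine ext (by simp) fun n => ?_
  by_cases hn : n ∈ s
  · rw [retr_collapse_of_mem hn]
  · rw [retr_collapse_of_notMem hn, retr_arc]

theorem collapse_pt {s : Set ℕ} {n : ℕ} (hn : n ∉ s) (p : X) :
    collapse s (pt x n p) = arc x (attachParam n) := by
  refine ext (by simp) fun m => ?_
  by_cases hm : m ∈ s
  · rw [retr_collapse_of_mem hm, retr_arc, retr_pt_of_ne (by rintro rfl; exact hn hm)]
  · rw [retr_collapse_of_notMem hm, retr_arc]

/-- A path in the interval, as a path of arcs in `Y`. -/
noncomputable def arcPath (x : X) (s t : I) : Path (arc x s) (arc x t) :=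
  haveI := pathConnectedSpace_unitInterval
  (PathConnectedSpace.somePath s t).map continuous_arc

/-- The loop `f` in the copy with index `k`, connected to the point `1` of the interval. -/
noncomputable def lasso (k : ℕ) (f : Path x x) : Path (arc x 1) (arc x 1) :=
  ((arcPath x 1 (attachParam k)).trans
    ((f.map (continuous_pt k)).cast (arc_attachParam k) (arc_attachParam k))).trans
    (arcPath x 1 (attachParam k)).symm

theorem map_lasso {H : Type*} [Group H] (Ψ : PathCocycle (Chain X x) H) (k : ℕ) (f : Path x x) :
    Ψ (lasso k f).toContinuousMap = (Ψ (arcPath x 1 (attachParam k)).toContinuousMap)⁻¹ *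
      Ψ ((⟨pt x k, continuous_pt k⟩ : C(X, Chain X x)).comp f.toContinuousMap) *
      Ψ (arcPath x 1 (attachParam k)).toContinuousMap := by
  rw [lasso, PathCocycle.map_trans, PathCocycle.map_trans, PathCocycle.map_symm, mul_assoc]
  rfl

/-- The powers of a product of two commutators of lassos. -/
theorem exists_commutator_loop (f : Path x x) (n : ℕ) : ∃ ℓ : Path (arc x 1) (arc x 1),
    ∀ {H : Type u} [Group H] (Ψ : PathCocycle (Chain X x) H) (a : ℕ → H),
      (∀ k, Ψ (lasso k f).toContinuousMap = a k) → Ψ ℓ.toContinuousMap =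
        (a 0 * a 1 * (a 0)⁻¹ * (a 1)⁻¹ * (a 2 * a 3 * (a 2)⁻¹ * (a 3)⁻¹)) ^ n := by
  let A : ℕ → FundamentalGroup (Chain X x) (arc x 1) := fun k =>
    Path.Homotopic.Quotient.mk (lasso k f)
  obtain ⟨ℓ, hℓ⟩ := Quotient.exists_rep
    ((A 0 * A 1 * (A 0)⁻¹ * (A 1)⁻¹ * (A 2 * A 3 * (A 2)⁻¹ * (A 3)⁻¹)) ^ n)
  refine ⟨ℓ, fun {H} _ Ψ a ha => ?_⟩
  have h1 : Ψ.fundamentalGroupHom (arc x 1) (Path.Homotopic.Quotient.mk ℓ) = Ψ ℓ.toContinuousMap :=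
    rfl
  have h2 : ∀ k, Ψ.fundamentalGroupHom (arc x 1) (A k) = a k := ha
  rw [← h1, show (Path.Homotopic.Quotient.mk ℓ : FundamentalGroup _ _) = _ from hℓ]
  simp only [map_pow, map_mul, map_inv, h2]

end Chain

namespace Chain

open Monoid

variable {X : Type u} [TopologicalSpace X] {x : X}

/-- A cocycle on `X` gives a cocycle on `Y` with values in the free product of four copies of the
group, which reads the paths in four copies of `X` and neglects the other copies. -/
theorem exists_pathCocycle {G : Type*} [Group G] (Λ : PathCocycle X G) {e : Fin 4 → ℕ}
    (he : Function.Injective e) : ∃ Φ : PathCocycle (Chain X x) (CoprodI fun _ : Fin 4 => G),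
      (∀ τ : C(I, Chain X x), (∀ k t, retr (e k) (τ t) = x) → Φ τ = 1) ∧
      ∀ k (τ : C(I, X)), Φ ((⟨pt x (e k), continuous_pt (e k)⟩ : C(X, Chain X x)).comp τ) =
        CoprodI.of (M := fun _ : Fin 4 => G) (i := k) (Λ τ) := by
  let N : Fin 4 → Set (Chain X x) := fun k => {y | ∀ m, m ≠ k → coord y ≠ attachParam (e m)}
  have hN : ∀ k, IsOpen (N k) := fun k => by
    have : N k = ⋂ m, {y | m ≠ k → coord y ≠ attachParam (e m)} := by
      ext y; simp [N]
    rw [this]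
    refine isOpen_iInter_of_finite fun m => ?_
    by_cases h : m = k
    · simp [h]
    · simpa [h] using isOpen_ne.preimage continuous_coord
  have hcov : ∀ y, ∃ k, y ∈ N k := fun y => by
    by_cases h : ∃ k, coord y = attachParam (e k)
    · obtain ⟨k, hk⟩ := h
      exact ⟨k, fun m hm h' => hm (he (attachParam_injective (h'.symm.trans hk)))⟩
    · exact ⟨0, fun m _ h' => h ⟨m, h'⟩⟩
  let R : Fin 4 → C(Chain X x, X) := fun k => ⟨retr (e k), continuous_retr (e k)⟩
  let ω : C(I, Chain X x) → CoprodI (fun _ : Fin 4 => G) := fun τ =>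
    CoprodI.of (M := fun _ : Fin 4 => G) (i := 0) (Λ ((R 0).comp τ)) *
    CoprodI.of (M := fun _ : Fin 4 => G) (i := 1) (Λ ((R 1).comp τ)) *
    CoprodI.of (M := fun _ : Fin 4 => G) (i := 2) (Λ ((R 2).comp τ)) *
    CoprodI.of (M := fun _ : Fin 4 => G) (i := 3) (Λ ((R 3).comp τ))
  have hω : ∀ k (τ : C(I, Chain X x)), (∀ t, τ t ∈ N k) →
      ω τ = CoprodI.of (M := fun _ : Fin 4 => G) (i := k) (Λ ((R k).comp τ)) := by
    intro k τ hτ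
    have h1 : ∀ m, m ≠ k → Λ ((R m).comp τ) = 1 := fun m hm => by
      have : (R m).comp τ = ContinuousMap.const I x := by
        ext t
        exact retr_of_coord_ne (hτ t m hm)
      rw [this, Λ.map_const]
    simp only [ω]
    fin_cases k
    · rw [h1 1 (by decide), h1 2 (by decide), h1 3 (by decide)]; simp
    · rw [h1 0 (by decide), h1 2 (by decide), h1 3 (by decide)]; simp
    · rw [h1 0 (by decide), h1 1 (by decide), h1 3 (by decide)]; simp
    · rw [h1 0 (by decide), h1 1 (by decide), h1 2 (by decide)]; simp
  obtain ⟨Φ, hΦ⟩ := exists_pathCocycle_of_cover hN hcov ω fun k D hD => by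
    have := Λ.triangle ((R k).comp D)
    rw [TriangleLaw] at this ⊢
    rw [hω k (edge D _ _) fun t => hD _, hω k (edge D _ _) fun t => hD _,
      hω k (edge D _ _) fun t => hD _, ← map_mul]
    exact congrArg _ this
  refine ⟨Φ, fun τ hτ => Φ.eq_one_of_cover hN hcov τ fun k θ hθ => ?_, fun k τ => ?_⟩
  · have : (R k).comp (τ.comp θ) = ContinuousMap.const I x := by
      ext t
      exact hτ k (θ t)
    rw [hΦ k _ hθ, hω k _ hθ, this, Λ.map_const, map_one]
  · have h : ∀ t, (⟨pt x (e k), continuous_pt (e k)⟩ : C(X, Chain X x)).comp τ t ∈ N k :=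
      fun t m hm h' => hm (he (attachParam_injective h')).symm
    rw [hΦ k _ h, hω k _ h]
    congr 2
    ext t
    exact retr_pt_self (e k) (τ t)

theorem endHeight_add (i k : ℕ) : endHeight (4 * i + k) = endHeight k := by
  unfold endHeight
  have : Even (4 * i + k + 1) ↔ Even (k + 1) := by
    rw [add_assoc, Nat.even_add]
    simp [show Even 4 by decide]
  simp only [this]

/-- There is a path along the whole of `Y` which runs, in front of the copies of `X` with the
indices `4 * n, …, 4 * n + 3`, through the `n`-th power of a product of two commutators of loops in
these four copies. It becomes homotopic to a path of arcs when every second copy of `X` is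
collapsed, because each of the commutators then becomes trivial. -/
theorem exists_path_commutators [PathConnectedSpace X] (f : Path x x) :
    ∃ (ℓ : ℕ → Path (arc x 1) (arc x 1)) (γ : C(I, Chain X x)) (β : C(I, I)),
      γ 0 = arc x 1 ∧ γ 1 = arc x 0 ∧ β 0 = 1 ∧ β 1 = 0 ∧
      (∀ n t, γ (stage n t) = shift n ((ℓ n).trans (arcPath x 1 0) t)) ∧
      (∀ n {H : Type u} [Group H] (Ψ : PathCocycle (Chain X x) H) (a : ℕ → H),
        (∀ k, Ψ (lasso k f).toContinuousMap = a k) → Ψ (ℓ n).toContinuousMap =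
          (a 0 * a 1 * (a 0)⁻¹ * (a 1)⁻¹ * (a 2 * a 3 * (a 2)⁻¹ * (a 3)⁻¹)) ^ n) ∧
      ∀ e : I, e = 0 ∨ e = 1 → ∃ K : C(I × I, Chain X x),
        (∀ t, K (0, t) = collapse {n | endHeight n ≠ e} (γ t)) ∧ (∀ t, K (1, t) = arc x (β t)) ∧
        (∀ s, K (s, 0) = arc x 1) ∧ ∀ s, K (s, 1) = arc x 0 := by
  choose ℓ hℓ using exists_commutator_loop f
  have hjoin : ∀ n : ℕ, shift n (arc x 0) = shift (n + 1) (arc x 1) := fun n => by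
    rw [shift_arc, shift_arc, shiftParam_zero, shiftParam_one]
    rfl
  have hstart : shift 0 (arc x 1) = arc x 1 := by
    rw [shift_arc, shiftParam_one]
    simp [attachParam_zero]
  -- concatenation of a sequence of paths from `1` to `0`, moved by the shifts
  have hcat : ∀ {T : Type} [TopologicalSpace T] (p : ℕ → C(T × I, Chain X x)),
      (∀ n τ, p n (τ, 0) = arc x 1) → (∀ n τ, p n (τ, 1) = arc x 0) →
      ∃ P : C(T × I, Chain X x), (∀ τ, P (τ, 0) = arc x 1) ∧ (∀ τ, P (τ, 1) = arc x 0) ∧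
        ∀ n τ t, P (τ, stage n t) = shift n (p n (τ, t)) := by
    intro T _ p h0 h1
    obtain ⟨P, hP1, hP⟩ := exists_infinite_concat
      (fun n => (⟨shift n, continuous_shift n⟩ : C(Chain X x, Chain X x)).comp (p n)) (arc x 0)
      (fun n τ => by
        change shift n (p n (τ, 1)) = shift (n + 1) (p (n + 1) (τ, 0))
        rw [h0, h1, hjoin])
      fun U hU => (eventually_shift_mem hU).mono fun i hi q => hi _
    refine ⟨P, fun τ => ?_, hP1, hP⟩
    rw [← stage_zero_zero, hP]
    change shift 0 (p 0 (τ, 0)) = _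
    rw [h0, hstart]
  obtain ⟨γ, hγ0, hγ1, hγ⟩ := hcat (T := Unit) (fun n =>
    ⟨fun q => (ℓ n).trans (arcPath x 1 0) q.2, by fun_prop⟩)
    (fun n _ => ((ℓ n).trans (arcPath x 1 0)).source)
    fun n _ => ((ℓ n).trans (arcPath x 1 0)).target
  obtain ⟨β, hβ0, hβ1, hβ⟩ := hcat (T := Unit) (fun _ =>
    ⟨fun q => arcPath x 1 0 q.2, by fun_prop⟩) (fun _ _ => (arcPath x 1 0).source)
    fun _ _ => (arcPath x 1 0).target
  have hβarc : ∀ t, β ((), t) = arc x (coord (β ((), t))) := by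
    intro t
    by_cases ht : t = 1
    · rw [ht, hβ1]; rfl
    · obtain ⟨n, t, rfl⟩ := exists_eq_stage ht
      rw [hβ]
      change shift n (arcPath x 1 0 t) = arc x (coord (shift n (arcPath x 1 0 t)))
      have : ∃ b, arcPath x 1 0 t = arc x b := ⟨_, rfl⟩
      obtain ⟨b, hb⟩ := this
      rw [hb, shift_arc, coord_arc]
  refine ⟨ℓ, ⟨fun t => γ ((), t), by fun_prop⟩, ⟨fun t => coord (β ((), t)),
    continuous_coord.comp (by fun_prop)⟩, hγ0 _, hγ1 _, ?_, ?_, fun n t => hγ n _ t, hℓ,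
    fun e he => ?_⟩
  · change coord (β ((), 0)) = 1
    rw [hβ0, coord_arc]
  · change coord (β ((), 1)) = 0
    rw [hβ1, coord_arc]
  set S : Set ℕ := {n | endHeight n ≠ e} with hS
  have hSadd : ∀ i k, 4 * i + k ∈ S ↔ k ∈ S := fun i k => by
    simp only [hS, mem_ofPred_eq, endHeight_add]
  obtain ⟨Λ, hΛ⟩ := exists_pathCocycle_fundamentalGroup (arc x 1)
  -- the loops are null-homotopic after the collapse
  let Θ := Λ.comp ⟨collapse S, continuous_collapse S⟩
  have hlasso : ∀ k, k ∉ S → Θ (lasso k f).toContinuousMap = 1 := fun k hk => by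
    have h1 : Θ ((⟨pt x k, continuous_pt k⟩ : C(X, Chain X x)).comp f.toContinuousMap) = 1 := by
      rw [← Λ.map_const (arc x (attachParam k))]
      refine congrArg Λ ?_
      ext t
      exact collapse_pt hk _
    rw [map_lasso, h1, mul_one, inv_mul_cancel]
  have hΘ : ∀ n, Θ (ℓ n).toContinuousMap = 1 := fun n => by
    rw [hℓ n Θ (fun k => Θ (lasso k f).toContinuousMap) fun _ => rfl]
    have h : (0 ∉ S ∧ 2 ∉ S) ∨ (1 ∉ S ∧ 3 ∉ S) := by
      rcases he with rfl | rfl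
      · left; simp [hS, endHeight, show ¬ Even 3 by decide]
      · right; simp [hS, endHeight, show Even 4 by decide]
    rcases h with ⟨h0, h2⟩ | ⟨h1, h3⟩
    · rw [hlasso 0 h0, hlasso 2 h2]
      simp only [one_mul, mul_one, inv_one, mul_inv_cancel, one_pow]
    · rw [hlasso 1 h1, hlasso 3 h3]
      simp only [mul_one, inv_one, mul_inv_cancel, one_pow]
  have hH : ∀ n, ∃ Hn : C(I × I, Chain X x),
      (∀ t, Hn (0, t) = collapse S ((ℓ n).trans (arcPath x 1 0) t)) ∧
      (∀ t, Hn (1, t) = arcPath x 1 0 t) ∧ (∀ s, Hn (s, 0) = arc x 1) ∧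
      ∀ s, Hn (s, 1) = arc x 0 := by
    intro n
    let c : Path (arc x 1) (arc x 1) := ((ℓ n).map (continuous_collapse S)).cast
      (collapse_arc S 1).symm (collapse_arc S 1).symm
    have hc : c.Homotopic (Path.refl _) := by
      have h1 := hΛ c
      have h2 : Λ c.toContinuousMap = 1 := hΘ n
      rw [h2] at h1
      exact Quotient.exact h1.symm
    obtain ⟨Hn⟩ : (c.trans (arcPath x 1 0)).Homotopic (arcPath x 1 0) :=
      (hc.hcomp (Path.Homotopic.refl _)).trans ⟨Path.Homotopy.reflTrans _⟩
    refine ⟨Hn.toContinuousMap, fun t => (Hn.apply_zero t).trans ?_, Hn.apply_one, Hn.source,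
      Hn.target⟩
    change (c.trans (arcPath x 1 0)) t = _
    rw [Path.trans_apply, Path.trans_apply]
    split_ifs
    · rfl
    · exact (collapse_arc S _).symm
  choose Hn hH0 hH1 hHs hHt using hH
  obtain ⟨K, hK0, hK1, hK⟩ := hcat Hn hHs hHt
  refine ⟨K, fun t => ?_, fun t => ?_, hK0, hK1⟩
  · change _ = collapse S (γ ((), t))
    by_cases ht : t = 1
    · rw [ht, hK1, hγ1, collapse_arc]
    · obtain ⟨n, t, rfl⟩ := exists_eq_stage ht
      rw [hK, hγ, hH0, shift_collapse n (hSadd n)]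
      rfl
  · change _ = arc x (coord (β ((), t)))
    rw [← hβarc]
    by_cases ht : t = 1
    · rw [ht, hK1, hβ1]
    · obtain ⟨n, t, rfl⟩ := exists_eq_stage ht
      rw [hK, hβ, hH1]
      rfl

end Chain

namespace AC

variable {X : Type u} [TopologicalSpace X] {x : X}

/-- The sphere in the alternating cone made of the cylinder over a path `γ` in `Y` and of
homotopies, at the two ends, from `γ` to a path of arcs. Its equator is `γ` up to arcs. -/
theorem exists_sphere {γ : C(I, Chain X x)} {β : C(I, I)} (hγ0 : γ 0 = Chain.arc x 1)
    (hγ1 : γ 1 = Chain.arc x 0) (hβ0 : β 0 = 1) (hβ1 : β 1 = 0)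
    (hK : ∀ e : I, e = 0 ∨ e = 1 → ∃ K : C(I × I, Chain X x),
        (∀ t, K (0, t) = Chain.collapse {n | endHeight n ≠ e} (γ t)) ∧
        (∀ t, K (1, t) = Chain.arc x (β t)) ∧
        (∀ s, K (s, 0) = Chain.arc x 1) ∧ ∀ s, K (s, 1) = Chain.arc x 0) :
    ∃ F : C(Fin 2 → ℝ, AC X x), (∀ z, 1 ≤ ‖z‖ → F z = sq x (clampI (1 / 2)) (clampI (1 / 2))) ∧
      (∀ z, z 1 ≤ 0 → height (F z) ≤ clampI (1 / 2)) ∧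
      (∀ z, 0 ≤ z 1 → clampI (1 / 2) ≤ height (F z)) ∧
      (∀ t : I, F ![t - 1 / 2, 0] = mk (γ t) (clampI (1 / 2))) ∧
      ∀ u : ℝ, 1 / 2 ≤ |u| → ∃ a, F ![u, 0] = sq x a (clampI (1 / 2)) := by
  obtain ⟨K0, hK00, hK01, hK0s, hK0t⟩ := hK 0 (Or.inl rfl)
  obtain ⟨K1, hK10, hK11, hK1s, hK1t⟩ := hK 1 (Or.inr rfl)
  have hcl0 : ∀ {s : ℝ}, s ≤ 0 → clampI s = 0 := fun h => projIcc_of_le_left _ h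
  have hcl1 : ∀ {s : ℝ}, 1 ≤ s → clampI s = 1 := fun h => projIcc_of_right_le _ h
  have hmono : Monotone clampI := monotone_projIcc zero_le_one
  have hγK0 : ∀ s, mk (K0 (0, s)) 0 = mk (γ s) 0 := fun s => by rw [hK00, mk_collapse]
  have hγK1 : ∀ s, mk (K1 (0, s)) 1 = mk (γ s) 1 := fun s => by rw [hK10, mk_collapse]
  let F0 : ℝ → ℝ → AC X x := fun s t =>
    if t ≤ 1 / 3 then mk (K0 (clampI (1 - 3 * t), clampI s)) 0 else
    if t ≤ 2 / 3 then mk (γ (clampI s)) (clampI (3 * t - 1)) else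
    mk (K1 (clampI (3 * t - 2), clampI s)) 1
  have hcl : ∀ {T : Type} [TopologicalSpace T] {g : T → ℝ}, Continuous g →
      Continuous fun t => clampI (g t) := fun h => continuous_clampI.comp h
  have hmk : ∀ {T : Type} [TopologicalSpace T] {y : T → Chain X x} {h : T → I}, Continuous y →
      Continuous h → Continuous fun t => mk (y t) (h t) := fun h h' =>
    continuous_mk.comp (h.prodMk h')
  have hF0 : Continuous fun q : ℝ × ℝ => F0 q.1 q.2 := by
    refine Continuous.if_le (hmk (K0.continuous.comp ((hcl (by fun_prop)).prodMk
      (hcl (by fun_prop)))) continuous_const) (Continuous.if_le (hmk (γ.continuous.comp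
      (hcl (by fun_prop))) (hcl (by fun_prop))) (hmk (K1.continuous.comp ((hcl (by fun_prop)).prodMk
      (hcl (by fun_prop)))) continuous_const) continuous_snd continuous_const ?_) continuous_snd
      continuous_const ?_
    · rintro ⟨s, t⟩ h
      simp only at h
      subst h
      norm_num
      rw [hγK1]
    · rintro ⟨s, t⟩ h
      simp only at h
      subst h
      norm_num
      rw [hγK0]
  have hout : ∀ s t : ℝ, s ≤ 0 ∨ 1 ≤ s ∨ t ≤ 0 ∨ 1 ≤ t →
      F0 s t = sq x (β (clampI s)) (clampI (3 * t - 1)) := by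
    intro s t h
    have hs : s ≤ 0 ∨ 1 ≤ s → F0 s t = sq x (β (clampI s)) (clampI (3 * t - 1)) := by
      intro h
      have : ∃ a, (∀ v, K0 (v, clampI s) = Chain.arc x a) ∧
          (∀ v, K1 (v, clampI s) = Chain.arc x a) ∧
          γ (clampI s) = Chain.arc x a ∧ β (clampI s) = a := by
        rcases h with h | h
        · rw [hcl0 h]; exact ⟨1, hK0s, hK1s, hγ0, hβ0⟩
        · rw [hcl1 h]; exact ⟨0, hK0t, hK1t, hγ1, hβ1⟩
      obtain ⟨a, h1, h2, h3, h4⟩ := this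
      simp only [F0, h1, h2, h3, h4]
      split_ifs with h5 h6
      · rw [hcl0 (by linarith : 3 * t - 1 ≤ 0)]; rfl
      · rfl
      · rw [hcl1 (by linarith : 1 ≤ 3 * t - 1)]; rfl
    rcases h with h | h | h | h
    · exact hs (Or.inl h)
    · exact hs (Or.inr h)
    · simp only [F0]
      rw [if_pos (by linarith), hcl1 (by linarith : 1 ≤ 1 - 3 * t), hK01,
        hcl0 (by linarith : 3 * t - 1 ≤ 0)]
      rfl
    · simp only [F0]
      rw [if_neg (by linarith), if_neg (by linarith), hcl1 (by linarith : 1 ≤ 3 * t - 2), hK11,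
        hcl1 (by linarith : 1 ≤ 3 * t - 1)]
      rfl
  have hhalf : ∀ a : I, mix a (clampI (1 / 2)) (clampI (1 / 2)) = clampI (1 / 2) := fun a =>
    mix_self a _
  have hmixle : ∀ a b c : I, b ≤ c → mix a b c ≤ c := fun a b c h => by
    have h' : (b : ℝ) ≤ c := h
    refine Subtype.coe_le_coe.1 ?_
    simp only [mix]
    nlinarith [a.2.1, a.2.2]
  have hmixge : ∀ a b c : I, c ≤ b → c ≤ mix a b c := fun a b c h => by
    have h' : (c : ℝ) ≤ b := h
    refine Subtype.coe_le_coe.1 ?_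
    simp only [mix]
    nlinarith [a.2.1, a.2.2]
  let F : (Fin 2 → ℝ) → AC X x := fun z => if ‖z‖ ≤ 1 / 2 then F0 (z 0 + 1 / 2) (z 1 + 1 / 2) else
    sq x (mix (clampI (2 * ‖z‖ - 1)) (β (clampI (z 0 + 1 / 2))) (clampI (1 / 2)))
      (mix (clampI (2 * ‖z‖ - 1)) (clampI (3 * (z 1 + 1 / 2) - 1)) (clampI (1 / 2)))
  have hF : Continuous F := by
    refine Continuous.if_le (hF0.comp (g := fun q : ℝ × ℝ => F0 q.1 q.2)
      (f := fun z : Fin 2 → ℝ => (z 0 + 1 / 2, z 1 + 1 / 2)) (by fun_prop))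
      (continuous_sq.comp (Continuous.prodMk (continuous_mix.comp ((hcl (by fun_prop)).prodMk
        ((β.continuous.comp (hcl (by fun_prop))).prodMk continuous_const)))
        (continuous_mix.comp ((hcl (by fun_prop)).prodMk ((hcl (by fun_prop)).prodMk
          continuous_const))))) continuous_norm continuous_const fun z hz => ?_
    have h : ∃ i, 1 / 2 ≤ |z i| := by
      by_contra! h
      have := (pi_norm_lt_iff (by norm_num : (0 : ℝ) < 1 / 2)).2 fun i =>
        show ‖z i‖ < 1 / 2 from h i
      linarith
    have h' : z 0 + 1 / 2 ≤ 0 ∨ 1 ≤ z 0 + 1 / 2 ∨ z 1 + 1 / 2 ≤ 0 ∨ 1 ≤ z 1 + 1 / 2 := by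
      obtain ⟨i, hi⟩ := h
      rcases le_abs.1 hi with h1 | h1 <;> fin_cases i <;> simp only [Fin.zero_eta, Fin.mk_one] at h1
      · exact Or.inr (Or.inl (by linarith))
      · exact Or.inr (Or.inr (Or.inr (by linarith)))
      · exact Or.inl (by linarith)
      · exact Or.inr (Or.inr (Or.inl (by linarith)))
    rw [hout _ _ h', hz]
    norm_num
  have hnorm : ∀ u : ℝ, ‖(![u, 0] : Fin 2 → ℝ)‖ = |u| := fun u => by
    refine le_antisymm ((pi_norm_le_iff_of_nonneg (abs_nonneg u)).2 fun i => ?_) ?_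
    · fin_cases i <;> simp
    · simpa using norm_le_pi_norm (![u, 0] : Fin 2 → ℝ) 0
  refine ⟨⟨F, hF⟩, fun z hz => ?_, fun z hz => ?_, fun z hz => ?_, fun t => ?_, fun u hu => ?_⟩
  · change F z = _
    simp only [F]
    rw [if_neg (by linarith), hcl1 (by linarith : 1 ≤ 2 * ‖z‖ - 1), mix_one, mix_one]
  · change height (F z) ≤ _
    simp only [F]
    split_ifs
    · simp only [F0]
      rw [apply_ite height, apply_ite height]
      simp only [height_mk]
      split_ifs
      · exact (clampI (1 / 2)).2.1
      · exact hmono (by linarith)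
      · linarith
    · exact hmixle _ _ _ (hmono (by linarith))
  · change _ ≤ height (F z)
    simp only [F]
    split_ifs
    · simp only [F0]
      rw [apply_ite height, apply_ite height]
      simp only [height_mk]
      split_ifs
      · linarith
      · exact hmono (by linarith)
      · exact (clampI (1 / 2)).2.2
    · exact hmixge _ _ _ (hmono (by linarith))
  · change F _ = _
    simp only [F]
    rw [hnorm, if_pos (abs_le.2 ⟨by linarith [t.2.1], by linarith [t.2.2]⟩)]
    simp only [F0, Matrix.cons_val_zero, Matrix.cons_val_one, sub_add_cancel, clampI_coe]
    norm_num
  · change ∃ a, F _ = _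
    simp only [F]
    rw [hnorm]
    have hh : clampI (3 * (0 + 1 / 2) - 1) = clampI (1 / 2) := by norm_num
    by_cases h : |u| ≤ 1 / 2
    · rw [if_pos h, hout]
      · exact ⟨_, by simp only [Matrix.cons_val_one]; rw [← hh]; rfl⟩
      · simp only [Matrix.cons_val_zero]
        rcases le_abs.1 hu with h1 | h1
        · exact Or.inr (Or.inl (by linarith))
        · exact Or.inl (by linarith)
    · rw [if_neg h]
      simp only [Matrix.cons_val_one, Matrix.cons_val_fin_one]
      rw [hh, hhalf]
      exact ⟨_, rfl⟩

end AC

theorem stage_le_stage_zero {n : ℕ} {t : I} (h : stage n t ≤ stage n 0) : t = 0 := by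
  have h' : (stage n t : ℝ) ≤ stage n 0 := h
  have hn : (0 : ℝ) ≤ n := Nat.cast_nonneg n
  simp only [stage, Icc.coe_zero, add_zero] at h'
  rw [div_le_div_iff₀ (by linarith [t.2.1]) (by linarith)] at h'
  exact Subtype.ext (le_antisymm (by simp only [Icc.coe_zero]; nlinarith) t.2.1)

theorem stage_one_le_stage {n : ℕ} {t : I} (h : stage n 1 ≤ stage n t) : t = 1 := by
  have h' : (stage n 1 : ℝ) ≤ stage n t := h
  have hn : (0 : ℝ) ≤ n := Nat.cast_nonneg n
  simp only [stage, Icc.coe_one] at h'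
  rw [div_le_div_iff₀ (by linarith) (by linarith [t.2.1])] at h'
  exact Subtype.ext (le_antisymm t.2.2 (by simp only [Icc.coe_one]; nlinarith))

namespace AC

open Monoid

variable {X : Type u} [TopologicalSpace X] {x : X}

/-- If all spheres in the alternating cone are null-homotopic, then the fundamental group of `X` is
trivial. Otherwise the connecting homomorphism that belongs to the two open cones, with values in
the sequences of integers modulo bounded sequences, would detect the path of commutators on the
equator of a sphere. -/
theorem subsingleton_fundamentalGroup [PathConnectedSpace X]
    (h : NullSphere (AC X x) (sq x (clampI (1 / 2)) (clampI (1 / 2)))) :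
    Subsingleton (FundamentalGroup X x) := by
  classical
  by_contra hns
  rw [not_subsingleton_iff_nontrivial] at hns
  obtain ⟨g, hg⟩ := exists_ne (1 : FundamentalGroup X x)
  obtain ⟨f, hf⟩ := Quotient.exists_rep g
  obtain ⟨Λ, hΛ⟩ := exists_pathCocycle_fundamentalGroup x
  have hΛf : Λ f.toContinuousMap = g := (hΛ f).trans hf
  obtain ⟨ℓ, γ, β, hγ0, hγ1, hβ0, hβ1, hγ, hℓ, hK⟩ := Chain.exists_path_commutators f
  obtain ⟨F, hF1, hFlo, hFup, hFγ, hFarc⟩ := exists_sphere hγ0 hγ1 hβ0 hβ1 hK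
  obtain ⟨ψ, hψ, hψn⟩ := exists_quasimorphism hg
  have hex := fun i : ℕ => Chain.exists_pathCocycle (x := x) Λ (e := fun k : Fin 4 => 4 * i + k)
    fun k l hkl => Fin.ext (Nat.add_left_cancel hkl)
  choose Φ hΦ1 hΦ using hex
  let B : AddSubgroup (ℕ → ℤ) :=
    { carrier := {s | ∃ C, ∀ n, |s n| ≤ C}
      zero_mem' := ⟨0, fun n => by simp⟩
      add_mem' := by
        rintro s t ⟨C, hC⟩ ⟨D, hD⟩
        exact ⟨C + D, fun n => (abs_add_le _ _).trans (add_le_add (hC n) (hD n))⟩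
      neg_mem' := by
        rintro s ⟨C, hC⟩
        exact ⟨C, fun n => by simpa using hC n⟩ }
  let φ : C(I, Chain X x) → (ℕ → ℤ) ⧸ B := fun τ => QuotientAddGroup.mk fun i => ψ (Φ i τ)
  have hcont : ∀ {T : Type} [TopologicalSpace T] (τ : C(T, AC X x)),
      (∀ t, height (τ t) ≠ 0 ∧ height (τ t) ≠ 1) → Continuous fun t => chainPart (τ t) :=
    fun τ hτ => continuousOn_chainPart.comp_continuous τ.continuous hτ
  let ω : C(I, AC X x) → (ℕ → ℤ) ⧸ B := fun τ =>
    if hτ : ∀ t, height (τ t) ≠ 0 ∧ height (τ t) ≠ 1 then φ ⟨_, hcont τ hτ⟩ else 0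
  have hhalf0 : clampI (1 / 2) ≠ 0 := fun h => by
    have := congrArg Subtype.val h
    rw [clampI, projIcc_of_mem zero_le_one ⟨by norm_num, by norm_num⟩] at this
    norm_num at this
  have hhalf1 : clampI (1 / 2) ≠ 1 := fun h => by
    have := congrArg Subtype.val h
    rw [clampI, projIcc_of_mem zero_le_one ⟨by norm_num, by norm_num⟩] at this
    norm_num at this
  have hlt1 : clampI (1 / 2) < 1 := lt_of_le_of_ne (clampI (1 / 2)).2.2 hhalf1
  have hgt0 : 0 < clampI (1 / 2) := lt_of_le_of_ne (clampI (1 / 2)).2.1 hhalf0.symm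
  have hω : ∀ G : C(ℝ × ℝ, AC X x), (∀ z, G z ∈ {q | height q ≠ 1} ∩ {q | height q ≠ 0}) →
      TriangleLaw (fun τ => Multiplicative.ofAdd (ω τ)) G := by
    intro G hG
    have hG' : ∀ z, height (G z) ≠ 0 ∧ height (G z) ≠ 1 := fun z => ⟨(hG z).2, (hG z).1⟩
    have he : ∀ p q, ω (edge G p q) = φ (edge ⟨_, hcont G hG'⟩ p q) := fun p q =>
      dif_pos fun t => hG' _
    rw [TriangleLaw, he, he, he, ← ofAdd_add]
    congr 1
    rw [← QuotientAddGroup.mk_add]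
    refine QuotientAddGroup.eq.2 ⟨10, fun n => ?_⟩
    have h1 := (Φ n).triangle ⟨_, hcont G hG'⟩
    rw [TriangleLaw] at h1
    simp only [Pi.add_apply, Pi.neg_apply]
    rw [h1, abs_le]
    have h2 := abs_le.1 (hψ (Φ n (edge ⟨_, hcont G hG'⟩ (1, 0) (0, 1)))
      (Φ n (edge ⟨_, hcont G hG'⟩ (0, 0) (1, 0))))
    constructor <;> linarith
  have hzero := equator_eq_zero (isOpen_ne.preimage continuous_height)
    (isOpen_ne.preimage continuous_height) (U := {q : AC X x | height q ≠ 1})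
    (V := {q : AC X x | height q ≠ 0}) (fun q => by
      by_cases hq : height q = 1
      · right; simp [hq]
      · exact Or.inl hq) ω hω ⟨hhalf1, hhalf0⟩ h F hF1
    (fun z hz => ((hFlo z hz).trans_lt hlt1).ne) fun z hz => (hgt0.trans_le (hFup z hz)).ne'
  -- the equator
  have hheq : ∀ u : ℝ, height (F ![u, 0]) = clampI (1 / 2) := fun u =>
    le_antisymm (hFlo _ (by simp)) (hFup _ (by simp))
  let E : C(ℝ, AC X x) := F.comp ⟨fun u => ![u, 0], by fun_prop⟩
  have hE : ∀ u, height (E u) ≠ 0 ∧ height (E u) ≠ 1 := fun u => by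
    change height (F ![u, 0]) ≠ 0 ∧ height (F ![u, 0]) ≠ 1
    rw [hheq]; exact ⟨hhalf0, hhalf1⟩
  let c : C(ℝ, Chain X x) := ⟨_, hcont E hE⟩
  have hcγ : ∀ t : I, c (t - 1 / 2) = γ t := fun t => by
    change chainPart (F ![(t : ℝ) - 1 / 2, 0]) = _
    rw [hFγ, chainPart_mk hhalf0 hhalf1]
  have hcarc : ∀ (u : ℝ) n, 1 / 2 ≤ |u| → Chain.retr n (c u) = x := fun u n hu => by
    obtain ⟨a, ha⟩ := hFarc u hu
    change Chain.retr n (chainPart (F ![u, 0])) = _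
    rw [ha, sq, chainPart_mk hhalf0 hhalf1, Chain.retr_arc]
  have heq : edge F ![-1, 0] ![1, 0] = edge E (-1) 1 := by
    ext t
    change F _ = F _
    congr 1
    ext i
    fin_cases i <;> simp
  have hbdd : ∃ C, ∀ i, |ψ (Φ i (edge c (-1) 1))| ≤ C := by
    have h1 : φ (edge c (-1) 1) = 0 := by
      rw [← hzero, heq]
      symm
      exact dif_pos fun t => hE _
    exact (QuotientAddGroup.eq_zero_iff _).1 h1
  -- evaluation on the equator
  have harc : ∀ i (k : Fin 4) (s : I), (∀ t, s = stage i t → t = 0 ∨ t = 1) →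
      Chain.retr (4 * i + k) (γ s) = x := by
    intro i k s hs
    by_cases hs1 : s = 1
    · rw [hs1, hγ1, Chain.retr_arc]
    · obtain ⟨n, t, rfl⟩ := exists_eq_stage hs1
      by_cases hn : n = i
      · subst hn
        rw [hγ]
        rcases hs t rfl with rfl | rfl
        · rw [Path.source, Chain.shift_arc, Chain.retr_arc]
        · rw [Path.target, Chain.shift_arc, Chain.retr_arc]
      · rw [hγ, Chain.retr_shift, if_neg (by omega)]
  have hretr : ∀ i (k : Fin 4) (u : ℝ),
      u ≤ stage i 0 - 1 / 2 ∨ (stage i 1 : ℝ) - 1 / 2 ≤ u → Chain.retr (4 * i + k) (c u) = x := by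
    intro i k u hu
    by_cases hu' : 1 / 2 ≤ |u|
    · exact hcarc u _ hu'
    · have hu'' := abs_lt.1 (not_le.1 hu')
      have h1 : u = ((⟨u + 1 / 2, by linarith, by linarith⟩ : I) : ℝ) - 1 / 2 := by simp
      rw [h1, hcγ]
      refine harc i k _ fun t ht => ?_
      rcases hu with hu | hu
      · exact Or.inl (stage_le_stage_zero (by
          rw [← ht]; exact Subtype.coe_le_coe.1 (by simp only; linarith)))
      · exact Or.inr (stage_one_le_stage (by
          rw [← ht]; exact Subtype.coe_le_coe.1 (by simp only; linarith)))
  have hstage0 : ∀ i, -1 ≤ (stage i 0 : ℝ) - 1 / 2 := fun i => by linarith [(stage i 0).2.1]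
  have hstage1 : ∀ i, (stage i 1 : ℝ) - 1 / 2 ≤ 1 := fun i => by linarith [(stage i 1).2.2]
  have hval : ∀ i, Φ i (edge c (-1) 1) = letterProd (commutatorWord g) ^ i := by
    intro i
    have h1 : Φ i (edge c (-1) (stage i 0 - 1 / 2)) = 1 := hΦ1 i _ fun k t =>
      hretr i k _ (Or.inl (by
      have := hstage0 i
      have h0 := t.2.1
      have h1 := t.2.2
      simp only [smul_eq_mul]
      nlinarith))
    have h2 : Φ i (edge c (stage i 1 - 1 / 2) 1) = 1 := hΦ1 i _ fun k t => hretr i k _ (Or.inr (by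
      have := hstage1 i
      have h0 := t.2.1
      have h1 := t.2.2
      simp only [smul_eq_mul]
      nlinarith))
    rw [← (Φ i).map_edge_mul c (-1) (stage i 1 - 1 / 2) 1, h2, one_mul,
      ← (Φ i).map_edge_mul c (-1) (stage i 0 - 1 / 2) (stage i 1 - 1 / 2), h1, mul_one]
    let p : Path ((stage i 0 : ℝ) - 1 / 2) ((stage i 1 : ℝ) - 1 / 2) :=
      ⟨⟨fun t => (stage i 0 - 1 / 2 : ℝ) +
          (t : ℝ) • ((stage i 1 - 1 / 2 : ℝ) - (stage i 0 - 1 / 2)),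
        by fun_prop⟩, by simp, by simp⟩
    let p' : Path ((stage i 0 : ℝ) - 1 / 2) ((stage i 1 : ℝ) - 1 / 2) :=
      ⟨⟨fun t => stage i t - 1 / 2,
        (continuous_subtype_val.comp (continuous_stage i)).sub continuous_const⟩, rfl, rfl⟩
    have h3 : edge c (stage i 0 - 1 / 2) (stage i 1 - 1 / 2) = c.comp p.toContinuousMap := rfl
    rw [h3, (Φ i).map_comp_eq c p p']
    have h4 : c.comp p'.toContinuousMap =
        (⟨Chain.shift i, Chain.continuous_shift i⟩ : C(Chain X x, Chain X x)).comp
          ((ℓ i).trans (Chain.arcPath x 1 0)).toContinuousMap := by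
      ext t
      exact (hcγ _).trans (hγ i t)
    rw [h4, ← PathCocycle.comp_apply, PathCocycle.map_trans]
    have hΨarc : ∀ s t, (Φ i).comp ⟨Chain.shift i, Chain.continuous_shift i⟩
        (Chain.arcPath x s t).toContinuousMap = 1 := fun s t => hΦ1 i _ fun k v => by
      change Chain.retr _ (Chain.shift i (Chain.arc x _)) = x
      rw [Chain.shift_arc, Chain.retr_arc]
    have hΨ : ∀ k : Fin 4, (Φ i).comp ⟨Chain.shift i, Chain.continuous_shift i⟩
        (Chain.lasso k f).toContinuousMap =
        CoprodI.of (M := fun _ : Fin 4 => FundamentalGroup X x) (i := k) g := fun k => by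
      rw [Chain.map_lasso, hΨarc, inv_one, one_mul, mul_one, ← hΛf, ← hΦ i k]
      refine congrArg (Φ i) ?_
      ext t
      exact Chain.shift_pt i k.2 _
    rw [hΨarc, one_mul, hℓ i _ (fun k => _) fun k => rfl]
    have e0 := hΨ 0
    have e1 := hΨ 1
    have e2 := hΨ 2
    have e3 := hΨ 3
    simp only [Fin.isValue, Fin.val_zero, Fin.val_one, Fin.val_two] at e0 e1 e2 e3
    rw [e0, e1, e2, show Chain.lasso 3 f = Chain.lasso ((3 : Fin 4) : ℕ) f from rfl, e3]
    simp [letterProd, commutatorWord, mul_assoc]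
  obtain ⟨C, hC⟩ := hbdd
  have hC0 : 0 ≤ C := (abs_nonneg _).trans (hC 0)
  have := hC (C.toNat + 1)
  rw [hval, hψn, abs_of_nonneg (by positivity)] at this
  push_cast at this
  rw [Int.toNat_of_nonneg hC0] at this
  linarith

/-- A simply connected space satisfies `nullSphere_of_simplyConnected`; conversely, all base points
are equivalent for `subsingleton_fundamentalGroup`. -/
theorem subsingleton_fundamentalGroup_iff [PathConnectedSpace X] (p : X) (q : AC X x) :
    Subsingleton (FundamentalGroup X p) ↔ Subsingleton (π_ 2 (AC X x) q) := by
  constructor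
  · intro h
    have := simplyConnectedSpace_of_subsingleton h
    exact (subsingleton_pi_two_iff q _).2 nullSphere_of_simplyConnected
  · intro h
    have h1 := subsingleton_fundamentalGroup ((subsingleton_pi_two_iff q _).1 h)
    have := simplyConnectedSpace_of_subsingleton h1
    infer_instance

end AC

/-! ### The alternating cone of the circle is a Peano continuum -/

theorem Circle.nontrivial_fundamentalGroup (x : Circle) :
    Nontrivial (FundamentalGroup Circle x) := by
  obtain ⟨t, rfl⟩ := Circle.exp_surjective x
  have h : Nontrivial (AddSubgroup.zmultiples (2 * Real.pi)) :=
    ⟨⟨⟨2 * Real.pi, AddSubgroup.mem_zmultiples _⟩, 0, fun h =>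
      Real.two_pi_pos.ne' (congrArg Subtype.val h)⟩⟩
  have := (Circle.isAddQuotientCoveringMap_exp.fundamentalGroupEquiv
    (⟨t, rfl⟩ : Circle.exp ⁻¹' {Circle.exp t})).toEquiv.nontrivial
  exact this

namespace Chain

theorem exists_mix_eq {t : I} (ht : t ≠ 0) :
    ∃ (n : ℕ) (s : I), t = mix s (attachParam n) (attachParam (n + 1)) := by
  have ht0 : (0 : ℝ) < t := lt_of_le_of_ne t.2.1 fun h => ht (Subtype.ext h.symm)
  have h1 : 1 ≤ 1 / (t : ℝ) := (one_le_div ht0).2 t.2.2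
  have hn1 : 1 ≤ ⌊1 / (t : ℝ)⌋₊ := Nat.le_floor (by exact_mod_cast h1)
  obtain ⟨n, hn⟩ := Nat.exists_eq_add_of_le' hn1
  have h2 : ((n : ℝ) + 1) ≤ 1 / t := by
    have := Nat.floor_le (zero_le_one.trans h1)
    rw [hn] at this
    exact_mod_cast this
  have h3 : 1 / (t : ℝ) < n + 2 := by
    have := Nat.lt_floor_add_one (1 / (t : ℝ))
    rw [hn] at this
    push_cast at this
    linarith
  rw [le_div_iff₀ ht0] at h2
  rw [div_lt_iff₀ ht0] at h3
  have hpos : (0 : ℝ) < n + 1 := by positivity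
  have hpos2 : (0 : ℝ) < n + 2 := by positivity
  have htn : (t : ℝ) ≤ 1 / (n + 1) := by rw [le_div_iff₀ hpos]; linarith
  have htn2 : 1 / ((n : ℝ) + 2) ≤ t := by rw [div_le_iff₀ hpos2]; linarith
  have hd : (1 / ((n : ℝ) + 1) - 1 / (n + 2)) = 1 / ((n + 1) * (n + 2)) := by field_simp; ring
  have hdp : (0 : ℝ) < 1 / ((n : ℝ) + 1) - 1 / (n + 2) := by rw [hd]; positivity
  refine ⟨n, ⟨(1 / (n + 1) - t) / (1 / ((n : ℝ) + 1) - 1 / (n + 2)),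
    div_nonneg (by linarith) hdp.le, (div_le_one hdp).2 (by linarith)⟩, Subtype.ext ?_⟩
  simp only [mix, coe_attachParam]
  have e : ((n + 1 : ℕ) : ℝ) + 1 = n + 2 := by push_cast; ring
  rw [e]
  generalize 1 / ((n : ℝ) + 1) = a at *
  generalize 1 / ((n : ℝ) + 2) = b at *
  field_simp
  ring

theorem exists_surjective_circle (x : Circle) :
    ∃ f : C(I, Chain Circle x), Function.Surjective f := by
  let loop : Path x x :=
    { toFun := fun t => x * Circle.exp (2 * Real.pi * t)
      continuous_toFun := by fun_prop
      source' := by simp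
      target' := by simp }
  have hloop : ∀ z, ∃ t, loop t = z := fun z => by
    obtain ⟨θ, hθ⟩ := Circle.exp_surjective (x⁻¹ * z)
    refine ⟨⟨Int.fract (θ / (2 * Real.pi)), Int.fract_nonneg _, (Int.fract_lt_one _).le⟩, ?_⟩
    change x * Circle.exp (2 * Real.pi * Int.fract (θ / (2 * Real.pi))) = z
    have h : 2 * Real.pi * Int.fract (θ / (2 * Real.pi)) =
        θ - 2 * Real.pi * (⌊θ / (2 * Real.pi)⌋ : ℤ) := by
      rw [Int.fract]
      have := Real.pi_pos
      field_simp
    rw [h, Circle.exp_sub, Circle.exp_two_pi_mul_int, div_one, hθ]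
    group
  let arcs : ∀ n, Path (arc x (attachParam n)) (arc x (attachParam (n + 1))) := fun n =>
    { toFun := fun t => arc x (mix t (attachParam n) (attachParam (n + 1)))
      continuous_toFun := continuous_arc.comp (continuous_mix.comp
        (continuous_id.prodMk
        (continuous_const.prodMk continuous_const)))
      source' := by simp
      target' := by simp }
  let p : ∀ n, Path (arc x (attachParam n)) (arc x (attachParam (n + 1))) := fun n =>
    ((loop.map (continuous_pt n)).cast (arc_attachParam n) (arc_attachParam n)).trans (arcs n)
  have hp : ∀ n y, (∃ z, y = pt x n z) ∨
      (∃ s, y = arc x (mix s (attachParam n) (attachParam (n + 1)))) →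
      ∃ t, p n t = y := by
    intro n y hy
    have : y ∈ range (p n) := by
      rw [Path.trans_range]
      rcases hy with ⟨z, rfl⟩ | ⟨s, rfl⟩
      · obtain ⟨t, rfl⟩ := hloop z
        exact Or.inl ⟨t, rfl⟩
      · exact Or.inr ⟨s, rfl⟩
    exact this
  have hcoord : ∀ n t, (coord (p n t) : ℝ) ≤ attachParam n := by
    intro n t
    have : p n t ∈ range (p n) := ⟨t, rfl⟩
    rw [Path.trans_range] at this
    rcases this with ⟨s, hs⟩ | ⟨s, hs⟩ <;> rw [← hs]
    · exact le_rfl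
    · change (mix s _ _ : ℝ) ≤ _
      have : (attachParam (n + 1) : ℝ) ≤ attachParam n := by
        rw [coe_attachParam, coe_attachParam]
        exact one_div_le_one_div_of_le (by positivity) (by push_cast; linarith)
      simp only [mix]
      nlinarith [s.2.1]
  obtain ⟨P, hP1, hP⟩ := exists_infinite_concat (T := Unit)
    (fun n => ⟨fun q => p n q.2, by fun_prop⟩) (arc x 0)
    (fun n _ => (p n).target.trans (p (n + 1)).source.symm) fun U hU => by
      obtain ⟨ε, hε, h⟩ := exists_forall_coord_lt hU
      filter_upwards [tendsto_coe_attachParam.eventually (gt_mem_nhds hε)] with n hn q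
      exact h _ ((hcoord n _).trans_lt hn)
  refine ⟨⟨fun t => P ((), t), by fun_prop⟩, fun y => ?_⟩
  change ∃ t, P ((), t) = y
  rcases cases y with ⟨n, z, rfl⟩ | ⟨t, _, rfl⟩
  · obtain ⟨t, ht⟩ := hp n _ (Or.inl ⟨z, rfl⟩)
    exact ⟨stage n t, (hP _ _ _).trans ht⟩
  · by_cases h0 : t = 0
    · exact ⟨1, h0 ▸ hP1 ()⟩
    · obtain ⟨n, s, rfl⟩ := exists_mix_eq h0
      obtain ⟨t, ht⟩ := hp n _ (Or.inr ⟨s, rfl⟩)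
      exact ⟨stage n t, (hP _ _ _).trans ht⟩

end Chain

namespace AC

theorem exists_surjective_circle (x : Circle) :
    ∃ f : C(I × I, AC Circle x), Function.Surjective f := by
  obtain ⟨f, hf⟩ := Chain.exists_surjective_circle x
  refine ⟨⟨fun q => mk (f q.1) q.2, continuous_mk.comp
    ((f.continuous.comp continuous_fst).prodMk continuous_snd)⟩, fun q => ?_⟩
  induction q using ind with
  | h y t =>
    obtain ⟨s, rfl⟩ := hf y
    exact ⟨(s, t), rfl⟩

/-- The coordinates of a point of the alternating cone of a subspace of the complex plane. The
coordinate that belongs to a copy tends to `0` at the end where the copy is shrunk. -/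
noncomputable def planarCoord {x : Circle} (n : ℕ) : AC Circle x → ℂ :=
  desc (fun y s => ((|(s : ℝ) - endHeight n| : ℝ) : ℂ) *
    (((Chain.retr n y : Circle) : ℂ) - x)) fun m p => by
    by_cases h : m = n
    · subst h; simp
    · simp [Chain.retr_pt_of_ne h]

theorem continuous_planarCoord {x : Circle} (n : ℕ) :
    Continuous (planarCoord n : AC Circle x → ℂ) := by
  refine continuous_desc ?_
  have h := Chain.continuous_retr (x := x) n
  have h' : Continuous fun q : Chain Circle x × I => ((Chain.retr n q.1 : Circle) : ℂ) :=
    continuous_subtype_val.comp (h.comp continuous_fst)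
  fun_prop

theorem eq_of_coord_eq {X : Type u} [TopologicalSpace X] {x : X} {y y' : Chain X x} {s : I}
    (h : Chain.coord y = Chain.coord y')
    (h' : ∀ n, s ≠ endHeight n → Chain.retr n y = Chain.retr n y') : mk y s = mk y' s := by
  by_cases hs : ∃ n, Chain.coord y = attachParam n ∧ s = endHeight n
  · obtain ⟨n, hn, rfl⟩ := hs
    have key : ∀ y : Chain X x, Chain.coord y = attachParam n →
        mk y (endHeight n) = mk (Chain.pt x n x) (endHeight n) := by
      intro y hy
      rcases Chain.cases y with ⟨m, p, rfl⟩ | ⟨t, ht, rfl⟩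
      · obtain rfl : m = n := attachParam_injective hy
        exact mk_endHeight m p
      · exact absurd hy (ht n)
    rw [key y hn, key y' (h ▸ hn)]
  · congr 1
    refine Chain.ext h fun n => ?_
    by_cases hn : Chain.coord y = attachParam n
    · exact h' n fun hs' => hs ⟨n, hn, hs'⟩
    · rw [Chain.retr_of_coord_ne hn, Chain.retr_of_coord_ne (h ▸ hn)]

theorem injective_planarCoord {x : Circle} : Function.Injective fun q : AC Circle x =>
    (coord q, height q, fun n => planarCoord n q) := by
  intro q q' h
  induction q using ind with
  | h y s =>
    induction q' using ind with
    | h y' s' =>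
      simp only [Prod.mk.injEq, coord_mk, height_mk] at h
      obtain ⟨h1, rfl, h3⟩ := h
      refine eq_of_coord_eq h1 fun n hn => ?_
      have h4 := congrFun h3 n
      simp only [planarCoord, desc_mk] at h4
      have h5 : ((|(s : ℝ) - endHeight n| : ℝ) : ℂ) ≠ 0 := by
        simpa [sub_eq_zero] using fun h => hn (Subtype.ext h)
      have h6 := mul_left_cancel₀ h5 h4
      exact Circle.ext (by simpa using h6)

instance compactSpace_circle (x : Circle) : CompactSpace (AC Circle x) := by
  obtain ⟨f, hf⟩ := exists_surjective_circle x
  exact hf.compactSpace f.continuous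

instance metrizableSpace_circle (x : Circle) : TopologicalSpace.MetrizableSpace (AC Circle x) := by
  have h : Continuous fun q : AC Circle x => (coord q, height q, fun n => planarCoord n q) :=
    continuous_coord.prodMk (continuous_height.prodMk (continuous_pi continuous_planarCoord))
  exact (h.isClosedEmbedding injective_planarCoord).isEmbedding.metrizableSpace

theorem _root_.locallyPathConnectedSpace_unitInterval : LocallyPathConnectedSpace I :=
  (IsQuotientMap.of_inverse (f := ((↑) : I → ℝ)) (g := clampI) continuous_subtype_val
    continuous_clampI
    clampI_coe).locallyPathConnectedSpace

theorem isPeanoContinuum_circle (x : Circle) : IsPeanoContinuum (AC Circle x) := by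
  have hp : PathConnectedSpace Circle :=
    Circle.exp_surjective.pathConnectedSpace Circle.exp.continuous
  obtain ⟨f, hf⟩ := exists_surjective_circle x
  have := locallyPathConnectedSpace_unitInterval
  have := (f.continuous.isClosedMap.isQuotientMap f.continuous hf).locallyPathConnectedSpace
  exact ⟨inferInstance, inferInstance, inferInstance, inferInstance⟩

theorem not_isAspherical_circle (x : Circle) : ¬ IsAspherical (AC Circle x) := by
  have hp : PathConnectedSpace Circle :=
    Circle.exp_surjective.pathConnectedSpace Circle.exp.continuous
  intro h
  have := (subsingleton_fundamentalGroup_iff x (sq x 0 0)).2 (h 2 le_rfl _)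
  have := Circle.nontrivial_fundamentalGroup x
  exact not_subsingleton (FundamentalGroup Circle x) ‹_›

end AC

/-! ### The alternating cone of the circle is cell-like -/

namespace AC

variable {X : Type u} [TopologicalSpace X] {x : X}

/-- The retraction of the alternating cone which shrinks all but the first `N` copies of `X`. -/
noncomputable def trunc (N : ℕ) : AC X x → AC X x :=
  desc (fun y s => mk (Chain.collapse (Iio N) y) s) fun n p =>
    eq_of_coord_eq (by simp) fun m hm => by
      have hmn : n ≠ m := fun h => hm (h ▸ rfl)
      by_cases h : m < N
      · rw [Chain.retr_collapse_of_mem (s := Iio N) h,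
          Chain.retr_collapse_of_mem (s := Iio N) h, Chain.retr_pt_of_ne hmn,
          Chain.retr_pt_of_ne hmn]
      · rw [Chain.retr_collapse_of_notMem (s := Iio N) h,
          Chain.retr_collapse_of_notMem (s := Iio N) h]

theorem continuous_trunc (N : ℕ) : Continuous (trunc N : AC X x → AC X x) :=
  continuous_desc (continuous_mk.comp (((Chain.continuous_collapse _).comp continuous_fst).prodMk
    continuous_snd))

/-- The parity condition on the heights of the ends is met by a cosine of `π / t`, as `t` runs
through the parameters `1 / (n + 1)`; a bound from below on `t` makes it continuous at `0`. -/
theorem exists_heights (N : ℕ) : ∃ θ : C(I, I), ∀ n < N, θ (attachParam n) = endHeight n := by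
  refine ⟨⟨fun a => ⟨(1 + Real.cos (Real.pi / max (a : ℝ) (1 / (N + 1)))) / 2,
    by linarith [Real.neg_one_le_cos (Real.pi / max (a : ℝ) (1 / (N + 1)))],
    by linarith [Real.cos_le_one (Real.pi / max (a : ℝ) (1 / (N + 1)))]⟩,
    Continuous.subtype_mk (Continuous.div_const (continuous_const.add (Real.continuous_cos.comp
      (continuous_const.div (by fun_prop) fun a => by positivity))) _) _⟩, fun n hn => ?_⟩
  have h : max (attachParam n : ℝ) (1 / (N + 1)) = 1 / (n + 1) := by
    rw [coe_attachParam, max_eq_left]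
    have : (n : ℝ) ≤ N := by exact_mod_cast hn.le
    exact one_div_le_one_div_of_le (by positivity) (by linarith)
  refine Subtype.ext ?_
  simp only [ContinuousMap.coe_mk, h]
  have h' : Real.pi / (1 / ((n : ℝ) + 1)) = ((n + 1 : ℕ) : ℝ) * Real.pi := by
    push_cast; field_simp
  rw [h', Real.cos_nat_mul_pi]
  by_cases he : Even (n + 1)
  · rw [he.neg_one_pow, endHeight_even he]; norm_num
  · rw [(Nat.not_even_iff_odd.1 he).neg_one_pow, endHeight_odd he]; norm_num

/-- If finitely many copies of `X` are kept, then the alternating cone contracts: over each of these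
copies the height is moved to the end where the copy is shrunk. -/
theorem nullhomotopic_trunc (N : ℕ) :
    (⟨trunc N, continuous_trunc N⟩ : C(AC X x, AC X x)).Nullhomotopic := by
  obtain ⟨θ, hθ⟩ := exists_heights N
  have hwd : ∀ (t : I) (n : ℕ) (p : X),
      mk (Chain.collapse (Iio N) (Chain.pt x n p))
        (mix t (endHeight n) (θ (Chain.coord (Chain.pt x n p)))) =
      mk (Chain.collapse (Iio N) (Chain.pt x n x))
        (mix t (endHeight n) (θ (Chain.coord (Chain.pt x n x)))) := by
    intro t n p
    refine eq_of_coord_eq (by simp) fun m hm => ?_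
    by_cases h : m < N
    · rw [Chain.retr_collapse_of_mem (s := Iio N) h, Chain.retr_collapse_of_mem (s := Iio N) h]
      by_cases hmn : n = m
      · subst hmn
        rw [Chain.coord_pt, hθ n h, mix_self] at hm
        exact absurd rfl hm
      · rw [Chain.retr_pt_of_ne hmn,
          Chain.retr_pt_of_ne hmn]
    · rw [Chain.retr_collapse_of_notMem (s := Iio N) h,
          Chain.retr_collapse_of_notMem (s := Iio N) h]
  let H₁ : I → AC X x → AC X x := fun t => desc (fun y s =>
    mk (Chain.collapse (Iio N) y) (mix t s (θ (Chain.coord y)))) (hwd t)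
  have hH₁ : Continuous fun q : I × AC X x => H₁ q.1 q.2 :=
    continuous_desc_param (f := fun t y s =>
      mk (Chain.collapse (Iio N) y) (mix t s (θ (Chain.coord y)))) (continuous_mk.comp
      (((Chain.continuous_collapse _).comp (continuous_fst.comp continuous_snd)).prodMk
      (continuous_mix.comp (continuous_fst.prodMk ((continuous_snd.comp continuous_snd).prodMk
        (θ.continuous.comp (Chain.continuous_coord.comp (continuous_fst.comp continuous_snd))))))))
  have hH₁1 : ∀ q, H₁ 1 q = sq x (coord q) (θ (coord q)) := by
    intro q
    induction q using ind with
    | h y s =>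
      simp only [H₁, desc_mk, mix_one, coord_mk, sq]
      by_cases h : ∃ n < N, Chain.coord y = attachParam n
      · obtain ⟨n, hn, hy⟩ := h
        rw [hy, hθ n hn]
        refine eq_of_coord_eq (by simp [hy]) fun m hm => ?_
        have hmn : n ≠ m := fun h => hm (h ▸ rfl)
        by_cases h : m < N
        · rw [Chain.retr_collapse_of_mem (s := Iio N) h, Chain.retr_of_coord_ne, Chain.retr_arc]
          rw [hy]
          exact fun h' => hmn (attachParam_injective h')
        · rw [Chain.retr_collapse_of_notMem (s := Iio N) h, Chain.retr_arc]
      · push Not at h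
        congr 1
        refine Chain.ext (by simp) fun m => ?_
        by_cases hm : m < N
        · rw [Chain.retr_collapse_of_mem (s := Iio N) hm, Chain.retr_of_coord_ne (h m hm),
            Chain.retr_arc]
        · rw [Chain.retr_collapse_of_notMem (s := Iio N) hm, Chain.retr_arc]
  let g : C(AC X x, AC X x) := ⟨fun q => sq x (coord q) (θ (coord q)), continuous_sq.comp
    (continuous_coord.prodMk (θ.continuous.comp continuous_coord))⟩
  have h1 : (⟨trunc N, continuous_trunc N⟩ : C(AC X x, AC X x)).Homotopic g :=
    ⟨{ toFun := fun q => H₁ q.1 q.2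
       continuous_toFun := hH₁
       map_zero_left := fun q => by
        induction q using ind with
        | h y s => simp [H₁, trunc]
       map_one_left := hH₁1 }⟩
  refine ⟨sq x 0 (θ 0), h1.trans ⟨{ toFun := fun q => sq x (mix q.1 (coord q.2) 0)
                                      (θ (mix q.1 (coord q.2) 0))
                                    continuous_toFun := ?_
                                    map_zero_left := fun q => by simp [g]
                                    map_one_left := fun q => by simp }⟩⟩
  have h2 : Continuous fun q : I × AC X x => mix q.1 (coord q.2) 0 := continuous_mix.comp
    (continuous_fst.prodMk ((continuous_coord.comp continuous_snd).prodMk continuous_const))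
  exact continuous_sq.comp (h2.prodMk (θ.continuous.comp h2))

/-- The segments between the images of the points and of their images under the truncation in a
neighbourhood of the embedded alternating cone, if sufficiently many copies of `X` are kept. -/
theorem exists_forall_mix_trunc_mem (e : C(AC X x, ℕ → I)) {U : Set (ℕ → I)} (hU : IsOpen U)
    (he : ∀ q, e q ∈ U) : ∃ N, ∀ (t : I) q, (fun i => mix t (e q i) (e (trunc N q) i)) ∈ U := by
  let L : (Chain X x × Chain X x) × (I × I) → ℕ → I := fun q i =>
    mix q.2.1 (e (mk q.1.1 q.2.2) i) (e (mk q.1.2 q.2.2) i)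
  have hL : Continuous L := by
    refine continuous_pi fun i => continuous_mix.comp (Continuous.prodMk (by fun_prop)
      (Continuous.prodMk ?_ ?_))
    · exact (continuous_apply i).comp (e.continuous.comp (continuous_mk.comp
        ((continuous_fst.comp continuous_fst).prodMk (continuous_snd.comp continuous_snd))))
    · exact (continuous_apply i).comp (e.continuous.comp (continuous_mk.comp
        ((continuous_snd.comp continuous_fst).prodMk (continuous_snd.comp continuous_snd))))
  obtain ⟨W, W', hW, -, h0W, hW', hWU⟩ := generalized_tube_lemma
    (isCompact_singleton (x := (Chain.arc x 0, Chain.arc x 0))) (isCompact_univ (X := I × I))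
    (n := L ⁻¹' U) (hU.preimage hL) (by
      rintro ⟨q, t, h⟩ ⟨rfl, -⟩
      have : L ((Chain.arc x 0, Chain.arc x 0), t, h) = e (mk (Chain.arc x 0) h) := by
        ext i; simp [L]
      rw [mem_preimage, this]
      exact he _)
  obtain ⟨A, hA, B, hB, hAB⟩ := mem_nhds_prod_iff.1 (hW.mem_nhds (singleton_subset_iff.1 h0W))
  obtain ⟨ε, hε, h⟩ := Chain.exists_forall_coord_lt (inter_mem hA hB)
  obtain ⟨N, hN⟩ := eventually_atTop.1 (tendsto_coe_attachParam.eventually (gt_mem_nhds hε))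
  refine ⟨N, fun t q => ?_⟩
  induction q using ind with
  | h y s =>
    by_cases hy : (Chain.coord y : ℝ) < ε
    · refine hWU (mk_mem_prod (a := (y, Chain.collapse (Iio N) y)) (b := (t, s))
        (hAB ⟨(h y hy).1, (h _ ?_).2⟩) (hW' trivial))
      rwa [Chain.coord_collapse]
    · have h1 : trunc N (mk y s) = mk y s := by
        change mk (Chain.collapse _ y) s = mk y s
        congr 1
        refine Chain.ext (by simp) fun m => ?_
        by_cases hm : m < N
        · rw [Chain.retr_collapse_of_mem (s := Iio N) hm]
        · rw [Chain.retr_collapse_of_notMem (s := Iio N) hm, Chain.retr_of_coord_ne]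
          rintro h'
          exact hy (by rw [h']; exact hN m (not_lt.1 hm))
      rw [h1]
      simpa using he (mk y s)

theorem isCellLike_circle (x : Circle) : IsCellLike (AC Circle x) where
  compact := inferInstance
  metrizable := inferInstance
  nonempty := ⟨sq x 0 0⟩
  contractibleIn e _ U hU he := by
    obtain ⟨N, hN⟩ := exists_forall_mix_trunc_mem e hU he
    let e' : C(AC Circle x, U) := ⟨fun k => ⟨e k, he k⟩, e.continuous.subtype_mk he⟩
    obtain ⟨q, hq⟩ := nullhomotopic_trunc (x := x) N
    have h1 : e'.Homotopic (e'.comp ⟨trunc N, continuous_trunc N⟩) :=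
      ⟨{ toFun := fun q => ⟨fun i => mix q.1 (e q.2 i) (e (trunc N q.2) i), hN q.1 q.2⟩
         continuous_toFun := Continuous.subtype_mk (continuous_pi fun i => continuous_mix.comp
          (continuous_fst.prodMk (((continuous_apply i).comp (e.continuous.comp
            continuous_snd)).prodMk ((continuous_apply i).comp (e.continuous.comp
            ((continuous_trunc N).comp continuous_snd)))))) _
         map_zero_left := fun q => by simp [e']
         map_one_left := fun q => by simp [e'] }⟩
    exact ⟨e' q, h1.trans ((ContinuousMap.Homotopic.refl e').comp hq)⟩

end AC

/-! ### The alternating cone of the circle has covering dimension at most two -/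

/-- A space has dimension at most `d` if its open covers have finite open refinements whose members
are coloured by `d + 1` colours such that members of the same colour are disjoint. -/
theorem CoveringDimLE.of_coloring {K : Type u} [TopologicalSpace K] {d : ℕ}
    (h : ∀ 𝒰 : Set (Set K), (∀ U ∈ 𝒰, IsOpen U) → ⋃₀ 𝒰 = univ →
      ∃ (L : Type) (_ : Finite L) (V : Fin (d + 1) → L → Set K), (∀ c l, IsOpen (V c l)) ∧
        (∀ k, ∃ c l, k ∈ V c l) ∧ (∀ c l, ∃ U ∈ 𝒰, V c l ⊆ U) ∧
        ∀ c l l' k, k ∈ V c l → k ∈ V c l' → l = l') : CoveringDimLE K d := by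
  intro 𝒰 _ hU hcov
  obtain ⟨L, _, V, hV, hcovV, hsub, hdisj⟩ := h 𝒰 hU hcov
  refine ⟨range fun p : Fin (d + 1) × L => V p.1 p.2, finite_range _, ?_, ?_, ?_, fun k => ?_⟩
  · rintro _ ⟨p, rfl⟩
    exact hV _ _
  · refine eq_univ_of_forall fun k => ?_
    obtain ⟨c, l, hk⟩ := hcovV k
    exact ⟨_, ⟨(c, l), rfl⟩, hk⟩
  · rintro _ ⟨p, rfl⟩
    exact hsub _ _
  · have h1 : {W ∈ range fun p : Fin (d + 1) × L => V p.1 p.2 | k ∈ W} ⊆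
        (fun c => ⋃ l ∈ {l | k ∈ V c l}, V c l) '' univ := by
      rintro _ ⟨⟨⟨c, l⟩, rfl⟩, hk⟩
      refine ⟨c, trivial, ?_⟩
      have : {l | k ∈ V c l} = {l} := by
        ext l'
        exact ⟨fun h' => hdisj c l' l k h' hk, fun h' => by rw [h']; exact hk⟩
      change ⋃ l ∈ {l | k ∈ V c l}, V c l = _
      rw [this]
      simp
    refine (encard_le_encard h1).trans ((encard_image_le _ _).trans ?_)
    simp

/-- The Lebesgue number lemma for a compact space with a countable family of coordinates. -/
theorem exists_forall_dist_le_subset {K : Type*} [TopologicalSpace K] [CompactSpace K]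
    {φ : ℕ → K → ℂ} (hφ : ∀ n, Continuous (φ n)) (hinj : Function.Injective fun q n => φ n q)
    {δ : ℕ → ℝ} (hδ : Tendsto δ atTop (𝓝 0)) {𝒰 : Set (Set K)} (hU : ∀ U ∈ 𝒰, IsOpen U)
    (hcov : ⋃₀ 𝒰 = univ) :
    ∃ m : ℕ, ∀ q, ∃ U ∈ 𝒰, ∀ q', (∀ n < m, dist (φ n q) (φ n q') ≤ δ m) → q' ∈ U := by
  have hj : Continuous fun q n => φ n q := continuous_pi hφ
  have hemb := (hj.isClosedEmbedding hinj).isInducing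
  obtain ⟨E, hE, hEK⟩ := lebesgue_number_lemma_sUnion
    (S := {W : Set (ℕ → ℂ) | IsOpen W ∧ ∃ U ∈ 𝒰, (fun q n => φ n q) ⁻¹' W ⊆ U})
    (isCompact_range hj) (fun W hW => hW.1) (by
      rintro _ ⟨q, rfl⟩
      obtain ⟨U, hU', hq⟩ := (hcov ▸ mem_univ q : q ∈ ⋃₀ 𝒰)
      obtain ⟨W, hW, rfl⟩ := hemb.isOpen_iff.1 (hU U hU')
      exact ⟨W, ⟨hW, _, hU', subset_rfl⟩, hq⟩)
  by_contra! hne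
  choose q hq using hne
  have key : ∀ m, ∃ q', (∀ n < m, dist (φ n (q m)) (φ n q') ≤ δ m) ∧
      ((fun n => φ n (q m)), fun n => φ n q') ∉ E := by
    intro m
    obtain ⟨W, ⟨-, U, hU', hWU⟩, hW⟩ := hEK _ ⟨q m, rfl⟩
    obtain ⟨q', h1, h2⟩ := hq m U hU'
    exact ⟨q', h1, fun h => h2 (hWU (hW h))⟩
  choose q' hq' hE' using key
  have ht : Tendsto (fun m => ((fun n => φ n (q m)), fun n => φ n (q' m))) atTop
      (uniformity (ℕ → ℂ)) := by
    rw [Pi.uniformity, tendsto_iInf]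
    intro n
    rw [tendsto_comap_iff, tendsto_uniformity_iff_dist_tendsto_zero]
    refine squeeze_zero' (Eventually.of_forall fun _ => dist_nonneg) ?_ hδ
    filter_upwards [eventually_gt_atTop n] with m hm using hq' m n hm
  obtain ⟨m, hm⟩ := (ht.eventually hE).exists
  exact hE' m hm

/-- The intervals between consecutive points congruent to `(2 c + 1) / 6` modulo `1`. -/
def gridInterval (c : Fin 3) (k : ℤ) : Set ℝ :=
  Ioo (k - 1 + (2 * (c : ℕ) + 1) / 6) (k + (2 * (c : ℕ) + 1) / 6)

theorem grid_shift_mem (c : Fin 3) : (0 : ℝ) < (2 * (c : ℕ) + 1) / 6 ∧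
    ((2 * (c : ℕ) + 1) / 6 : ℝ) < 1 := by
  have : ((c : ℕ) : ℝ) ≤ 2 := by exact_mod_cast Nat.le_of_lt_succ c.2
  constructor
  · positivity
  · linarith

theorem int_mem_gridInterval (c : Fin 3) (k : ℤ) : (k : ℝ) ∈ gridInterval c k := by
  obtain ⟨h0, h1⟩ := grid_shift_mem c
  constructor <;> linarith

theorem eq_of_mem_gridInterval {c : Fin 3} {k k' : ℤ} {u : ℝ} (h : u ∈ gridInterval c k)
    (h' : u ∈ gridInterval c k') : k = k' := by
  have h1 : (k : ℝ) < k' + 1 := by linarith [h.1, h'.2]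
  have h2 : (k' : ℝ) < k + 1 := by linarith [h.2, h'.1]
  have h1 : k < k' + 1 := by exact_mod_cast h1
  have h2 : k' < k + 1 := by exact_mod_cast h2
  omega

theorem abs_sub_le_of_mem_gridInterval {c : Fin 3} {k : ℤ} {u u' : ℝ} (h : u ∈ gridInterval c k)
    (h' : u' ∈ gridInterval c k) : |u - u'| ≤ 1 := by
  rw [abs_le]
  constructor <;> linarith [h.1, h.2, h'.1, h'.2]

theorem add_mem_gridInterval {c : Fin 3} {k : ℤ} {u : ℝ} (h : u ∈ gridInterval c k) (z : ℤ) :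
    u + z ∈ gridInterval c (k + z) := by
  constructor <;> push_cast <;> linarith [h.1, h.2]

/-- A real number is an end point of the intervals of at most one of the three colours. -/
theorem exists_mem_gridInterval_or {c c' : Fin 3} (h : c ≠ c') (u : ℝ) :
    (∃ k, u ∈ gridInterval c k) ∨ ∃ k, u ∈ gridInterval c' k := by
  have key : ∀ c : Fin 3, (¬ ∃ k, u ∈ gridInterval c k) →
      ∃ z : ℤ, u = z + (2 * (c : ℕ) + 1) / 6 := by
    intro c hc
    refine ⟨⌊u - (2 * (c : ℕ) + 1) / 6⌋, ?_⟩
    by_contra hne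
    refine hc ⟨⌊u - (2 * (c : ℕ) + 1) / 6⌋ + 1, ?_, ?_⟩
    · have := lt_of_le_of_ne (Int.floor_le (u - (2 * (c : ℕ) + 1) / 6)) fun h => hne (by linarith)
      push_cast
      linarith
    · have := Int.lt_floor_add_one (u - (2 * (c : ℕ) + 1) / 6)
      push_cast
      linarith
  by_contra! hne
  obtain ⟨z, hz⟩ := key c fun ⟨k, hk⟩ => hne.1 k hk
  obtain ⟨z', hz'⟩ := key c' fun ⟨k, hk⟩ => hne.2 k hk
  have h1 : (3 * z + (c : ℕ) : ℝ) = 3 * z' + (c' : ℕ) := by linarith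
  have h2 : 3 * z + (c : ℕ) = 3 * z' + (c' : ℕ) := by exact_mod_cast h1
  have := c.2
  have := c'.2
  exact h (Fin.ext (by omega))

theorem mem_Icc_of_mem_gridInterval {c : Fin 3} {k : ℤ} {M : ℕ} {u : ℝ} (h : u ∈ gridInterval c k)
    (h0 : 0 ≤ u) (h1 : u ≤ M) : 0 ≤ k ∧ k ≤ M := by
  obtain ⟨hc0, hc1⟩ := grid_shift_mem c
  have h2 : ((-1 : ℤ) : ℝ) < k := by push_cast; linarith [h.2]
  have h3 : (k : ℝ) < ((M + 1 : ℤ) : ℝ) := by push_cast; linarith [h.1]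
  have h2 := Int.cast_lt.1 h2
  have h3 := Int.cast_lt.1 h3
  omega

/-- The arcs of the circle, of length `2 π / M`, which correspond to the intervals of colour `c`. -/
def gridArc (x : Circle) (M : ℕ) (c : Fin 3) (k : ℤ) : Set Circle :=
  (fun t : ℝ => x * Circle.exp (2 * Real.pi * t)) '' {t | M * t ∈ gridInterval c k}

theorem isOpen_gridArc (x : Circle) (M : ℕ) (c : Fin 3) (k : ℤ) : IsOpen (gridArc x M c k) := by
  have h : IsOpenMap fun t : ℝ => x * Circle.exp (2 * Real.pi * t) :=
    (isOpenMap_mul_left x).comp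
      (Circle.isCoveringMap_exp.isLocalHomeomorph.isOpenMap.comp
        (Homeomorph.mulLeft₀ (2 * Real.pi) Real.two_pi_pos.ne').isOpenMap)
  exact h _ (isOpen_Ioo.preimage (by fun_prop))

theorem self_mem_gridArc (x : Circle) (M : ℕ) (c : Fin 3) : x ∈ gridArc x M c 0 :=
  ⟨0, by simpa using int_mem_gridInterval c 0, by simp⟩

theorem gridArc_add (x : Circle) (M : ℕ) (c : Fin 3) (k z : ℤ) :
    gridArc x M c k ⊆ gridArc x M c (k + M * z) := by
  rintro _ ⟨t, ht, rfl⟩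
  refine ⟨t + z, ?_, ?_⟩
  · have h : (M : ℝ) * (t + z) = M * t + ((M * z : ℤ) : ℝ) := by push_cast; ring
    change (M : ℝ) * (t + z) ∈ gridInterval c _
    rw [h]
    exact add_mem_gridInterval ht _
  · change x * Circle.exp (2 * Real.pi * (t + z)) = _
    rw [mul_add, Circle.exp_add, Circle.exp_two_pi_mul_int, mul_one]

theorem eq_of_mem_gridArc {x z : Circle} {M : ℕ} {c : Fin 3} {k k' : ℤ}
    (hk : k ∈ Ico 0 (M : ℤ)) (hk' : k' ∈ Ico 0 (M : ℤ)) (h : z ∈ gridArc x M c k)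
    (h' : z ∈ gridArc x M c k') : k = k' := by
  obtain ⟨t, ht, rfl⟩ := h
  obtain ⟨t', ht', h⟩ := h'
  obtain ⟨m, hm⟩ := Circle.exp_eq_exp.1 (mul_left_cancel h)
  have hm' : t' = t + m := by
    have := Real.two_pi_pos.ne'
    field_simp at hm
    linarith
  subst hm'
  have h1 : (M : ℝ) * (t + m) = M * t + ((M * m : ℤ) : ℝ) := by push_cast; ring
  change (M : ℝ) * (t + m) ∈ gridInterval c _ at ht'
  rw [h1] at ht'
  have h2 := eq_of_mem_gridInterval (add_mem_gridInterval ht (M * m)) ht'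
  have h3 := congrArg (· % (M : ℤ)) h2
  simpa [Int.emod_eq_of_lt hk.1 hk.2, Int.emod_eq_of_lt hk'.1 hk'.2] using h3

theorem exists_mem_gridArc_or (x z : Circle) {M : ℕ} (hM : M ≠ 0) {c c' : Fin 3} (h : c ≠ c') :
    (∃ k ∈ Ico 0 (M : ℤ), z ∈ gridArc x M c k) ∨ ∃ k ∈ Ico 0 (M : ℤ), z ∈ gridArc x M c' k := by
  obtain ⟨θ, hθ⟩ := Circle.exp_surjective (x⁻¹ * z)
  have hz : x * Circle.exp (2 * Real.pi * (θ / (2 * Real.pi))) = z := by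
    rw [mul_div_cancel₀ _ Real.two_pi_pos.ne', hθ, mul_inv_cancel_left]
  have hM' : (M : ℤ) ≠ 0 := by exact_mod_cast hM
  have key : ∀ c k, M * (θ / (2 * Real.pi)) ∈ gridInterval c k →
      ∃ k ∈ Ico 0 (M : ℤ), z ∈ gridArc x M c k := fun c k hk =>
    ⟨k % M, ⟨Int.emod_nonneg _ hM', Int.emod_lt_of_pos _ (by positivity)⟩, by
      have h1 := gridArc_add x M c k (-(k / M)) ⟨_, hk, hz⟩
      rwa [show k + M * -(k / M) = k % M by rw [Int.emod_def]; ring] at h1⟩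
  rcases exists_mem_gridInterval_or h (M * (θ / (2 * Real.pi))) with ⟨k, hk⟩ | ⟨k, hk⟩
  · exact Or.inl (key c k hk)
  · exact Or.inr (key c' k hk)

theorem norm_sub_le_of_mem_gridArc {x z z' : Circle} {M : ℕ} (hM : M ≠ 0) {c : Fin 3} {k : ℤ}
    (h : z ∈ gridArc x M c k) (h' : z' ∈ gridArc x M c k) : ‖(z : ℂ) - z'‖ ≤ 7 / M := by
  obtain ⟨t, ht, rfl⟩ := h
  obtain ⟨t', ht', rfl⟩ := h'
  have hM' : (0 : ℝ) < M := by positivity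
  have h1 : Circle.exp (2 * Real.pi * t) =
      Circle.exp (2 * Real.pi * t') * Circle.exp (2 * Real.pi * (t - t')) := by
    rw [← Circle.exp_add]; congr 1; ring
  have h2 : |t - t'| ≤ 1 / M := by
    rw [le_div_iff₀ hM', ← abs_of_pos hM', ← abs_mul]
    simpa [sub_mul, mul_comm] using abs_sub_le_of_mem_gridInterval ht ht'
  simp only [h1, Circle.coe_mul, ← mul_assoc]
  rw [show ∀ a b : ℂ, a * b - a = a * (b - 1) from fun a b => by ring, norm_mul, norm_mul]
  rw [Circle.norm_coe, Circle.norm_coe, one_mul, one_mul, Circle.coe_exp]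
  rw [mul_comm _ Complex.I]
  refine Real.norm_exp_I_mul_ofReal_sub_one_le.trans ?_
  rw [Real.norm_eq_abs, abs_mul, abs_of_pos Real.two_pi_pos]
  calc 2 * Real.pi * |t - t'| ≤ 7 * (1 / M) :=
        mul_le_mul (by linarith [Real.pi_lt_d2]) h2 (abs_nonneg _) (by norm_num)
    _ = 7 / M := by ring

/-- If each of two properties fails for at most one of three colours, some colour has both. -/
theorem exists_and_of_forall_or {P Q : Fin 3 → Prop} (hP : ∀ c c', c ≠ c' → P c ∨ P c')
    (hQ : ∀ c c', c ≠ c' → Q c ∨ Q c') : ∃ c, P c ∧ Q c := by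
  by_contra! h
  rcases hP 0 1 (by decide) with h0 | h0 <;> rcases hP 1 2 (by decide) with h1 | h1 <;>
  rcases hP 0 2 (by decide) with h2 | h2 <;>
  simp_all <;> have := hQ 0 1 <;> have := hQ 1 2 <;> have := hQ 0 2 <;> simp_all

namespace AC

theorem planarCoord_eq {x : Circle} (n : ℕ) (q : AC Circle x) :
    planarCoord n q = ((|(height q : ℝ) - endHeight n| : ℝ) : ℂ) * ((retr n q : Circle) - x) := by
  induction q using ind with
  | h y s =>
    by_cases hs : s = endHeight n
    · simp [planarCoord, hs]
    · simp [planarCoord, retr_mk_of_ne hs]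

/-- The cell with the indices `i` and `j` of the grid of colour `c` and mesh `1 / M` on the square,
enlarged by the arcs with the indices `κ n` in the first `m` copies of the circle, except for those
copies which are shrunk at a height in the range of the cell. -/
def coloredCell (x : Circle) (M m : ℕ) (c : Fin 3) (i j : ℤ) (κ : ℕ → ℤ) : Set (AC Circle x) :=
  {q | M * (coord q : ℝ) ∈ gridInterval c i ∧ M * (height q : ℝ) ∈ gridInterval c j ∧
    ∀ n < m, M * (endHeight n : ℝ) ∉ gridInterval c j → retr n q ∈ gridArc x M c (κ n)}

variable {x : Circle} {M m : ℕ} {c : Fin 3}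

theorem isOpen_coloredCell (i j : ℤ) (κ : ℕ → ℤ) : IsOpen (coloredCell x M m c i j κ) := by
  have h0 : IsOpen {q : AC Circle x | M * (coord q : ℝ) ∈ gridInterval c i ∧
      M * (height q : ℝ) ∈ gridInterval c j} := by
    have hc := continuous_coord (x := x)
    have hh := continuous_height (x := x)
    exact (isOpen_Ioo.preimage (by fun_prop)).inter (isOpen_Ioo.preimage (by fun_prop))
  have h1 : ∀ n, M * (endHeight n : ℝ) ∉ gridInterval c j →
      IsOpen ({q : AC Circle x | M * (coord q : ℝ) ∈ gridInterval c i ∧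
      M * (height q : ℝ) ∈ gridInterval c j} ∩ retr n ⁻¹' gridArc x M c (κ n)) := fun n hn =>
    ((continuousOn_retr n).mono fun q hq hq' => hn (hq'.2 ▸ hq.2)).isOpen_inter_preimage h0
      (isOpen_gridArc _ _ _ _)
  have h2 : coloredCell x M m c i j κ = {q : AC Circle x | M * (coord q : ℝ) ∈ gridInterval c i ∧
      M * (height q : ℝ) ∈ gridInterval c j} ∩
      ⋂ n ∈ {n | n < m ∧ M * (endHeight n : ℝ) ∉ gridInterval c j},
      ({q : AC Circle x | M * (coord q : ℝ) ∈ gridInterval c i ∧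
      M * (height q : ℝ) ∈ gridInterval c j} ∩ retr n ⁻¹' gridArc x M c (κ n)) := by
    ext q
    simp only [coloredCell, mem_inter_iff, mem_ofPred_eq, mem_iInter, mem_preimage]
    exact ⟨fun h => ⟨⟨h.1, h.2.1⟩, fun n hn => ⟨⟨h.1, h.2.1⟩, h.2.2 n hn.1 hn.2⟩⟩,
      fun h => ⟨h.1.1, h.1.2, fun n h1 h2 => (h.2 n ⟨h1, h2⟩).2⟩⟩
  rw [h2]
  exact h0.inter (((finite_lt_nat m).subset fun n hn => hn.1).isOpen_biInter fun n hn => h1 n hn.2)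

theorem dist_le_of_mem_coloredCell (hM : M ≠ 0) {i j : ℤ} {κ : ℕ → ℤ} {q q' : AC Circle x}
    (h : q ∈ coloredCell x M m c i j κ) (h' : q' ∈ coloredCell x M m c i j κ) :
    |(coord q : ℝ) - coord q'| ≤ 1 / M ∧ |(height q : ℝ) - height q'| ≤ 1 / M ∧
    ∀ n < m, ‖planarCoord n q - planarCoord n q'‖ ≤ 9 / M := by
  have hM' : (0 : ℝ) < M := by positivity
  have key : ∀ {k : ℤ} {u u' : ℝ}, M * u ∈ gridInterval c k → M * u' ∈ gridInterval c k →
      |u - u'| ≤ 1 / M := fun {k u u'} hu hu' => by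
    rw [le_div_iff₀ hM', ← abs_of_pos hM', ← abs_mul]
    simpa [sub_mul, mul_comm] using abs_sub_le_of_mem_gridInterval hu hu'
  have hhh := key h.2.1 h'.2.1
  refine ⟨key h.1 h'.1, hhh, fun n hn => ?_⟩
  have hx : ∀ z : Circle, ‖(z : ℂ) - x‖ ≤ 2 := fun z => (norm_sub_le _ _).trans (by
    rw [Circle.norm_coe, Circle.norm_coe]; norm_num)
  rw [planarCoord_eq, planarCoord_eq]
  have h9 : 7 / (M : ℝ) + 1 / M * 2 = 9 / M := by ring
  by_cases he : M * (endHeight n : ℝ) ∈ gridInterval c j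
  · have h1 := key h.2.1 he
    have h2 := key h'.2.1 he
    refine (norm_sub_le _ _).trans ?_
    rw [norm_mul, norm_mul, Complex.norm_real, Complex.norm_real, Real.norm_eq_abs, abs_abs,
      Real.norm_eq_abs, abs_abs]
    calc _ ≤ 1 / (M : ℝ) * 2 + 1 / M * 2 := by
          gcongr
          exacts [hx _, hx _]
      _ ≤ 9 / M := by
          rw [← h9]
          have : 1 / (M : ℝ) * 2 ≤ 7 / M := by
            rw [div_mul_eq_mul_div]; gcongr; norm_num
          linarith
  · have h3 := norm_sub_le_of_mem_gridArc hM (h.2.2 n hn he) (h'.2.2 n hn he)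
    have e : ∀ a b r r' y : ℂ, a * (r - y) - b * (r' - y) = a * (r - r') + (a - b) * (r' - y) :=
      fun _ _ _ _ _ => by ring
    rw [e]
    refine (norm_add_le _ _).trans ?_
    rw [norm_mul, norm_mul, ← Complex.ofReal_sub, Complex.norm_real, Complex.norm_real,
      Real.norm_eq_abs, abs_abs, ← h9]
    have h4 : |(height q : ℝ) - endHeight n| ≤ 1 := by
      rw [abs_le]
      constructor <;>
        linarith [(height q).2.1, (height q).2.2, (endHeight n).2.1, (endHeight n).2.2]
    have h5 : ‖|(height q : ℝ) - endHeight n| - |(height q' : ℝ) - endHeight n|‖ ≤ 1 / M := by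
      refine (abs_abs_sub_abs_le_abs_sub _ _).trans ?_
      simpa using hhh
    refine add_le_add ?_ (mul_le_mul h5 (hx _) (norm_nonneg _) (by positivity))
    calc _ ≤ 1 * (7 / (M : ℝ)) := mul_le_mul h4 h3 (norm_nonneg _) zero_le_one
      _ = _ := one_mul _

theorem exists_mem_coloredCell (hM : M ≠ 0)
    (hp : ∀ n < m, ∃ k : ℤ, M * (attachParam n : ℝ) = k) (q : AC Circle x) :
    ∃ c i j, ∃ κ : ℕ → ℤ, q ∈ coloredCell x M m c i j κ ∧ ∀ n, κ n ∈ Ico 0 (M : ℤ) := by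
  have hM0 : (0 : ℤ) ∈ Ico 0 (M : ℤ) := ⟨le_rfl, by positivity⟩
  -- At most one of the colours is excluded by the height, and at most one by the other coordinates.
  obtain ⟨c, ⟨⟨i, hi⟩, hκ⟩, j, hj⟩ := exists_and_of_forall_or
    (P := fun c => (∃ i, M * (coord q : ℝ) ∈ gridInterval c i) ∧
      ∀ n < m, ∃ k ∈ Ico 0 (M : ℤ), retr n q ∈ gridArc x M c k)
    (Q := fun c => ∃ j, M * (height q : ℝ) ∈ gridInterval c j) (fun c c' hcc => by
      by_cases h : ∃ n < m, retr n q ≠ x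
      · obtain ⟨n, hn, hq⟩ := h
        have hc : coord q = attachParam n := not_not.1 fun h => hq (retr_of_coord_ne h)
        obtain ⟨k, hk⟩ := hp n hn
        have hne : ∀ n', n' ≠ n → retr n' q = x := fun n' h => retr_of_coord_ne fun h' =>
          h (attachParam_injective (h'.symm.trans hc))
        have key : ∀ c, (∃ k ∈ Ico 0 (M : ℤ), retr n q ∈ gridArc x M c k) →
            (∃ i, M * (coord q : ℝ) ∈ gridInterval c i) ∧
            ∀ n < m, ∃ k ∈ Ico 0 (M : ℤ), retr n q ∈ gridArc x M c k := by
          refine fun c h => ⟨⟨k, by rw [hc, hk]; exact int_mem_gridInterval c k⟩, fun n' _ => ?_⟩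
          by_cases hn' : n' = n
          · exact hn' ▸ h
          · exact ⟨0, hM0, by rw [hne n' hn']; exact self_mem_gridArc x M c⟩
        exact (exists_mem_gridArc_or x (retr n q) hM hcc).imp (key c) (key c')
      · push Not at h
        have key : ∀ c, (∃ i, M * (coord q : ℝ) ∈ gridInterval c i) →
            (∃ i, M * (coord q : ℝ) ∈ gridInterval c i) ∧
            ∀ n < m, ∃ k ∈ Ico 0 (M : ℤ), retr n q ∈ gridArc x M c k := fun c h' =>
          ⟨h', fun n hn => ⟨0, hM0, by rw [h n hn]; exact self_mem_gridArc x M c⟩⟩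
        exact (exists_mem_gridInterval_or hcc _).imp (key c) (key c'))
    (fun c c' hcc => exists_mem_gridInterval_or hcc _)
  choose! κ h1 h2 using hκ
  refine ⟨c, i, j, fun n => if n < m then κ n else 0, ⟨hi, hj, fun n hn _ => ?_⟩, fun n => ?_⟩
  · simp only [if_pos hn]
    exact h2 n hn
  · dsimp only
    split_ifs with hn
    exacts [h1 n hn, hM0]

theorem coveringDimLE_two_circle (x : Circle) : CoveringDimLE (AC Circle x) 2 := by
  refine CoveringDimLE.of_coloring fun 𝒰 hU hcov => ?_
  let φ : ℕ → AC Circle x → ℂ := fun n => match n with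
    | 0 => fun q => ((coord q : ℝ) : ℂ)
    | 1 => fun q => ((height q : ℝ) : ℂ)
    | n + 2 => planarCoord n
  have hφ : ∀ n, Continuous (φ n) := fun n => match n with
    | 0 => Complex.continuous_ofReal.comp (continuous_subtype_val.comp continuous_coord)
    | 1 => Complex.continuous_ofReal.comp (continuous_subtype_val.comp continuous_height)
    | n + 2 => continuous_planarCoord n
  have hinj : Function.Injective fun q n => φ n q := fun q q' h => injective_planarCoord (by
    simp only [Prod.mk.injEq]
    exact ⟨Subtype.ext (Complex.ofReal_injective (congrFun h 0)),
      Subtype.ext (Complex.ofReal_injective (congrFun h 1)), funext fun n => congrFun h (n + 2)⟩)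
  have hδ : Tendsto (fun m : ℕ => 9 / (m.factorial : ℝ)) atTop (𝓝 0) :=
    tendsto_const_nhds.div_atTop (tendsto_natCast_atTop_atTop.comp
      (tendsto_atTop_mono Nat.self_le_factorial tendsto_id))
  obtain ⟨m, hm⟩ := exists_forall_dist_le_subset hφ hinj hδ hU hcov
  have hM := m.factorial_ne_zero
  have hp : ∀ n < m, ∃ k : ℤ, m.factorial * (attachParam n : ℝ) = k := fun n hn => by
    obtain ⟨k, hk⟩ := Nat.dvd_factorial n.succ_pos hn
    refine ⟨k, ?_⟩
    rw [hk, coe_attachParam]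
    push_cast
    field_simp
  generalize hMm : m.factorial = M at *
  -- The heights at the ends of the cylinders are integral multiples of the mesh, too.
  let J : Finset ℤ := Finset.Icc 0 (M : ℤ)
  let A : Finset ℤ := Finset.Ico 0 (M : ℤ)
  have hA0 : (0 : ℤ) ∈ A := Finset.mem_Ico.2 ⟨le_rfl, by positivity⟩
  let ext : (Fin m → A) → ℕ → ℤ := fun κ n => if h : n < m then κ ⟨n, h⟩ else 0
  let V : Fin 3 → J × J × (Fin m → A) → Set (AC Circle x) := fun c l =>
    {q | q ∈ coloredCell x M m c l.1 l.2.1 (ext l.2.2) ∧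
      ∀ n : Fin m, M * (endHeight n : ℝ) ∈ gridInterval c l.2.1 → (l.2.2 n : ℤ) = 0}
  refine ⟨J × J × (Fin m → A), inferInstance, V, fun c l => ?_, fun q => ?_, fun c l => ?_,
    fun c l l' q hq hq' => ?_⟩
  · by_cases h : ∀ n : Fin m, M * (endHeight n : ℝ) ∈ gridInterval c l.2.1 → (l.2.2 n : ℤ) = 0
    · have hV : V c l = coloredCell x M m c l.1 l.2.1 (ext l.2.2) :=
        Set.ext fun q => ⟨fun h' => h'.1, fun h' => ⟨h', h⟩⟩
      exact hV ▸ isOpen_coloredCell _ _ _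
    · have hV : V c l = ∅ := eq_empty_of_forall_notMem fun q h' => h h'.2
      exact hV ▸ isOpen_empty
  · obtain ⟨c, i, j, κ, hq, hκ⟩ := exists_mem_coloredCell hM hp q
    have hi := mem_Icc_of_mem_gridInterval hq.1 (mul_nonneg M.cast_nonneg (coord q).2.1)
      (mul_le_of_le_one_right M.cast_nonneg (coord q).2.2)
    have hj := mem_Icc_of_mem_gridInterval hq.2.1 (mul_nonneg M.cast_nonneg (height q).2.1)
      (mul_le_of_le_one_right M.cast_nonneg (height q).2.2)
    classical
    refine ⟨c, (⟨i, Finset.mem_Icc.2 hi⟩, ⟨j, Finset.mem_Icc.2 hj⟩, fun n =>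
      if M * (endHeight n : ℝ) ∈ gridInterval c j then ⟨0, hA0⟩
        else ⟨κ n, Finset.mem_Ico.2 (hκ n)⟩), ⟨hq.1, hq.2.1, fun n hn he => ?_⟩, fun n hn => ?_⟩
    · simpa [ext, hn, he] using hq.2.2 n hn he
    · simp [hn]
  · rcases (V c l).eq_empty_or_nonempty with he | ⟨q, hq⟩
    · obtain ⟨U, hU', -⟩ := hm (sq x 0 0)
      exact ⟨U, hU', he ▸ empty_subset _⟩
    · obtain ⟨U, hU', h⟩ := hm q
      refine ⟨U, hU', fun q' hq' => h q' fun n hn => ?_⟩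
      obtain ⟨h1, h2, h3⟩ := dist_le_of_mem_coloredCell hM hq.1 hq'.1
      have h19 : 1 / (M : ℝ) ≤ 9 / M := by gcongr; norm_num
      match n with
      | 0 =>
        refine le_trans ?_ h19
        simpa [φ, dist_eq_norm, ← Complex.ofReal_sub] using h1
      | 1 =>
        refine le_trans ?_ h19
        simpa [φ, dist_eq_norm, ← Complex.ofReal_sub] using h2
      | n + 2 =>
        rw [dist_eq_norm]
        exact h3 n (by omega)
  · obtain ⟨⟨h1, h2, h3⟩, h4⟩ := hq
    obtain ⟨⟨h1', h2', h3'⟩, h4'⟩ := hq'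
    have hi : l.1 = l'.1 := Subtype.ext (eq_of_mem_gridInterval h1 h1')
    have hj : l.2.1 = l'.2.1 := Subtype.ext (eq_of_mem_gridInterval h2 h2')
    refine Prod.ext hi (Prod.ext hj (funext fun n => Subtype.ext ?_))
    by_cases he : M * (endHeight n : ℝ) ∈ gridInterval c l.2.1
    · rw [h4 n he, h4' n (hj ▸ he)]
    · have h5 := h3 n n.2 he
      have h6 := h3' n n.2 (hj ▸ he)
      simp only [ext, n.2, dif_pos] at h5 h6
      exact eq_of_mem_gridArc (Finset.mem_Ico.1 (l.2.2 n).2) (Finset.mem_Ico.1 (l'.2.2 n).2) h5 h6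

end AC

/-! ### The alternating cone of the circle has covering dimension at least two -/

theorem abs_sub_lt_pi_of_cos_pos {f : ℝ → ℝ} (hf : Continuous f) {α : ℝ}
    (h : ∀ t ∈ Icc (0 : ℝ) 1, 0 < Real.cos (f t - α)) : |f 1 - f 0| < Real.pi := by
  have key : ∀ g : ℝ → ℝ, Continuous g → (∀ t ∈ Icc (0 : ℝ) 1, 0 < Real.cos (g t)) →
      g 1 - g 0 < Real.pi := by
    intro g hg hpos
    by_contra! hle
    obtain ⟨t, ht, hgt⟩ := intermediate_value_Icc zero_le_one hg.continuousOn
      (⟨by linarith [Real.pi_pos], by linarith⟩ : g 0 + Real.pi ∈ Icc (g 0) (g 1))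
    have h0 := hpos 0 ⟨le_rfl, zero_le_one⟩
    have h1 := hpos t ht
    rw [hgt, Real.cos_add_pi] at h1
    linarith
  have h1 := key (fun t => f t - α) (by fun_prop) h
  have h2 := key (fun t => -(f t - α)) (by fun_prop) fun t ht => by
    rw [Real.cos_neg]; exact h t ht
  rw [abs_lt]
  constructor <;> linarith

/-- A map from the square to the boundary of a triangle, in homogeneous barycentric coordinates
`g`, has a continuous polar angle `L`. -/
theorem exists_polar_angle {g : Fin 3 → I × I → ℝ} (hg : ∀ i, Continuous (g i))
    (h0 : ∀ q, ∃ i, g i q = 0) (h1 : ∀ q, ∃ i, g i q ≠ 0) :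
    ∃ (L : C(ℝ × ℝ, ℝ)) (r : ℝ × ℝ → ℝ), (∀ q, 0 < r q) ∧ ∀ (q : ℝ × ℝ) (α : ℝ),
      r q * Real.cos (L q - α) =
        ∑ i, g i (clampI q.1, clampI q.2) * Real.cos (2 * Real.pi * (i : ℕ) / 3 - α) := by
  let p : ℝ × ℝ → I × I := fun q => (clampI q.1, clampI q.2)
  have hp : Continuous p := (continuous_clampI.comp continuous_fst).prodMk
    (continuous_clampI.comp continuous_snd)
  let z : ℝ × ℝ → ℂ := fun q =>
    ∑ i, (g i (p q) : ℂ) * Complex.exp (((2 * Real.pi * (i : ℕ) / 3 : ℝ) : ℂ) * Complex.I)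
  have hz : Continuous z := continuous_finsetSum _ fun i _ =>
    (Complex.continuous_ofReal.comp ((hg i).comp hp)).mul continuous_const
  have hre : ∀ q (α : ℝ), (z q * Complex.exp (((-α : ℝ) : ℂ) * Complex.I)).re =
      ∑ i, g i (p q) * Real.cos (2 * Real.pi * (i : ℕ) / 3 - α) := by
    intro q α
    simp only [z, Finset.sum_mul, Complex.re_sum]
    refine Finset.sum_congr rfl fun i _ => ?_
    rw [mul_assoc, ← Complex.exp_add, ← add_mul, ← Complex.ofReal_add, Complex.re_ofReal_mul,
      Complex.exp_ofReal_mul_I_re, sub_eq_add_neg]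
  have hz0 : ∀ q, z q ≠ 0 := by
    intro q hq
    have h2 : ∀ α : ℝ, ∑ i, g i (p q) * Real.cos (2 * Real.pi * (i : ℕ) / 3 - α) = 0 := fun α => by
      rw [← hre, hq, zero_mul, Complex.zero_re]
    have c1 : Real.cos (2 * Real.pi / 3) = -1 / 2 := by
      rw [show 2 * Real.pi / 3 = Real.pi - Real.pi / 3 by ring, Real.cos_pi_sub,
        Real.cos_pi_div_three]
      ring
    have c2 : Real.cos (2 * Real.pi * 2 / 3) = -1 / 2 := by
      rw [show 2 * Real.pi * 2 / 3 = Real.pi / 3 + Real.pi by ring, Real.cos_add_pi,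
        Real.cos_pi_div_three]
      ring
    have e0 := h2 0
    have e1 := h2 (2 * Real.pi / 3)
    simp only [Fin.sum_univ_three, Fin.val_zero, Fin.val_one, Fin.val_two, Nat.cast_zero,
      Nat.cast_one, Nat.cast_ofNat, mul_zero, zero_div, mul_one, sub_zero, zero_sub, Real.cos_zero,
      Real.cos_neg, sub_self, c1, c2] at e0 e1
    rw [show 2 * Real.pi * 2 / 3 - 2 * Real.pi / 3 = 2 * Real.pi / 3 by ring, c1] at e1
    have e2 : g 0 (p q) = g 1 (p q) := by linarith
    have e3 : g 0 (p q) = g 2 (p q) := by linarith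
    obtain ⟨i, hi⟩ := h0 (p q)
    obtain ⟨j, hj⟩ := h1 (p q)
    refine hj ?_
    fin_cases i <;> fin_cases j <;> simp at hi ⊢ <;> linarith
  have hzn : Continuous fun q => z q / (‖z q‖ : ℂ) :=
    hz.div (by fun_prop) fun q => by simpa using hz0 q
  have hmem : ∀ q, z q / (‖z q‖ : ℂ) ∈ Submonoid.unitSphere ℂ := fun q => by
    simp [Submonoid.unitSphere, hz0 q]
  let φ : C(ℝ × ℝ, Circle) := ⟨fun q => ⟨z q / (‖z q‖ : ℂ), hmem q⟩, hzn.subtype_mk hmem⟩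
  obtain ⟨θ, hθ⟩ := Circle.exp_surjective (φ 0)
  obtain ⟨L, ⟨-, hL⟩, -⟩ := Circle.isCoveringMap_exp.existsUnique_continuousMap_lifts φ 0 θ hθ
  refine ⟨L, fun q => ‖z q‖, fun q => norm_pos_iff.2 (hz0 q), fun q α => ?_⟩
  rw [← hre]
  have h3 : z q = ‖z q‖ * Complex.exp (L q * Complex.I) := by
    have h4 : ((Circle.exp (L q) : Circle) : ℂ) = z q / ‖z q‖ :=
      congrArg Subtype.val (congrFun hL q)
    rw [← Circle.coe_exp, h4, mul_div_cancel₀]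
    simpa using hz0 q
  conv_rhs => rw [h3]
  rw [mul_assoc, ← Complex.exp_add, ← add_mul, ← Complex.ofReal_add, Complex.re_ofReal_mul,
    Complex.exp_ofReal_mul_I_re, sub_eq_add_neg]

/-- A form of the theorem of Knaster, Kuratowski and Mazurkiewicz for the square, whose right and
upper sides are regarded as one side of a triangle. -/
theorem nonempty_inter_of_cover_square {V : Fin 3 → Set (I × I)} (hV : ∀ i, IsOpen (V i))
    (hcov : ∀ q, ∃ i, q ∈ V i) (h0 : ∀ s, (0, s) ∉ V 0) (h1 : ∀ t, (t, 0) ∉ V 1)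
    (h2 : ∀ s, (1, s) ∉ V 2) (h2' : ∀ t, (t, 1) ∉ V 2) : ∃ q, ∀ i, q ∈ V i := by
  by_contra! hne
  have hVne : ∀ i, (V i)ᶜ.Nonempty := fun i => match i with
    | 0 => ⟨(0, 0), h0 0⟩
    | 1 => ⟨(0, 0), h1 0⟩
    | 2 => ⟨(1, 1), h2 1⟩
  let g : Fin 3 → I × I → ℝ := fun i q => Metric.infDist q (V i)ᶜ
  have hg0 : ∀ i q, 0 ≤ g i q := fun i q => Metric.infDist_nonneg
  have hgV : ∀ i q, q ∈ V i ↔ 0 < g i q := fun i q => by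
    rw [← (hV i).isClosed_compl.notMem_iff_infDist_pos (hVne i), mem_compl_iff, not_not]
  have hgz : ∀ i q, q ∉ V i → g i q = 0 := fun i q h =>
    le_antisymm (not_lt.1 fun h' => h ((hgV i q).2 h')) (hg0 i q)
  obtain ⟨L, r, hr, hL⟩ := exists_polar_angle (g := g) (fun i => Metric.continuous_infDist_pt _)
    (fun q => (hne q).imp fun i hi => hgz i q hi)
    (fun q => (hcov q).imp fun i hi => ((hgV i q).1 hi).ne')
  simp only [Fin.sum_univ_three, Fin.val_zero, Fin.val_one, Fin.val_two, Nat.cast_zero,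
      Nat.cast_one, Nat.cast_ofNat, mul_zero, zero_div, mul_one] at hL
  have hc3 : Real.cos (Real.pi / 3) = 1 / 2 := Real.cos_pi_div_three
  have hpos : ∀ q : I × I, 0 < g 0 q + g 1 q + g 2 q := fun q => by
    obtain ⟨i, hi⟩ := hcov q
    have := (hgV i q).1 hi
    have := hg0 0 q
    have := hg0 1 q
    have := hg0 2 q
    fin_cases i <;> simp at * <;> linarith
  -- On every side of the triangle, the polar angle varies by less than `π`.
  have hside : ∀ (q : ℝ × ℝ) (α : ℝ), (g 0 (clampI q.1, clampI q.2) *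
      Real.cos (0 - α) + g 1 (clampI q.1, clampI q.2) * Real.cos (2 * Real.pi / 3 - α) +
      g 2 (clampI q.1, clampI q.2) * Real.cos (2 * Real.pi * 2 / 3 - α)) =
      (g 0 (clampI q.1, clampI q.2) + g 1 (clampI q.1, clampI q.2) +
        g 2 (clampI q.1, clampI q.2)) * (1 / 2) → 0 < Real.cos (L q - α) := by
    intro q α h
    rw [← hL] at h
    exact pos_of_mul_pos_right (h ▸ mul_pos (hpos _) (by norm_num)) (hr q).le
  have hleft : ∀ s, 0 < Real.cos (L (0, s) - Real.pi) := fun s => hside _ _ (by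
    rw [show 2 * Real.pi / 3 - Real.pi = -(Real.pi / 3) by ring,
      show 2 * Real.pi * 2 / 3 - Real.pi = Real.pi / 3 by ring, Real.cos_neg, hc3]
    simp only [clampI_zero, hgz 0 _ (h0 _)]
    ring)
  have hbot : ∀ t, 0 < Real.cos (L (t, 0) - -(Real.pi / 3)) := fun t => hside _ _ (by
    rw [show 2 * Real.pi * 2 / 3 - -(Real.pi / 3) = -(Real.pi / 3) + 2 * Real.pi by ring,
      Real.cos_add_two_pi, Real.cos_neg, sub_neg_eq_add, zero_add, hc3]
    simp only [clampI_zero, hgz 1 _ (h1 _)]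
    ring)
  have hright : ∀ q : ℝ × ℝ, (clampI q.1, clampI q.2) ∉ V 2 →
      0 < Real.cos (L q - Real.pi / 3) := fun q hq => hside _ _ (by
    rw [show 2 * Real.pi / 3 - Real.pi / 3 = Real.pi / 3 by ring, zero_sub, Real.cos_neg, hc3,
      hgz 2 _ hq]
    ring)
  have hcorner : ∀ (q : ℝ × ℝ) (i : Fin 3), (∀ j ≠ i, (clampI q.1, clampI q.2) ∉ V j) →
      ∃ k : ℤ, L q = 2 * Real.pi * (i : ℕ) / 3 + k * (2 * Real.pi) := by
    intro q i hi
    have hq : ∀ α, r q * Real.cos (L q - α) =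
        g i (clampI q.1, clampI q.2) * Real.cos (2 * Real.pi * (i : ℕ) / 3 - α) := by
      intro α
      rw [hL]
      fin_cases i
      · simp [hgz 1 _ (hi 1 (by decide)), hgz 2 _ (hi 2 (by decide))]
      · simp [hgz 0 _ (hi 0 (by decide)), hgz 2 _ (hi 2 (by decide))]
      · simp [hgz 0 _ (hi 0 (by decide)), hgz 1 _ (hi 1 (by decide))]
    have hgi : 0 < g i (clampI q.1, clampI q.2) := by
      obtain ⟨j, hj⟩ := hcov (clampI q.1, clampI q.2)
      have : j = i := not_not.1 fun h => hi j h hj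
      exact (hgV i _).1 (this ▸ hj)
    have e1 := hq (2 * Real.pi * (i : ℕ) / 3)
    have e2 := hq (2 * Real.pi * (i : ℕ) / 3 + Real.pi / 2)
    rw [sub_self, Real.cos_zero, mul_one] at e1
    rw [← sub_sub, Real.cos_sub_pi_div_two, ← sub_sub, sub_self, zero_sub, Real.cos_neg,
      Real.cos_pi_div_two, mul_zero] at e2
    have e3 : Real.sin (L q - 2 * Real.pi * (i : ℕ) / 3) = 0 :=
      (mul_eq_zero.1 e2).resolve_left (hr q).ne'
    have e4 : 0 < Real.cos (L q - 2 * Real.pi * (i : ℕ) / 3) :=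
      pos_of_mul_pos_right (e1 ▸ hgi) (hr q).le
    have e5 : Real.cos (L q - 2 * Real.pi * (i : ℕ) / 3) = 1 := by
      rcases Real.sin_eq_zero_iff_cos_eq.1 e3 with h | h
      · exact h
      · rw [h] at e4; norm_num at e4
    obtain ⟨k, hk⟩ := (Real.cos_eq_one_iff _).1 e5
    exact ⟨k, by linarith⟩
  obtain ⟨k, hk⟩ := hcorner (1, 0) 0 fun j hj => by
    simp only [clampI_zero, clampI_one]
    fin_cases j
    exacts [absurd rfl hj, h1 1, h2 0]
  obtain ⟨k', hk'⟩ := hcorner (0, 1) 1 fun j hj => by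
    simp only [clampI_zero, clampI_one]
    fin_cases j
    exacts [h0 1, absurd rfl hj, h2' 0]
  obtain ⟨k'', hk''⟩ := hcorner (0, 0) 2 fun j hj => by
    simp only [clampI_zero]
    fin_cases j
    exacts [h0 0, h1 0, absurd rfl hj]
  have a1 := abs_sub_lt_pi_of_cos_pos (f := fun s => L (0, s)) (by fun_prop) fun s _ => hleft s
  have a2 := abs_sub_lt_pi_of_cos_pos (f := fun t => L (t, 0)) (by fun_prop) fun t _ => hbot t
  have a3 := abs_sub_lt_pi_of_cos_pos (f := fun t => L (min 1 (2 - 2 * t), min 1 (2 * t)))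
    (by fun_prop) (α := Real.pi / 3) fun t _ => hright _ (by
      rcases le_total t (1 / 2) with h | h
      · rw [min_eq_left (by linarith : (1 : ℝ) ≤ 2 - 2 * t), clampI_one]
        exact h2 _
      · rw [min_eq_left (by linarith : (1 : ℝ) ≤ 2 * t), clampI_one]
        exact h2' _)
  norm_num at a3
  simp only [Fin.val_zero, Fin.val_one, Fin.val_two, Nat.cast_zero, Nat.cast_one,
    Nat.cast_ofNat] at hk hk' hk''
  rw [hk', hk''] at a1
  rw [hk, hk''] at a2
  rw [hk, hk'] at a3
  have hpi := Real.pi_pos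
  have b : ∀ u v : ℤ, |2 * Real.pi / 3 * u - 2 * Real.pi / 3 * v| < Real.pi → |u - v| ≤ 1 := by
    intro u v h
    rw [← mul_sub, abs_mul, abs_of_pos (by positivity), ← Int.cast_sub, ← Int.cast_abs] at h
    by_contra! h2
    have h3 : (2 : ℝ) ≤ (|u - v| : ℤ) := by exact_mod_cast h2
    nlinarith
  have b1 := b (3 * k' + 1) (3 * k'' + 2) (by convert a1 using 2; push_cast; ring)
  have b2 := b (3 * k) (3 * k'' + 2) (by convert a2 using 2; push_cast; ring)
  have b3 := b (3 * k' + 1) (3 * k) (by convert a3 using 2; push_cast; ring)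
  rw [abs_le] at b1 b2 b3
  omega

namespace AC

theorem not_coveringDimLE_of_lt_two {X : Type u} [TopologicalSpace X] (x : X) {m : ℕ} (hm : m < 2) :
    ¬ CoveringDimLE (AC X x) m := by
  intro h
  let U : Fin 3 → Set (AC X x) := fun i => match i with
    | 0 => {q | coord q ≠ 0}
    | 1 => {q | height q ≠ 0}
    | 2 => {q | coord q ≠ 1 ∧ height q ≠ 1}
  have hU : ∀ i, IsOpen (U i) := fun i => match i with
    | 0 => isOpen_ne.preimage continuous_coord
    | 1 => isOpen_ne.preimage continuous_height
    | 2 => (isOpen_ne.preimage continuous_coord).inter (isOpen_ne.preimage continuous_height)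
  obtain ⟨𝒱, -, hV, hcov, hVU, hcard⟩ := h (range U) (finite_range U)
    (by rintro _ ⟨i, rfl⟩; exact hU i) (eq_univ_of_forall fun q => by
      by_cases h0 : coord q = 0
      · by_cases h1 : height q = 0
        · exact ⟨U 2, ⟨2, rfl⟩, by simp [U, h0, h1]⟩
        · exact ⟨U 1, ⟨1, rfl⟩, h1⟩
      · exact ⟨U 0, ⟨0, rfl⟩, h0⟩)
  have hidx : ∀ V ∈ 𝒱, ∃ i, V ⊆ U i := fun V hV => by
    obtain ⟨_, ⟨i, rfl⟩, hi⟩ := hVU V hV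
    exact ⟨i, hi⟩
  choose! f hf using hidx
  let W : Fin 3 → Set (AC X x) := fun i => ⋃₀ {V ∈ 𝒱 | f V = i}
  have hWU : ∀ i, W i ⊆ U i := fun i => sUnion_subset fun V hV => hV.2 ▸ hf V hV.1
  obtain ⟨q, hq⟩ := nonempty_inter_of_cover_square
    (V := fun i => (fun q : I × I => sq x q.1 q.2) ⁻¹' W i)
    (fun i => (isOpen_sUnion fun V hV' => hV V hV'.1).preimage continuous_sq)
    (fun q => by
      obtain ⟨V, hV', hq⟩ := (hcov ▸ mem_univ (sq x q.1 q.2) : sq x q.1 q.2 ∈ ⋃₀ 𝒱)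
      exact ⟨f V, V, ⟨hV', rfl⟩, hq⟩)
    (fun s hs => hWU 0 hs rfl) (fun t ht => hWU 1 ht rfl) (fun s hs => (hWU 2 hs).1 rfl)
    (fun t ht => (hWU 2 ht).2 rfl)
  choose V hV' hqV using hq
  have hinj : Function.Injective V := fun i j hij => by
    rw [← (hV' i).2, ← (hV' j).2, hij]
  have h3 : range V ⊆ {V ∈ 𝒱 | sq x q.1 q.2 ∈ V} := by
    rintro _ ⟨i, rfl⟩
    exact ⟨(hV' i).1, hqV i⟩
  have h4 : (3 : ℕ∞) ≤ (m : ℕ∞) + 1 := by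
    refine le_trans (le_of_eq ?_) ((encard_le_encard h3).trans (hcard _))
    rw [← image_univ, hinj.injOn.encard_image]
    simp
  have h5 : 3 ≤ m + 1 := by exact_mod_cast h4
  omega

theorem hasCoveringDim_circle (x : Circle) : HasCoveringDim (AC Circle x) 2 :=
  ⟨coveringDimLE_two_circle x, fun _ => not_coveringDimLE_of_lt_two x⟩

end AC

theorem theorem4 :
    (∀ (X : Type u) [TopologicalSpace X] [PathConnectedSpace X] (x p : X) (q : AC X x),
      Subsingleton (FundamentalGroup X p) ↔ Subsingleton (π_ 2 (AC X x) q)) ∧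
    (∀ x : Circle,
      IsPeanoContinuum (AC Circle x) ∧ IsCellLike (AC Circle x) ∧
      HasCoveringDim (AC Circle x) 2 ∧ ¬ IsAspherical (AC Circle x)) :=
  ⟨fun _ _ _ _ p q => AC.subsingleton_fundamentalGroup_iff p q, fun x =>
    ⟨AC.isPeanoContinuum_circle x, AC.isCellLike_circle x, AC.hasCoveringDim_circle x,
      AC.not_isAspherical_circle x⟩⟩
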